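/- \textbf{Setting.} Let $M$ be a smooth (Hausdorff, second countable, finite-dimensional) manifold, $H\subset TM$ a smooth bracket-generating subbundle and $g$ a smoothly varying inner product on the fibres of $H$. Put $H_0=0$, $H_1=H$, and let $(H_{i+1})_x$ be spanned by $(H_i)_x$ and the vectors $[A,B]_x$ with $A\in C^\infty(H_i)$, $B\in C^\infty(H)$. Assume that $M$ is \emph{equiregular of step size} $r\ge 1$: $H_r=TM$, $H_{r-1}\ne TM$ if $r\geq 2$, and $H_1,\dots,H_r$ have constant rank. Let $\widehat H_m=H_m/H_{m-1}$, $d_m=\operatorname{rank}\widehat H_m$, and $[v]_m\in\widehat H_m$ the class of $v\in H_m$. For $a,b$ represented at $x$ by sections $A$ of $H_k$, $B$ of $H_m$ let $B^{k,m}(a,b)=[-[A,B]_x]_{k+m}$. Give $\widehat H_1=H$ the inner product $g$; identify $\widehat H_2$ with $(\ker\pi_1)^\perp\subset\wedge^2H$, where $\pi_1(X\wedge Y)=B^{1,1}(X,Y)$, and for $j\ge2$ identify $\widehat H_{j+1}$ with $(\ker\tilde\pi_j)^\perp\subset H\otimes\widehat H_j$, where $\tilde\pi_j(X\otimes b)=B^{1,j}(X,b)$;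 this successively defines inner products on all $\widehat H_m$, and dual ones on $\widehat H_m^*$. For $\phi\in\widehat H_{m+1}^*$ define $\mathcal J^{m,1}(\phi)\colon\widehat H_m\to H$ by $\langle\mathcal J^{m,1}(\phi)a,b\rangle=\phi(B^{m,1}(a,b))$. $M$ is \emph{semi-$\mathcal J$-nondegenerate} if for every $x\in M$, every $2\le k\le r$ and every orthonormal basis $(\phi^1,\dots,\phi^{d_k})$ of $(\widehat H_k)_x^*$ the linear map \[(\widehat H_{k-1})_x^{d_k}\to M_{d_k\times d_k}(H_x),\qquad (Z_1,\dots,Z_{d_k})\mapsto\bigl(\mathcal J^{k-1,1}(\phi^i)Z_j+\mathcal J^{k-1,1}(\phi^j)Z_i\bigr)_{i,j}\] is injective. A \emph{graded complement} is a sum $V=V_2\oplus\dots\oplus V_r$ of smooth subbundles $V_m$ with $H_m=H_{m-1}\oplus V_m$; it carries the inner product for which the $V_m$ are mutually orthogonal and each $V_m\cong\widehat H_m$ isometrically. An \emph{$m$-coframe} is a column $\varphi=(\phi^1,\dots,\phi^{d_m})$ of covectors annihilating $H_{m-1}$ whose classes form an orthonormal basis of $\widehat H_m^*$. An \emph{$(m,k)$-frame}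 $(k<m)$ is a row of $d_m$ elements of $H_m/H_k$ whose classes form an orthonormal frame of $\widehat H_m$; it is dual to $\varphi$ if $\phi^i(E_j)=\delta_{ij}$. Up to orthonormal changes of frame, an $(m,k)$-frame is the same as a subspace $W\subset H_m$ with $W+H_{m-1}=H_m$ and $W\cap H_{m-1}=H_k$. For coframe fields $\varphi$ and rows $E$ of vectors at $x$, let $\mathcal A(\varphi,E)$ and $\mathcal S(\varphi,E)$ be the $H_x$-valued matrices with $\langle\mathcal A(\varphi,E)_{ij},X\rangle=d\phi^i(E_j,X)$ and $\langle\mathcal S(\varphi,E)_{ij},X\rangle=d\phi^i(E_j,X)+d\phi^j(E_i,X)$ for $X\in H_x$, and let $\|\cdot\|^2$ of such a matrix be the sum of the squared norms of its entries. \textbf{Algorithm.} Subbundles $W_m^k\subset H_m$ $(2\le m\le r,\ 0\le k<m)$ with $W_m^k+H_{m-1}=H_m$, $W_m^k\cap H_{m-1}=H_k$ and $W_m^{k-1}\subset W_m^{k}$ for $1\leq k<m$ (so $W_m^{m-1}=H_m$) are selected successively for $k=r-1,r-2,\dots,0$. Given $W_m^k$ for all $m>k$, where $k\ge1$, let $\varphi^{k+1}$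 be any smooth local $(k+1)$-coframe field whose entries annihilate $H_k$ and all $W_j^k$, $j>k+1$. \begin{itemize} \item For $m>k+1$: among the $(m,k-1)$-frames in $W_m^k$ that represent a given $(m,k)$-frame of $W_m^k$, the one in $W_m^{k-1}$ is the unique minimizer of $\|\mathcal A(\varphi^{k+1},\cdot)\|$, at each point. \item For $m=k+1\ge3$: among the $(m,k-1)$-frames in $W_m^k$ dual to $\varphi^{k+1}$, the one in $W_m^{k-1}$ is the unique minimizer of $\|\mathcal S(\varphi^{k+1},\cdot)\|$, at each point. \item For $m=2$, $k=1$, after all $W_m^0$ with $m\ge3$ have been found: let $R=\sum_{m=3}^r\operatorname{tr}\mathcal S(\varphi^m,E^m)$ with $\varphi^m$ as above and $E^m$ the frame of $W_m^0$ dual to $\varphi^m$. The frame in $W_2^0$ dual to $\varphi^2$ is the unique minimizer of $\|\mathcal S(\varphi^2,F)\|$, at each point, among the $(2,0)$-frames $F$ dual to $\varphi^2$ with $\operatorname{tr}\mathcal S(\varphi^2,F)=-R$. \end{itemize} \textbf{Theorem A.} Let $M$ be a semi-$\mathcal J$-nondegenerate, equiregular sub-Riemannian manifold of step size $r$. Then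 the algorithm can be carried out with smooth subbundles $W_m^k$, which are uniquely determined, and the subbundles $V_m=W_m^0$, $2\le m\le r$, form a graded complement $V=V_2\oplus\dots\oplus V_r$ to $H$ (the \emph{minimal rigid complement}) that is \begin{itemize} \item natural: $F_*V_m=V_m$ for all $m$ and every weak $H$-isometry $F$, i.e. every diffeomorphism $F\colon M\to M$ with $F_*H=H$ and $F^*g=g$; \item $V$-rigid: for every smooth local orthonormal frame $(U_i)$ of $V$ with dual frame $(\psi^i)$ (the one-forms with $\psi^i(U_j)=\delta_{ij}$ and $\psi^i|_H=0$), $\sum_i d\psi^i(U_i,X)=0$ for all horizontal vectors $X\in H$. \end{itemize} -/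

import Mathlib

open scoped Manifold ContDiff TensorProduct Topology

noncomputable section

namespace SubRiem

section Basic

variable (E : Type*) [NormedAddCommGroup E] [NormedSpace ℝ E]
variable (M : Type*) [TopologicalSpace M] [ChartedSpace E M]

/-- Vector fields (no regularity). -/
abbrev VField := ∀ x : M, TangentSpace 𝓘(ℝ, E) x

/-- One-forms (no regularity). -/
abbrev OneForm := ∀ x : M, TangentSpace 𝓘(ℝ, E) x →L[ℝ] ℝ

/-- Families of subspaces of the tangent spaces (no regularity). -/
abbrev Distr := ∀ x : M, Submodule ℝ (TangentSpace 𝓘(ℝ, E) x)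

end Basic

section Fields

variable {E : Type*} [NormedAddCommGroup E] [NormedSpace ℝ E]
variable {M : Type*} [TopologicalSpace M] [ChartedSpace E M]

/-- The vector field `X` is smooth at the point `x`. -/
def VField.SmoothAt [IsManifold 𝓘(ℝ, E) ∞ M] (X : VField E M) (x : M) : Prop :=
  ContMDiffAt 𝓘(ℝ, E) 𝓘(ℝ, E).tangent ∞ (fun y => (⟨y, X y⟩ : TangentBundle 𝓘(ℝ, E) M)) x

/-- The vector field `X` is smooth at every point of `O`. -/
def VField.SmoothOn [IsManifold 𝓘(ℝ, E) ∞ M] (X : VField E M) (O : Set M) : Prop :=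
  ContMDiffOn 𝓘(ℝ, E) 𝓘(ℝ, E).tangent ∞ (fun y => (⟨y, X y⟩ : TangentBundle 𝓘(ℝ, E) M)) O

/-- The vector field `X` is smooth on the whole manifold. -/
def VField.Smooth [IsManifold 𝓘(ℝ, E) ∞ M] (X : VField E M) : Prop :=
  ContMDiff 𝓘(ℝ, E) 𝓘(ℝ, E).tangent ∞ (fun y => (⟨y, X y⟩ : TangentBundle 𝓘(ℝ, E) M))

/-- The one-form `φ` is smooth on `O`, as a section of the cotangent bundle. -/
def OneForm.SmoothOn [IsManifold 𝓘(ℝ, E) ∞ M] (φ : OneForm E M) (O : Set M) : Prop :=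
  ContMDiffOn 𝓘(ℝ, E) (𝓘(ℝ, E).prod 𝓘(ℝ, E →L[ℝ] ℝ)) ∞
    (fun y => Bundle.TotalSpace.mk' (E →L[ℝ] ℝ)
      (E := fun y : M => TangentSpace 𝓘(ℝ, E) y →L[ℝ] Bundle.Trivial M ℝ y) y (φ y)) O

/-- The derivative `v f` of the function `f` in the direction of the tangent vector `v`. -/
def dirDeriv (f : M → ℝ) (x : M) (v : TangentSpace 𝓘(ℝ, E) x) : ℝ :=
  mfderiv 𝓘(ℝ, E) 𝓘(ℝ, ℝ) f x v

/-- The bilinear form `θ` is the exterior derivative of `φ` at `x`: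
`dφ(U, X) = U (φ X) - X (φ U) - φ [U, X]` for all vector fields `U`, `X` smooth at `x`. -/
def IsExtDeriv [IsManifold 𝓘(ℝ, E) ∞ M] (φ : OneForm E M) (x : M)
    (θ : LinearMap.BilinForm ℝ (TangentSpace 𝓘(ℝ, E) x)) : Prop :=
  ∀ U X : VField E M, U.SmoothAt x → X.SmoothAt x →
    θ (U x) (X x) = dirDeriv (fun y => φ y (X y)) x (U x) - dirDeriv (fun y => φ y (U y)) x (X x)
      - φ x (VectorField.mlieBracket 𝓘(ℝ, E) U X x)

/-- The exterior derivative of the one-form `φ` at `x`, as a bilinear form on the tangent space;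
it is used for one-forms that are smooth near `x`, where there is exactly one such form. -/
def extDer [IsManifold 𝓘(ℝ, E) ∞ M] (φ : OneForm E M) (x : M) :
    LinearMap.BilinForm ℝ (TangentSpace 𝓘(ℝ, E) x) :=
  Classical.epsilon (IsExtDeriv φ x)

/-- `D` is a smooth subbundle of the tangent bundle: it has smooth local frames. -/
def IsSmoothSubbundle [IsManifold 𝓘(ℝ, E) ∞ M] (D : Distr E M) : Prop :=
  ∀ x : M, ∃ O : Set M, IsOpen O ∧ x ∈ O ∧ ∃ (k : ℕ) (X : Fin k → VField E M),
    (∀ i, (X i).SmoothOn O) ∧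
    ∀ y ∈ O, LinearIndependent ℝ (fun i => X i y) ∧
      Submodule.span ℝ (Set.range fun i => X i y) = D y

/-- The nested sequence `0 = H₀ ⊆ H₁ = H ⊆ H₂ ⊆ …`, where `H_{i+1}` is spanned at each point by
`H_i` and the brackets `[A, B]` of smooth sections `A` of `H_i` and `B` of `H`. -/
def flag [IsManifold 𝓘(ℝ, E) ∞ M] (H : Distr E M) : ℕ → Distr E M
  | 0 => fun _ => ⊥
  | 1 => H
  | (i + 2) => fun x => flag H (i + 1) x ⊔ Submodule.span ℝ
      {v | ∃ A B : VField E M, A.Smooth ∧ B.Smooth ∧ (∀ y, A y ∈ flag H (i + 1) y) ∧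
        (∀ y, B y ∈ H y) ∧ v = VectorField.mlieBracket 𝓘(ℝ, E) A B x}

end Fields

section LinearAlgebra

variable {W U : Type*} [AddCommGroup W] [Module ℝ W] [AddCommGroup U] [Module ℝ U]

/-- For a surjective linear map `p : W → U` and an inner product `b` on `W`, the inner product on
`U` obtained by identifying `U` with `(ker p)^⊥` through `p`. -/
def quotForm (p : W →ₗ[ℝ] U) (b : LinearMap.BilinForm ℝ W) : LinearMap.BilinForm ℝ U :=
  Classical.epsilon fun β : LinearMap.BilinForm ℝ U =>
    ∀ w ∈ b.orthogonal (LinearMap.ker p), ∀ w' ∈ b.orthogonal (LinearMap.ker p),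
      β (p w) (p w') = b w w'

/-- The inner product on `⋀² W` induced by an inner product `b` on `W`: it is determined by
`⟨X ∧ Y, Z ∧ T⟩ = b X Z * b Y T - b X T * b Y Z`. -/
def wedgeForm (b : LinearMap.BilinForm ℝ W) : LinearMap.BilinForm ℝ (⋀[ℝ]^2 W) :=
  exteriorPower.pairingDual ℝ W 2 ∘ₗ exteriorPower.map 2 b

/-- `f` is an orthonormal basis for the inner product `b`. -/
def IsOrthonormalBasis (b : LinearMap.BilinForm ℝ U) {d : ℕ} (f : Fin d → U) : Prop :=
  (∀ i j, b (f i) (f j) = if i = j then 1 else 0) ∧ Submodule.span ℝ (Set.range f) = ⊤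

/-- `φ` is an orthonormal basis of the dual space for the dual of the inner product `b`,
that is, the dual basis of an orthonormal basis for `b`. -/
def IsOrthonormalCobasis (b : LinearMap.BilinForm ℝ U) {d : ℕ}
    (φ : Fin d → Module.Dual ℝ U) : Prop :=
  ∃ f : Fin d → U, IsOrthonormalBasis b f ∧ ∀ i j, φ i (f j) = if i = j then 1 else 0

end LinearAlgebra

/-- A sub-Riemannian structure on the manifold `M`: a smooth bracket-generating subbundle `H` of the
tangent bundle with a smoothly varying inner product `g` on its fibres. -/
structure SubRiemannian (E : Type*) [NormedAddCommGroup E] [NormedSpace ℝ E]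
    (M : Type*) [TopologicalSpace M] [ChartedSpace E M] [IsManifold 𝓘(ℝ, E) ∞ M] where
  /-- the horizontal bundle -/
  H : Distr E M
  /-- the inner product on the fibres of the horizontal bundle -/
  g : ∀ x : M, LinearMap.BilinForm ℝ (H x)
  smooth_H : IsSmoothSubbundle H
  g_symm : ∀ x v w, g x v w = g x w v
  g_pos : ∀ x v, v ≠ 0 → 0 < g x v v
  smooth_g : ∀ (X Y : VField E M) (hX : ∀ x, X x ∈ H x) (hY : ∀ x, Y x ∈ H x),
    X.Smooth → Y.Smooth →
    ContMDiff 𝓘(ℝ, E) 𝓘(ℝ, ℝ) ∞ (fun x => g x ⟨X x, hX x⟩ ⟨Y x, hY x⟩)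
  bracketGenerating : ∀ x, ∃ i, flag H i x = ⊤

namespace SubRiemannian

variable {E : Type*} [NormedAddCommGroup E] [NormedSpace ℝ E]
variable {M : Type*} [TopologicalSpace M] [ChartedSpace E M] [IsManifold 𝓘(ℝ, E) ∞ M]
variable (S : SubRiemannian E M)

/-- `M` is equiregular of step size `r`: `H_r` is the tangent bundle, `H_{r-1}` is not, and
`H_1, …, H_r` have constant rank. (For `r = 1` nothing is required of `H_0`, so that
a manifold of dimension zero has step size one.) -/
structure IsEquiregular (r : ℕ) : Prop where
  one_le : 1 ≤ r
  eq_top : ∀ x, flag S.H r x = ⊤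
  ne_top : 2 ≤ r → ∃ x, flag S.H (r - 1) x ≠ ⊤
  const_rank : ∀ i, 1 ≤ i → i ≤ r → ∃ n : ℕ, ∀ x, Module.finrank ℝ (flag S.H i x) = n

/-- The quotient `Ĥ_m = H_m / H_{m-1}` at `x`. -/
abbrev Hat (m : ℕ) (x : M) : Type _ :=
  flag S.H m x ⧸ (flag S.H (m - 1) x).submoduleOf (flag S.H m x)

/-- The class `[v]_m` in `Ĥ_m` of a vector `v` of `H_m`. -/
def cls (m : ℕ) (x : M) : flag S.H m x →ₗ[ℝ] S.Hat m x :=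
  ((flag S.H (m - 1) x).submoduleOf (flag S.H m x)).mkQ

/-- The defining property of the bracket form `B^{k,1} : Ĥ_k × H → Ĥ_{k+1}`:
`B^{k,1}([A]_k, B) = [-[A, B]]_{k+1}` for smooth sections `A` of `H_k` and `B` of `H`. -/
def IsBracketForm (k : ℕ) (x : M) (β : S.Hat k x →ₗ[ℝ] S.H x →ₗ[ℝ] S.Hat (k + 1) x) : Prop :=
  ∀ (A B : VField E M) (hA : ∀ y, A y ∈ flag S.H k y) (hB : ∀ y, B y ∈ S.H y),
    A.Smooth → B.Smooth →
    ∀ c : flag S.H (k + 1) x,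
      (c : TangentSpace 𝓘(ℝ, E) x) = -VectorField.mlieBracket 𝓘(ℝ, E) A B x →
      β (S.cls k x ⟨A x, hA x⟩) ⟨B x, hB x⟩ = S.cls (k + 1) x c

/-- The bracket form `B^{k,1}`, for `k ≥ 1`; on an equiregular manifold there is exactly one
bilinear map with the defining property. -/
def bracketForm (k : ℕ) (x : M) : S.Hat k x →ₗ[ℝ] S.H x →ₗ[ℝ] S.Hat (k + 1) x :=
  Classical.epsilon (S.IsBracketForm k x)

/-- The linear map `π₁ : ⋀² H → Ĥ_2` with `X ∧ Y ↦ B^{1,1}(X, Y)`. -/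
def piOne (x : M) : ⋀[ℝ]^2 (S.H x) →ₗ[ℝ] S.Hat 2 x :=
  Classical.epsilon fun p : ⋀[ℝ]^2 (S.H x) →ₗ[ℝ] S.Hat 2 x =>
    ∀ X Y : S.H x, p (exteriorPower.ιMulti ℝ 2 ![X, Y]) = S.bracketForm 1 x (S.cls 1 x X) Y

/-- The linear map `π_j : H ⊗ Ĥ_j → Ĥ_{j+1}` with `X ⊗ b ↦ B^{1,j}(X, b) = -B^{j,1}(b, X)`. -/
def piTensor (j : ℕ) (x : M) : (S.H x ⊗[ℝ] S.Hat j x) →ₗ[ℝ] S.Hat (j + 1) x :=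
  TensorProduct.lift (-(S.bracketForm j x).flip)

/-- The inner product on `Ĥ_m`: that of `H` for `m = 1`, and then successively the ones obtained by
identifying `Ĥ_2` with `(ker π₁)^⊥` in `⋀² H` and `Ĥ_{j+1}` with `(ker π_j)^⊥` in `H ⊗ Ĥ_j` for
`j ≥ 2`. (The value for `m = 0` is not used.) -/
def hatForm (x : M) : (m : ℕ) → LinearMap.BilinForm ℝ (S.Hat m x)
  | 0 => 0
  | 1 => quotForm (S.cls 1 x) (S.g x)
  | 2 => quotForm (S.piOne x) (wedgeForm (S.g x))
  | (j + 3) => quotForm (S.piTensor (j + 2) x) ((S.g x).tmul (hatForm x (j + 2)))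

/-- The inner product on `H` is nondegenerate. -/
theorem g_nondegenerate (x : M) : (S.g x).Nondegenerate := by
  constructor
  · intro v hv
    by_contra hne
    exact (S.g_pos x v hne).ne' (hv v)
  · intro v hv
    by_contra hne
    exact (S.g_pos x v hne).ne' (hv v)

variable [FiniteDimensional ℝ E]

instance finiteDimensional_H (x : M) : FiniteDimensional ℝ (S.H x) :=
  haveI : FiniteDimensional ℝ (TangentSpace 𝓘(ℝ, E) x) := inferInstanceAs (FiniteDimensional ℝ E)
  inferInstance

/-- The Riesz isomorphism `H^* ≃ H`: `g (sharp α) X = α X`. -/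
def sharp (x : M) : Module.Dual ℝ (S.H x) ≃ₗ[ℝ] S.H x :=
  ((S.g x).toDual (S.g_nondegenerate x)).symm

/-- The map `𝒥^{m,1}` that sends `φ` in the dual of `Ĥ_{m+1}` to the element of `Hom(Ĥ_m, H)` with
`g (𝒥 φ a) b = φ (B^{m,1}(a, b))`. -/
def J (m : ℕ) (x : M) (φ : Module.Dual ℝ (S.Hat (m + 1) x)) : S.Hat m x →ₗ[ℝ] S.H x :=
  (S.sharp x).toLinearMap ∘ₗ (S.bracketForm m x).compr₂ φ

/-- Semi-`𝒥`-nondegeneracy, for step size `r`: at every point, for `1 ≤ k < r` and every orthonormal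
coframe `φ` of `Ĥ_{k+1}`, the map sending the row vector `Z` with entries in `Ĥ_k` to the matrix
`(𝒥 φ_i Z_j + 𝒥 φ_j Z_i)` with entries in `H` is injective. -/
def IsSemiJNondegenerate (r : ℕ) : Prop :=
  ∀ (x : M) (k : ℕ), 1 ≤ k → k + 1 ≤ r →
    ∀ (d : ℕ) (φ : Fin d → Module.Dual ℝ (S.Hat (k + 1) x)),
      IsOrthonormalCobasis (S.hatForm x (k + 1)) φ →
      Function.Injective fun (Z : Fin d → S.Hat k x) (i j : Fin d) =>
        S.J k x (φ i) (Z j) + S.J k x (φ j) (Z i)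

/-- The row vector `e` consists of vectors of `H_m` at `x` whose classes form an orthonormal frame
of `Ĥ_m`. -/
def IsFrameAt (m : ℕ) (x : M) {d : ℕ} (e : Fin d → TangentSpace 𝓘(ℝ, E) x) : Prop :=
  ∃ he : ∀ i, e i ∈ flag S.H m x,
    IsOrthonormalBasis (S.hatForm x m) fun i => S.cls m x ⟨e i, he i⟩

/-- The column vector `φ` is an `m`-coframe at `x`: its entries annihilate `H_{m-1}`, and it is dual
to an orthonormal frame of `Ĥ_m`. -/
def IsCoframeAt (m : ℕ) (x : M) {d : ℕ} (φ : Fin d → TangentSpace 𝓘(ℝ, E) x →L[ℝ] ℝ) : Prop :=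
  (∀ i, ∀ v ∈ flag S.H (m - 1) x, φ i v = 0) ∧
  ∃ e : Fin d → TangentSpace 𝓘(ℝ, E) x, S.IsFrameAt m x e ∧
    ∀ i j, φ i (e j) = if i = j then 1 else 0

/-- The matrix `𝒜(φ, e)` at `x` with entries in `H`: `g (𝒜(φ, e)ᵢⱼ) X = dφᵢ(eⱼ, X)`. -/
def matA (x : M) {d d' : ℕ} (φ : Fin d → OneForm E M) (e : Fin d' → TangentSpace 𝓘(ℝ, E) x)
    (i : Fin d) (j : Fin d') : S.H x :=
  S.sharp x ((extDer (φ i) x (e j)).comp (S.H x).subtype)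

/-- The matrix `𝒮(φ, e)` at `x` with entries in `H`:
`g (𝒮(φ, e)ᵢⱼ) X = dφᵢ(eⱼ, X) + dφⱼ(eᵢ, X)`. -/
def matS (x : M) {d : ℕ} (φ : Fin d → OneForm E M) (e : Fin d → TangentSpace 𝓘(ℝ, E) x)
    (i j : Fin d) : S.H x :=
  S.matA x φ e i j + S.matA x φ e j i

/-- The squared norm `∑ᵢⱼ ‖Aᵢⱼ‖²` of a matrix with entries in `H`. -/
def normSq (x : M) {d d' : ℕ} (A : Fin d → Fin d' → S.H x) : ℝ :=
  ∑ i, ∑ j, S.g x (A i j) (A i j)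

/-- The trace of a square matrix with entries in `H`. -/
def tr (x : M) {d : ℕ} (A : Fin d → Fin d → S.H x) : S.H x :=
  ∑ i, A i i

/-- `φ` is a smooth `m`-coframe field near `x` with entries in the bundle `V^m` of covectors that
annihilate `H_{m-1}` and `W_j^{m-1}` for `m < j ≤ r`; here `W_j^k` is written `W j k`. -/
def IsAdaptedCoframe (r : ℕ) (W : ℕ → ℕ → Distr E M) (m : ℕ) (x : M) {d : ℕ}
    (φ : Fin d → OneForm E M) : Prop :=
  ∃ O : Set M, IsOpen O ∧ x ∈ O ∧ (∀ i, (φ i).SmoothOn O) ∧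
    ∀ y ∈ O, S.IsCoframeAt m y (fun i => φ i y) ∧
      ∀ i j, m < j → j ≤ r → ∀ v ∈ W j (m - 1) y, φ i y v = 0

/-- The run of the algorithm that produces the minimal rigid complement.

An `(m, k)`-frame (a row vector with entries in `H_m / H_k` whose class is an orthonormal frame of
`Ĥ_m`), up to orthogonal changes of frame, is the same as a subspace `W` of `H_m` with
`W + H_{m-1} = H_m` and `W ∩ H_{m-1} = H_k`: the span of the entries and `H_k`. In these terms
`W m k` is the section of equivalence classes of `(m, k)`-frames that has been selected.

The algorithm starts from `W r (r - 1) = H_r`, the only possibility. For `k = r - 1, …, 1` it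
passes from the `W m k` with `m > k` to the `W m (k - 1)` with `m > k`, by selecting inside `W m k`
the unique class of `(m, k - 1)`-frames for which the norm of `𝒜` (for `m > k + 1`) or of
`𝒮` (for `m = k + 1`) is minimal, with respect to a `(k+1)`-coframe field with entries in
`V^{k+1}`; it then adds `W k (k - 1) = H_k`, the only possibility. In the last selection, that
of `W 2 0` inside `W 2 1`, the norm of `𝒮` is minimized under the constraint
`tr 𝒮(φ², F) = -R`, where `R = ∑_{m ≥ 3} tr 𝒮(φᵐ, Eᵐ)`. -/
structure IsMinimalRigidRun (r : ℕ) (W : ℕ → ℕ → Distr E M) : Prop where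
  /-- `W m k` is a smooth section of equivalence classes of `(m, k)`-frames. -/
  smooth : ∀ m k, 2 ≤ m → m ≤ r → k < m → IsSmoothSubbundle (W m k)
  sup_eq : ∀ m k, 2 ≤ m → m ≤ r → k < m → ∀ x,
    W m k x ⊔ flag S.H (m - 1) x = flag S.H m x
  inf_eq : ∀ m k, 2 ≤ m → m ≤ r → k < m → ∀ x,
    W m k x ⊓ flag S.H (m - 1) x = flag S.H k x
  /-- Each selection is made inside the previous one. -/
  nested : ∀ m k, 2 ≤ m → m ≤ r → 1 ≤ k → k < m → ∀ x, W m (k - 1) x ≤ W m k x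
  /-- Selection by `𝒜`: an `m`-frame `e` in `W m (k - 1)` has strictly smaller norm than
  every frame `e'` in `W m k` with the same class in `Ĥ_m` and a different class modulo
  `H_{k-1}`. -/
  min_A : ∀ m k, 1 ≤ k → k + 2 ≤ m → m ≤ r →
    ∀ (x : M) (d d' : ℕ) (φ : Fin d → OneForm E M) (e e' : Fin d' → TangentSpace 𝓘(ℝ, E) x),
      S.IsAdaptedCoframe r W (k + 1) x φ →
      S.IsFrameAt m x e → (∀ j, e j ∈ W m (k - 1) x) →
      (∀ j, e' j ∈ W m k x) → (∀ j, e' j - e j ∈ flag S.H (m - 1) x) →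
      (∃ j, e' j - e j ∉ flag S.H (k - 1) x) →
      S.normSq x (S.matA x φ e) < S.normSq x (S.matA x φ e')
  /-- Selection by `𝒮`, for frames dual to the coframe. -/
  min_S : ∀ k, 2 ≤ k → k + 1 ≤ r →
    ∀ (x : M) (d : ℕ) (φ : Fin d → OneForm E M) (e e' : Fin d → TangentSpace 𝓘(ℝ, E) x),
      S.IsAdaptedCoframe r W (k + 1) x φ →
      (∀ j, e j ∈ W (k + 1) (k - 1) x) → (∀ i j, φ i x (e j) = if i = j then 1 else 0) →
      (∀ j, e' j ∈ W (k + 1) k x) → (∀ i j, φ i x (e' j) = if i = j then 1 else 0) →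
      (∃ j, e' j - e j ∉ flag S.H (k - 1) x) →
      S.normSq x (S.matS x φ e) < S.normSq x (S.matS x φ e')
  /-- The last selection: the constraint is satisfied, and the norm of `𝒮` is strictly smaller
  than at every other `(2, 0)`-frame in `W 2 1` that satisfies it. -/
  final : 2 ≤ r → ∀ (x : M) (d : ℕ → ℕ) (φ : (m : ℕ) → Fin (d m) → OneForm E M)
      (e : (m : ℕ) → Fin (d m) → TangentSpace 𝓘(ℝ, E) x) (R : S.H x),
      (∀ m, 2 ≤ m → m ≤ r → S.IsAdaptedCoframe r W m x (φ m)) →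
      (∀ m, 2 ≤ m → m ≤ r → ∀ j, e m j ∈ W m 0 x) →
      (∀ m, 2 ≤ m → m ≤ r → ∀ i j, φ m i x (e m j) = if i = j then 1 else 0) →
      R = ∑ m ∈ Finset.Icc 3 r, S.tr x (S.matS x (φ m) (e m)) →
      S.tr x (S.matS x (φ 2) (e 2)) = -R ∧
      ∀ f : Fin (d 2) → TangentSpace 𝓘(ℝ, E) x,
        (∀ j, f j ∈ W 2 1 x) → (∀ i j, φ 2 i x (f j) = if i = j then 1 else 0) →
        S.tr x (S.matS x (φ 2) f) = -R → f ≠ e 2 →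
        S.normSq x (S.matS x (φ 2) (e 2)) < S.normSq x (S.matS x (φ 2) f)

/-- `V = V_2 ⊕ … ⊕ V_r` is a graded complement: each `V_m` is a smooth subbundle
with `H_m = H_{m-1} ⊕ V_m`. -/
def IsGradedComplement (r : ℕ) (V : ℕ → Distr E M) : Prop :=
  ∀ m, 2 ≤ m → m ≤ r → IsSmoothSubbundle (V m) ∧
    ∀ x, flag S.H (m - 1) x ⊔ V m x = flag S.H m x ∧ flag S.H (m - 1) x ⊓ V m x = ⊥

/-- `F` is a weak `H`-isometry: a diffeomorphism with `F_* H = H` and `F^* g = g`. -/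
def IsWeakIsometry (F : Diffeomorph 𝓘(ℝ, E) 𝓘(ℝ, E) M M ∞) : Prop :=
  (∀ x, (S.H x).map (mfderiv 𝓘(ℝ, E) 𝓘(ℝ, E) F x).toLinearMap = S.H (F x)) ∧
  ∀ (x : M) (v w : S.H x) (v' w' : S.H (F x)),
    (v' : TangentSpace 𝓘(ℝ, E) (F x)) = mfderiv 𝓘(ℝ, E) 𝓘(ℝ, E) F x v →
    (w' : TangentSpace 𝓘(ℝ, E) (F x)) = mfderiv 𝓘(ℝ, E) 𝓘(ℝ, E) F x w →
    S.g (F x) v' w' = S.g x v w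

/-- The graded complement `V` is natural: every weak `H`-isometry preserves each `V_m`. -/
def IsNatural (r : ℕ) (V : ℕ → Distr E M) : Prop :=
  ∀ F : Diffeomorph 𝓘(ℝ, E) 𝓘(ℝ, E) M M ∞, S.IsWeakIsometry F →
    ∀ m, 2 ≤ m → m ≤ r → ∀ x,
      (V m x).map (mfderiv 𝓘(ℝ, E) 𝓘(ℝ, E) F x).toLinearMap = V m (F x)

/-- `u` is an orthonormal frame at `x` of `V = V_2 ⊕ … ⊕ V_r`, for the inner product for which the
`V_m` are orthogonal and each `V_m` carries the inner product of `Ĥ_m`;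
`c i m` is the component of `u i` in `V_m`. -/
def IsOrthonormalFrameAt (r : ℕ) (V : ℕ → Distr E M) (x : M) {n : ℕ}
    (u : Fin n → TangentSpace 𝓘(ℝ, E) x) : Prop :=
  Submodule.span ℝ (Set.range u) = ⨆ m ∈ Finset.Icc 2 r, V m x ∧
  ∃ c : Fin n → (m : ℕ) → flag S.H m x,
    (∀ i, ∀ m ∈ Finset.Icc 2 r, (c i m : TangentSpace 𝓘(ℝ, E) x) ∈ V m x) ∧
    (∀ i, u i = ∑ m ∈ Finset.Icc 2 r, (c i m : TangentSpace 𝓘(ℝ, E) x)) ∧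
    ∀ i j, ∑ m ∈ Finset.Icc 2 r, S.hatForm x m (S.cls m x (c i m)) (S.cls m x (c j m)) =
      if i = j then 1 else 0

/-- The graded complement `V` is `V`-rigid: `∑ᵢ dψᵢ(Uᵢ, X) = 0` for all horizontal vectors `X` and
every smooth local orthonormal frame `U` of `V`, with dual frame `ψ` (the one-forms
with `ψᵢ(Uⱼ) = δᵢⱼ` that vanish on `H`). -/
def IsVRigid (r : ℕ) (V : ℕ → Distr E M) : Prop :=
  ∀ (O : Set M) (n : ℕ) (U : Fin n → VField E M) (ψ : Fin n → OneForm E M), IsOpen O →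
    (∀ i, (U i).SmoothOn O) → (∀ i, (ψ i).SmoothOn O) →
    (∀ y ∈ O, S.IsOrthonormalFrameAt r V y (fun i => U i y) ∧
      (∀ i j, ψ i y (U j y) = if i = j then 1 else 0) ∧ ∀ i, ∀ v ∈ S.H y, ψ i y v = 0) →
    ∀ x ∈ O, ∀ X ∈ S.H x, ∑ i, extDer (ψ i) x (U i x) X = 0

end SubRiemannian

end SubRiem

end

noncomputable section

namespace SubRiem

set_option linter.unusedSectionVars false

/-! ### Smooth functions, vector fields and one-forms at a point -/

section Smooth

variable {E : Type*} [NormedAddCommGroup E] [NormedSpace ℝ E]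
variable {M : Type*} [TopologicalSpace M] [ChartedSpace E M]

/-! Fix a level k and suppose that the subspaces with index m > k are known at that level. The
entries φ of an adapted (k+1)-coframe annihilate H_k, and [H_{k-1}, H] lies in H_k. Hence for z in
H_k the functional dφ(z, ·) on H depends only on the class of z in Ĥ_k, and it is dual to 𝒥(φ) of
that class (`extDer_lower`, `IsCoframeGerm.J_cls`). Two competitors in a selection differ by a row z
in H_k, so the function to be minimized is a quadratic polynomial in z. Semi-𝒥-nondegeneracy says
that z ↦ 𝒮(φ, z) is injective modulo H_{k-1}; applied to constant rows, it gives the same for 𝒜. The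
quadratic part is therefore positive definite modulo H_{k-1}. The minimizer exists, is unique modulo
H_{k-1}, and is characterized by an orthogonality relation (`stepA` for 𝒜, `IsSelected` for 𝒮). It
depends smoothly on the point because it solves an invertible linear system with smooth coefficients
(`exists_smooth_critical`). In the last selection the trace constraint adds Lagrange multipliers.
The constraint is solvable because a horizontal w orthogonal to all traces tr 𝒮(φ, z) satisfies
dφ^i(z, w) = 0 for all horizontal z, which forces 𝒥(φ^i)w = 0 and so w = 0.

The result does not depend on the coframe. Two adapted coframes are related by φ' = aφ with a field
a of orthogonal matrices (`IsCoframeGerm.exists_gauge`), and dφ' = a dφ + da ∧ φ. In the selection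
by 𝒜 the second term vanishes on the relevant vectors. On dual rows it contributes to 𝒮 the
symmetrization of da aᵀ, and da aᵀ is skew; so 𝒮 is conjugated by a, and norm and trace are
unchanged (`IsGauge.matS_conj`). The coframes used at different points can thus be chosen
independently.

All this requires smooth orthonormal frames of Ĥ_m, whose inner products are defined through
quotients. Parseval frames are convenient here because they survive surjections, tensor products
and, after rescaling, exterior squares (`IsParseval.quotForm`). An orthonormal frame of H thus
yields a smooth Parseval frame of Ĥ_m made of iterated brackets, and Gram–Schmidt then gives
`IsEquiregular.exists_frame`.

The last constraint says that the traces of all 𝒮(φ^m, E^m) with m ≥ 2 add up to zero. An arbitrary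
orthonormal frame of V may mix the degrees, but it is an orthogonal transform of the adapted ones,
and the trace is unaffected for the same reason as before; this is rigidity
(`IsMinimalRigidRun.isVRigid`). A weak isometry transports the flag, the metrics, exterior
derivatives and adapted coframes, so it pulls a run back to a run, and uniqueness of the run gives
naturality (`IsMinimalRigidRun.isNatural`). -/

instance finiteDimensional_tangentSpace [FiniteDimensional ℝ E] (x : M) :
    FiniteDimensional ℝ (TangentSpace 𝓘(ℝ, E) x) :=
  inferInstanceAs (FiniteDimensional ℝ E)

instance t2Space_tangentSpace (x : M) : T2Space (TangentSpace 𝓘(ℝ, E) x) :=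
  inferInstanceAs (T2Space E)

variable (E) in
/-- The real function `f` is smooth at the point `x`. -/
def SmoothFnAt (f : M → ℝ) (x : M) : Prop := ContMDiffAt 𝓘(ℝ, E) 𝓘(ℝ, ℝ) ∞ f x

/-- The one-form `φ` is smooth at `x`, as a section of the cotangent bundle. -/
def OneForm.SmoothAt [IsManifold 𝓘(ℝ, E) ∞ M] (φ : OneForm E M) (x : M) : Prop :=
  ContMDiffAt 𝓘(ℝ, E) (𝓘(ℝ, E).prod 𝓘(ℝ, E →L[ℝ] ℝ)) ∞
    (fun y => Bundle.TotalSpace.mk' (E →L[ℝ] ℝ)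
      (E := fun y : M => TangentSpace 𝓘(ℝ, E) y →L[ℝ] Bundle.Trivial M ℝ y) y (φ y)) x

namespace SmoothFnAt

variable {f g : M → ℝ} {x : M}

theorem congr (hf : SmoothFnAt E f x) (h : ∀ᶠ y in 𝓝 x, g y = f y) : SmoothFnAt E g x :=
  ContMDiffAt.congr_of_eventuallyEq hf h

theorem const (c : ℝ) : SmoothFnAt E (fun _ : M => c) x := contMDiffAt_const

theorem add (hf : SmoothFnAt E f x) (hg : SmoothFnAt E g x) :
    SmoothFnAt E (fun y => f y + g y) x := ContMDiffAt.add hf hg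

theorem sub (hf : SmoothFnAt E f x) (hg : SmoothFnAt E g x) :
    SmoothFnAt E (fun y => f y - g y) x := ContMDiffAt.sub hf hg

theorem neg (hf : SmoothFnAt E f x) : SmoothFnAt E (fun y => -f y) x := ContMDiffAt.neg hf

theorem mul (hf : SmoothFnAt E f x) (hg : SmoothFnAt E g x) :
    SmoothFnAt E (fun y => f y * g y) x := ContMDiffAt.mul hf hg

theorem sum {ι : Type*} {s : Finset ι} {f : ι → M → ℝ} (hf : ∀ i ∈ s, SmoothFnAt E (f i) x) :
    SmoothFnAt E (fun y => ∑ i ∈ s, f i y) x := contMDiffAt_finsetSum hf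

theorem prod {ι : Type*} {s : Finset ι} {f : ι → M → ℝ} (hf : ∀ i ∈ s, SmoothFnAt E (f i) x) :
    SmoothFnAt E (fun y => ∏ i ∈ s, f i y) x := contMDiffAt_finsetProd hf

theorem inv (hf : SmoothFnAt E f x) (h : f x ≠ 0) : SmoothFnAt E (fun y => (f y)⁻¹) x :=
  ContMDiffAt.inv₀ hf h

theorem sqrt (hf : SmoothFnAt E f x) (h : f x ≠ 0) : SmoothFnAt E (fun y => √(f y)) x :=
  ContMDiffAt.comp (I' := 𝓘(ℝ, ℝ)) (g := Real.sqrt) x (Real.contDiffAt_sqrt h).contMDiffAt hf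

theorem continuousAt (hf : SmoothFnAt E f x) : ContinuousAt f x := ContMDiffAt.continuousAt hf

theorem mdifferentiableAt (hf : SmoothFnAt E f x) : MDifferentiableAt 𝓘(ℝ, E) 𝓘(ℝ, ℝ) f x :=
  ContMDiffAt.mdifferentiableAt hf (by simp)

end SmoothFnAt

section Derivative

variable {f g : M → ℝ} {x : M} (v : TangentSpace 𝓘(ℝ, E) x)

theorem dirDeriv_add_vec (f : M → ℝ) (v w : TangentSpace 𝓘(ℝ, E) x) :
    dirDeriv f x (v + w) = dirDeriv f x v + dirDeriv f x w := map_add _ v w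

theorem dirDeriv_smul_vec (f : M → ℝ) (c : ℝ) (v : TangentSpace 𝓘(ℝ, E) x) :
    dirDeriv f x (c • v) = c * dirDeriv f x v := map_smul _ c v

theorem dirDeriv_congr (h : ∀ᶠ y in 𝓝 x, f y = g y) : dirDeriv f x v = dirDeriv g x v := by
  unfold dirDeriv
  rw [Filter.EventuallyEq.mfderiv_eq h, h.self_of_nhds]

theorem dirDeriv_const (c : ℝ) : dirDeriv (fun _ : M => c) x v = 0 := by
  unfold dirDeriv
  rw [mfderiv_const]; rfl

theorem dirDeriv_of_eventually_const {c : ℝ} (h : ∀ᶠ y in 𝓝 x, f y = c) : dirDeriv f x v = 0 := by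
  rw [dirDeriv_congr v h, dirDeriv_const]

theorem dirDeriv_add (hf : SmoothFnAt E f x) (hg : SmoothFnAt E g x) :
    dirDeriv (fun y => f y + g y) x v = dirDeriv f x v + dirDeriv g x v := by
  have := (hf.mdifferentiableAt.hasMFDerivAt.add hg.mdifferentiableAt.hasMFDerivAt).mfderiv
  unfold dirDeriv
  exact congrArg (fun L : TangentSpace 𝓘(ℝ, E) x →L[ℝ] ℝ => L v) this

theorem dirDeriv_mul (hf : SmoothFnAt E f x) (hg : SmoothFnAt E g x) :
    dirDeriv (fun y => f y * g y) x v = f x * dirDeriv g x v + g x * dirDeriv f x v := by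
  have := (hf.mdifferentiableAt.hasMFDerivAt.mul hg.mdifferentiableAt.hasMFDerivAt).mfderiv
  unfold dirDeriv
  exact congrArg (fun L : TangentSpace 𝓘(ℝ, E) x →L[ℝ] ℝ => L v) this

theorem dirDeriv_sum {ι : Type*} {s : Finset ι} {f : ι → M → ℝ}
    (hf : ∀ i ∈ s, SmoothFnAt E (f i) x) :
    dirDeriv (fun y => ∑ i ∈ s, f i y) x v = ∑ i ∈ s, dirDeriv (f i) x v := by
  classical
  induction s using Finset.induction_on with
  | empty => simpa using dirDeriv_const v 0
  | insert a s ha ih =>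
    simp only [Finset.sum_insert ha]
    rw [dirDeriv_add v (hf a (by simp)) (SmoothFnAt.sum fun i hi => hf i (by simp [hi])),
      ih fun i hi => hf i (by simp [hi])]

end Derivative

variable [IsManifold 𝓘(ℝ, E) ∞ M]

instance isManifold_one : IsManifold 𝓘(ℝ, E) 1 M := IsManifold.of_le (n := ∞) (by simp)

instance isManifold_minSmoothness : IsManifold 𝓘(ℝ, E) (minSmoothness ℝ 2) M :=
  IsManifold.of_le (n := ∞) (by
    rw [minSmoothness_of_isRCLikeNormedField]
    exact WithTop.coe_le_coe.2 (le_top : (2 : ℕ∞) ≤ ⊤))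

namespace VField.SmoothAt

variable {X Y : VField E M} {x : M}

theorem add (hX : X.SmoothAt x) (hY : Y.SmoothAt x) : VField.SmoothAt (fun y => X y + Y y) x :=
  ContMDiffAt.add_section hX hY

theorem sub (hX : X.SmoothAt x) (hY : Y.SmoothAt x) : VField.SmoothAt (fun y => X y - Y y) x :=
  ContMDiffAt.sub_section hX hY

theorem smul {f : M → ℝ} (hf : SmoothFnAt E f x) (hX : X.SmoothAt x) :
    VField.SmoothAt (fun y => f y • X y) x :=
  ContMDiffAt.smul_section hf hX

theorem const_smul (c : ℝ) (hX : X.SmoothAt x) : VField.SmoothAt (fun y => c • X y) x :=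
  hX.smul (.const c)

theorem zero : VField.SmoothAt (fun y : M => (0 : TangentSpace 𝓘(ℝ, E) y)) x :=
  Bundle.contMDiff_zeroSection ℝ (TangentSpace 𝓘(ℝ, E)) x

theorem sum {ι : Type*} {s : Finset ι} {X : ι → VField E M} (h : ∀ i ∈ s, (X i).SmoothAt x) :
    VField.SmoothAt (fun y => ∑ i ∈ s, X i y) x :=
  ContMDiffAt.sum_section h

theorem mdifferentiableAt (hX : X.SmoothAt x) :
    MDifferentiableAt 𝓘(ℝ, E) 𝓘(ℝ, E).tangent
      (fun y => (⟨y, X y⟩ : TangentBundle 𝓘(ℝ, E) M)) x :=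
  ContMDiffAt.mdifferentiableAt hX (by simp)

theorem bracket [CompleteSpace E] (hX : X.SmoothAt x) (hY : Y.SmoothAt x) :
    VField.SmoothAt (VectorField.mlieBracket 𝓘(ℝ, E) X Y) x := by
  have : IsManifold 𝓘(ℝ, E) (((⊤ : ℕ∞) : WithTop ℕ∞) + 1) M := by
    exact inferInstanceAs (IsManifold 𝓘(ℝ, E) ∞ M)
  exact ContMDiffAt.mlieBracket_vectorField (m := ⊤) (n := ⊤) hX hY (by simp)

end VField.SmoothAt

theorem VField.Smooth.smoothAt {X : VField E M} (hX : X.Smooth) (x : M) : X.SmoothAt x := hX x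

theorem VField.SmoothOn.smoothAt {X : VField E M} {O : Set M} (hX : X.SmoothOn O) (hO : IsOpen O)
    {x : M} (hx : x ∈ O) : X.SmoothAt x := (hX x hx).contMDiffAt (hO.mem_nhds hx)

theorem OneForm.SmoothOn.smoothAt {φ : OneForm E M} {O : Set M} (hφ : φ.SmoothOn O)
    (hO : IsOpen O) {x : M} (hx : x ∈ O) : φ.SmoothAt x :=
  (hφ x hx).contMDiffAt (hO.mem_nhds hx)

theorem OneForm.SmoothAt.apply {φ : OneForm E M} {X : VField E M} {x : M} (hφ : φ.SmoothAt x)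
    (hX : X.SmoothAt x) : SmoothFnAt E (fun y => φ y (X y)) x := by
  have := ContMDiffAt.clm_bundle_apply (F₁ := E) (F₂ := ℝ) (E₂ := Bundle.Trivial M ℝ) hφ hX
  exact (Bundle.contMDiffAt_section (F := ℝ) _ ).1 this

/-- A vector field with a given value that is smooth at the given point. -/
def extend {x : M} (v : TangentSpace 𝓘(ℝ, E) x) : VField E M :=
  FiberBundle.extend (E := fun y : M => TangentSpace 𝓘(ℝ, E) y) E v

theorem extend_self {x : M} (v : TangentSpace 𝓘(ℝ, E) x) : extend v x = v := by
  simp [extend]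

theorem extend_smoothAt {x : M} (v : TangentSpace 𝓘(ℝ, E) x) : (extend v).SmoothAt x :=
  FiberBundle.contMDiffAt_extend ..

/-- Smoothness on a neighbourhood, not only at `x`, is what cutting off to a global field requires.
-/
theorem eventually_extend_smoothAt {x : M} (v : TangentSpace 𝓘(ℝ, E) x) :
    ∀ᶠ y in 𝓝 x, (extend v).SmoothAt y := by
  obtain ⟨s, hs, h⟩ := FiberBundle.exists_contMDiffOn_extend (k := ∞) 𝓘(ℝ, E) E v
  filter_upwards [eventually_mem_nhds_iff.2 hs] with y hy
  exact (h y (mem_of_mem_nhds hy)).contMDiffAt hy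

/-! ### The exterior derivative -/

section ExtDer

variable [FiniteDimensional ℝ E]

theorem mlieBracket_smul_right {X Y : VField E M} {f : M → ℝ} {x : M} (hf : SmoothFnAt E f x)
    (hY : Y.SmoothAt x) :
    VectorField.mlieBracket 𝓘(ℝ, E) X (fun y => f y • Y y) x =
      dirDeriv f x (X x) • Y x + f x • VectorField.mlieBracket 𝓘(ℝ, E) X Y x :=
  VectorField.mlieBracket_smul_right hf.mdifferentiableAt hY.mdifferentiableAt

theorem mlieBracket_add_right {X Y Z : VField E M} {x : M} (hY : Y.SmoothAt x)
    (hZ : Z.SmoothAt x) :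
    VectorField.mlieBracket 𝓘(ℝ, E) X (fun y => Y y + Z y) x =
      VectorField.mlieBracket 𝓘(ℝ, E) X Y x + VectorField.mlieBracket 𝓘(ℝ, E) X Z x :=
  VectorField.mlieBracket_add_right hY.mdifferentiableAt hZ.mdifferentiableAt

theorem mlieBracket_congr {X Y X' Y' : VField E M} {x : M} (hX : ∀ᶠ y in 𝓝 x, X' y = X y)
    (hY : ∀ᶠ y in 𝓝 x, Y' y = Y y) :
    VectorField.mlieBracket 𝓘(ℝ, E) X' Y' x = VectorField.mlieBracket 𝓘(ℝ, E) X Y x :=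
  Filter.EventuallyEq.mlieBracket_vectorField_eq hX hY

/-- The expression that defines the exterior derivative. -/
def extDerExpr (φ : OneForm E M) (x : M) (U X : VField E M) : ℝ :=
  dirDeriv (fun y => φ y (X y)) x (U x) - dirDeriv (fun y => φ y (U y)) x (X x)
      - φ x (VectorField.mlieBracket 𝓘(ℝ, E) U X x)

theorem extDerExpr_swap (φ : OneForm E M) (x : M) (U X : VField E M) :
    extDerExpr φ x U X = -extDerExpr φ x X U := by
  unfold extDerExpr
  rw [VectorField.mlieBracket_swap_apply, map_neg]
  ring

theorem extDerExpr_add_right {φ : OneForm E M} {x : M} (hφ : φ.SmoothAt x) {U X Y : VField E M}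
    (hX : X.SmoothAt x) (hY : Y.SmoothAt x) :
    extDerExpr φ x U (fun y => X y + Y y) = extDerExpr φ x U X + extDerExpr φ x U Y := by
  unfold extDerExpr
  rw [mlieBracket_add_right hX hY, dirDeriv_add_vec]
  simp only [map_add]
  rw [dirDeriv_add _ (hφ.apply hX) (hφ.apply hY)]
  ring

theorem extDerExpr_smul_right {φ : OneForm E M} {x : M} (hφ : φ.SmoothAt x) {U X : VField E M}
    {f : M → ℝ} (hf : SmoothFnAt E f x) (hX : X.SmoothAt x) :
    extDerExpr φ x U (fun y => f y • X y) = f x * extDerExpr φ x U X := by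
  unfold extDerExpr
  rw [mlieBracket_smul_right hf hX, dirDeriv_smul_vec]
  simp only [map_add, map_smul, smul_eq_mul]
  rw [dirDeriv_mul _ hf (hφ.apply hX)]
  ring

theorem extDerExpr_congr_right {φ : OneForm E M} {x : M} {U X Y : VField E M}
    (h : ∀ᶠ y in 𝓝 x, Y y = X y) : extDerExpr φ x U Y = extDerExpr φ x U X := by
  unfold extDerExpr
  rw [mlieBracket_congr (.of_forall fun _ => rfl) h, h.self_of_nhds,
    dirDeriv_congr (g := fun y => φ y (X y)) _ (h.mono fun y hy => by simp only [hy])]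

theorem extDerExpr_sum_right {φ : OneForm E M} {x : M} (hφ : φ.SmoothAt x) {U : VField E M}
    {ι : Type*} (s : Finset ι) {X : ι → VField E M} (hX : ∀ i ∈ s, (X i).SmoothAt x) :
    extDerExpr φ x U (fun y => ∑ i ∈ s, X i y) = ∑ i ∈ s, extDerExpr φ x U (X i) := by
  classical
  induction s using Finset.induction_on with
  | empty =>
    have := extDerExpr_smul_right (U := U) hφ (.const 0) (VField.SmoothAt.zero (x := x))
    simpa using this
  | insert a s ha ih =>
    simp only [Finset.sum_insert ha]
    rw [extDerExpr_add_right hφ (hX a (by simp)) (VField.SmoothAt.sum fun i hi => hX i (by simp [hi])),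
      ih fun i hi => hX i (by simp [hi])]

/-- A local frame together with its coefficient functionals. Linearity of the functionals at each
point is what turns linearity over functions into dependence on the value at `x` alone. -/
theorem exists_coefficients {x : M} : ∃ (n : ℕ) (Z : Fin n → VField E M)
    (c : Fin n → ∀ y : M, TangentSpace 𝓘(ℝ, E) y →ₗ[ℝ] ℝ), (∀ i, (Z i).SmoothAt x) ∧
    (∀ X : VField E M, ∀ i, X.SmoothAt x → SmoothFnAt E (fun y => c i y (X y)) x) ∧
    ∀ X : VField E M, ∀ᶠ y in 𝓝 x, X y = ∑ i, c i y (X y) • Z i y := by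
  let t := trivializationAt E (TangentSpace 𝓘(ℝ, E) : M → Type _) x
  have hx : x ∈ t.baseSet := FiberBundle.mem_baseSet_trivializationAt' x
  let b := Module.finBasis ℝ E
  refine ⟨_, t.localFrame b, t.localFrameCoeff 𝓘(ℝ, E) b, fun i => ?_, fun X i hX => ?_,
    fun X => ?_⟩
  · exact contMDiffAt_localFrame_of_mem ∞ _ b i hx
  · exact contMDiffAt_localFrameCoeff b hx hX i
  · exact t.eventually_eq_localFrame_sum_coeff_smul b hx

/-- Tensoriality: after expansion in a local frame, linearity over functions leaves only the
coefficients at `x`, and these are determined by the value of the field there. -/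
theorem extDerExpr_pointwise_right {φ : OneForm E M} {x : M} (hφ : φ.SmoothAt x)
    {U X Y : VField E M} (hX : X.SmoothAt x) (hY : Y.SmoothAt x) (h : X x = Y x) :
    extDerExpr φ x U X = extDerExpr φ x U Y := by
  obtain ⟨n, Z, c, hZ, hc, hsum⟩ := exists_coefficients (E := E) (x := x)
  have key : ∀ X : VField E M, X.SmoothAt x →
      extDerExpr φ x U X = ∑ i, c i x (X x) * extDerExpr φ x U (Z i) := by
    intro X hX
    rw [extDerExpr_congr_right (hsum X),
      extDerExpr_sum_right hφ _ fun i _ => (hZ i).smul (hc X i hX)]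
    exact Finset.sum_congr rfl fun i _ => extDerExpr_smul_right hφ (hc X i hX) (hZ i)
  rw [key X hX, key Y hY, h]

theorem extDerExpr_pointwise {φ : OneForm E M} {x : M} (hφ : φ.SmoothAt x)
    {U X V Y : VField E M} (hU : U.SmoothAt x) (hX : X.SmoothAt x) (hV : V.SmoothAt x)
    (hY : Y.SmoothAt x) (h : U x = V x) (h' : X x = Y x) :
    extDerExpr φ x U X = extDerExpr φ x V Y := by
  rw [extDerExpr_pointwise_right hφ hX hY h', extDerExpr_swap,
    extDerExpr_pointwise_right hφ hU hV h, ← extDerExpr_swap]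

/-- Since `extDer` is a choice, some bilinear form with the property must be produced. Evaluating
the expression on arbitrary extensions of two vectors is well defined and bilinear by tensoriality.
-/
theorem isExtDeriv_extDer {φ : OneForm E M} {x : M} (hφ : φ.SmoothAt x) :
    IsExtDeriv φ x (extDer φ x) := by
  have add_r : ∀ u v w : TangentSpace 𝓘(ℝ, E) x, extDerExpr φ x (extend u) (extend (v + w)) =
      extDerExpr φ x (extend u) (extend v) + extDerExpr φ x (extend u) (extend w) := by
    intro u v w
    rw [← extDerExpr_add_right hφ (extend_smoothAt v) (extend_smoothAt w)]
    exact extDerExpr_pointwise_right hφ (extend_smoothAt _)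
      ((extend_smoothAt v).add (extend_smoothAt w)) (by simp only [extend_self])
  have smul_r : ∀ (c : ℝ) (u v : TangentSpace 𝓘(ℝ, E) x),
      extDerExpr φ x (extend u) (extend (c • v)) =
      c * extDerExpr φ x (extend u) (extend v) := by
    intro c u v
    rw [← extDerExpr_smul_right hφ (.const c) (extend_smoothAt v)]
    exact extDerExpr_pointwise_right hφ (extend_smoothAt _)
      ((extend_smoothAt v).const_smul c) (by simp only [extend_self])
  refine Classical.epsilon_spec (p := IsExtDeriv φ x) ⟨LinearMap.mk₂ ℝ
    (fun u v => extDerExpr φ x (extend u) (extend v)) (fun u v w => ?_) (fun c u v => ?_)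
    (fun u v w => add_r u v w) (fun c u v => smul_r c u v), fun U X hU hX => ?_⟩
  · rw [extDerExpr_swap, add_r, extDerExpr_swap φ x (extend u), extDerExpr_swap φ x (extend v)]
    ring
  · rw [extDerExpr_swap, smul_r, extDerExpr_swap φ x (extend u), smul_eq_mul]
    ring
  · exact extDerExpr_pointwise hφ (extend_smoothAt _) (extend_smoothAt _) hU hX
      (extend_self _) (extend_self _)

theorem extDer_apply {φ : OneForm E M} {x : M} (hφ : φ.SmoothAt x) {U X : VField E M}
    (hU : U.SmoothAt x) (hX : X.SmoothAt x) :
    extDer φ x (U x) (X x) = dirDeriv (fun y => φ y (X y)) x (U x)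
      - dirDeriv (fun y => φ y (U y)) x (X x) - φ x (VectorField.mlieBracket 𝓘(ℝ, E) U X x) :=
  isExtDeriv_extDer hφ U X hU hX

theorem extDer_swap {φ : OneForm E M} {x : M} (hφ : φ.SmoothAt x)
    (u v : TangentSpace 𝓘(ℝ, E) x) : extDer φ x u v = -extDer φ x v u := by
  have e := extDerExpr_swap φ x (extend u) (extend v)
  have h1 := extDer_apply hφ (extend_smoothAt u) (extend_smoothAt v)
  have h2 := extDer_apply hφ (extend_smoothAt v) (extend_smoothAt u)
  unfold extDerExpr at e
  rw [← h1, ← h2] at e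
  rwa [extend_self, extend_self] at e

/-- The exterior derivative on fields whose pairings with the form vanish nearby. -/
theorem extDer_apply_eq_neg {φ : OneForm E M} {x : M} (hφ : φ.SmoothAt x) {U X : VField E M}
    (hU : U.SmoothAt x) (hX : X.SmoothAt x) {c : ℝ} (hφU : ∀ᶠ y in 𝓝 x, φ y (U y) = c)
    {c' : ℝ} (hφX : ∀ᶠ y in 𝓝 x, φ y (X y) = c') :
    extDer φ x (U x) (X x) = -φ x (VectorField.mlieBracket 𝓘(ℝ, E) U X x) := by
  rw [extDer_apply hφ hU hX, dirDeriv_of_eventually_const _ hφU,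
    dirDeriv_of_eventually_const _ hφX]
  ring

/-- In a trivialization a one-form is the combination of constant coordinate functionals whose
coefficients are its values on the local frame, so smoothness of those values is enough. -/
theorem OneForm.smoothAt_of_apply {φ : OneForm E M} {x : M}
    (h : ∀ X : VField E M, X.SmoothAt x → SmoothFnAt E (fun y => φ y (X y)) x) :
    φ.SmoothAt x := by
  let t := trivializationAt E (TangentSpace 𝓘(ℝ, E) : M → Type _) x
  have hx : x ∈ t.baseSet := FiberBundle.mem_baseSet_trivializationAt' x
  refine (contMDiffAt_hom_bundle _).2 ⟨contMDiffAt_id, ?_⟩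
  let b := Module.finBasis ℝ E
  have hZ : ∀ i, VField.SmoothAt (t.localFrame b i) x := fun i =>
    contMDiffAt_localFrame_of_mem ∞ _ b i hx
  have key : ContMDiffAt 𝓘(ℝ, E) 𝓘(ℝ, E →L[ℝ] ℝ) ∞
      (fun y => ∑ i, (φ y (t.localFrame b i y)) • LinearMap.toContinuousLinearMap (b.coord i)) x :=
    contMDiffAt_finsetSum fun i _ => ContMDiffAt.smul (h _ (hZ i)) contMDiffAt_const
  refine key.congr_of_eventuallyEq ?_
  filter_upwards [t.open_baseSet.mem_nhds hx] with y hy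
  refine ContinuousLinearMap.coe_injective (b.ext fun j => ?_)
  rw [ContinuousLinearMap.inCoordinates_eq (by exact hy) (by simp)]
  simp [Finsupp.single_apply]
  rw [t.localFrame_apply_of_mem_baseSet b hy]
  simp [Bundle.Trivialization.basisAt]
  rfl

theorem OneForm.smoothOn_of_smoothAt {φ : OneForm E M} {O : Set M}
    (h : ∀ x ∈ O, φ.SmoothAt x) : φ.SmoothOn O := fun x hx => (h x hx).contMDiffWithinAt

/-- The Leibniz rule d(fφ) = df ∧ φ + f dφ. The terms with df are the origin of the correction terms
in every change of coframe. -/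
theorem extDer_sum_smul {ι : Type*} [Fintype ι] {ψ : OneForm E M} {φ : ι → OneForm E M}
    {f : ι → M → ℝ} {x : M}
    (hψ : ∀ᶠ y in 𝓝 x, ψ y = ∑ i, f i y • φ i y) (hφ : ∀ i, (φ i).SmoothAt x)
    (hf : ∀ i, SmoothFnAt E (f i) x) (u v : TangentSpace 𝓘(ℝ, E) x) :
    extDer ψ x u v = ∑ i, (dirDeriv (f i) x u * φ i x v - dirDeriv (f i) x v * φ i x u
      + f i x * extDer (φ i) x u v) := by
  have hev : ∀ X : VField E M, ∀ᶠ y in 𝓝 x, ψ y (X y) = ∑ i, f i y * φ i y (X y) := by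
    intro X
    filter_upwards [hψ] with y hy
    rw [hy]
    simp
  have hd : ∀ X : VField E M, X.SmoothAt x → ∀ w : TangentSpace 𝓘(ℝ, E) x,
      dirDeriv (fun y => ψ y (X y)) x w = ∑ i, (f i x * dirDeriv (fun y => φ i y (X y)) x w
        + φ i x (X x) * dirDeriv (f i) x w) := by
    intro X hX w
    rw [dirDeriv_congr _ (hev X), dirDeriv_sum _ fun i _ => (hf i).mul ((hφ i).apply hX)]
    exact Finset.sum_congr rfl fun i _ => dirDeriv_mul _ (hf i) ((hφ i).apply hX)
  have hs : ψ.SmoothAt x := OneForm.smoothAt_of_apply fun X hX =>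
    (SmoothFnAt.sum fun i _ => (hf i).mul ((hφ i).apply hX)).congr (hev X)
  have hu := extend_smoothAt u
  have hv := extend_smoothAt v
  have e := extDer_apply hs hu hv
  rw [hd _ hv, hd _ hu, hψ.self_of_nhds] at e
  simp only [extend_self] at e
  rw [e, sum_apply, ← Finset.sum_sub_distrib, ← Finset.sum_sub_distrib]
  refine Finset.sum_congr rfl fun i _ => ?_
  have ei := extDer_apply (hφ i) hu hv
  simp only [extend_self] at ei
  rw [ei]
  simp only [smul_apply, smul_eq_mul]
  ring

end ExtDer

/-! ### Cutting off local sections -/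

section Global

variable [FiniteDimensional ℝ E] [T2Space M]

/-- Multiplication by a bump function keeps the values in the subspaces `D y`. The flag is defined
by global sections, and this is how local ones are fed into it. -/
theorem exists_global_section {D : Distr E M} {X : VField E M} {x : M}
    (hX : ∀ᶠ y in 𝓝 x, X.SmoothAt y) (hD : ∀ᶠ y in 𝓝 x, X y ∈ D y) :
    ∃ Y : VField E M, Y.Smooth ∧ (∀ y, Y y ∈ D y) ∧ ∀ᶠ y in 𝓝 x, Y y = X y := by
  obtain ⟨O, hO, hOo, hxO⟩ := eventually_nhds_iff.1 (hX.and hD)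
  obtain ⟨ρ, -, hρ⟩ := (SmoothBumpFunction.nhds_basis_tsupport (I := 𝓘(ℝ, E)) x).mem_iff.1
    (hOo.mem_nhds hxO)
  refine ⟨fun y => ρ y • X y, ?_, fun y => ?_, ?_⟩
  · exact ContMDiffOn.smul_section_of_tsupport ρ.contMDiff.contMDiffOn hOo hρ
      fun y hy => (hO y hy).1.contMDiffWithinAt
  · by_cases hy : ρ y = 0
    · simp only [hy, zero_smul, Submodule.zero_mem]
    · exact (D y).smul_mem _ (hO y (hρ (subset_tsupport _ hy))).2
  · filter_upwards [ρ.eventuallyEq_one] with y hy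
    simp [hy]

theorem exists_smooth_eq {x : M} (v : TangentSpace 𝓘(ℝ, E) x) :
    ∃ X : VField E M, X.Smooth ∧ X x = v := by
  obtain ⟨Y, hY, -, h⟩ := exists_global_section (D := fun _ => ⊤) (eventually_extend_smoothAt v)
    (.of_forall fun _ => trivial)
  exact ⟨Y, hY, by rw [h.self_of_nhds, extend_self]⟩

end Global

/-! ### Local frames of the tangent bundle and dual coframes -/

section Frames

variable [FiniteDimensional ℝ E]

theorem SmoothFnAt.det {ι : Type*} [Fintype ι] [DecidableEq ι] {A : M → Matrix ι ι ℝ} {x : M}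
    (hA : ∀ i j, SmoothFnAt E (fun y => A y i j) x) : SmoothFnAt E (fun y => (A y).det) x := by
  simp only [Matrix.det_apply']
  exact SmoothFnAt.sum fun σ _ => (SmoothFnAt.const _).mul (SmoothFnAt.prod fun i _ => hA _ _)

/-- Cramer's rule: an entry of the inverse is a quotient of two determinants. -/
theorem SmoothFnAt.matrix_inv {ι : Type*} [Fintype ι] [DecidableEq ι] {A : M → Matrix ι ι ℝ}
    {x : M} (hA : ∀ i j, SmoothFnAt E (fun y => A y i j) x) (h : (A x).det ≠ 0) (i j : ι) :
    SmoothFnAt E (fun y => (A y)⁻¹ i j) x := by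
  have e : ∀ y, (A y)⁻¹ i j = (A y).det⁻¹ * ((A y).updateRow j (Pi.single i 1)).det := by
    intro y
    rw [Matrix.inv_def, Matrix.smul_apply, Matrix.adjugate_apply, Ring.inverse_eq_inv',
      smul_eq_mul]
  simp only [e]
  refine ((SmoothFnAt.det hA).inv h).mul (SmoothFnAt.det fun k l => ?_)
  by_cases hk : k = j
  · subst hk
    simpa using SmoothFnAt.const _
  · simpa [Matrix.updateRow_ne hk] using hA k l

/-- In a trivialization the fields become continuous maps to `E`, where linear independence of a
finite family is an open condition. -/
theorem eventually_linearIndependent {ι : Type*} [Finite ι] {X : ι → VField E M} {x : M}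
    (hX : ∀ i, (X i).SmoothAt x) (h : LinearIndependent ℝ fun i => X i x) :
    ∀ᶠ y in 𝓝 x, LinearIndependent ℝ fun i => X i y := by
  let t := trivializationAt E (TangentSpace 𝓘(ℝ, E) : M → Type _) x
  have hx : x ∈ t.baseSet := FiberBundle.mem_baseSet_trivializationAt' x
  have hlin : ∀ y, ∀ hy : y ∈ t.baseSet, ((LinearIndependent ℝ fun i => X i y) ↔
      LinearIndependent ℝ fun i => (t ⟨y, X i y⟩).2) := by
    intro y hy
    have := LinearMap.linearIndependent_iff (v := fun i => X i y)
      ((t.continuousLinearEquivAt ℝ y hy).toLinearEquiv.toLinearMap)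
      (LinearMap.ker_eq_bot.2 (t.continuousLinearEquivAt ℝ y hy).injective)
    exact this.symm
  have hc : ContinuousAt (fun y i => (t ⟨y, X i y⟩).2) x :=
    continuousAt_pi.2 fun i => ((Bundle.contMDiffAt_section _).1 (hX i)).continuousAt
  have h' := hc.eventually (LinearIndependent.eventually ((hlin x hx).1 h))
  filter_upwards [h', t.open_baseSet.mem_nhds hx] with y hy hyb
  exact (hlin y hyb).2 hy

theorem span_eq_top_of_linearIndependent {ι : Type*} [Fintype ι] (hc : Fintype.card ι = Module.finrank ℝ E)
    {y : M} {v : ι → TangentSpace 𝓘(ℝ, E) y} (h : LinearIndependent ℝ v) :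
    Submodule.span ℝ (Set.range v) = ⊤ :=
  h.span_eq_top_of_card_eq_finrank' hc

/-- The one-forms dual to a family of vector fields, where that family is a basis. -/
def dualForm {ι : Type*} (X : ι → VField E M) (i : ι) : OneForm E M := fun y =>
  open Classical in
  if h : LinearIndependent ℝ (fun i => X i y) ∧ ⊤ ≤ Submodule.span ℝ (Set.range fun i => X i y) then
    LinearMap.toContinuousLinearMap ((Module.Basis.mk h.1 h.2).coord i) else 0

theorem dualForm_apply_self {ι : Type*} [DecidableEq ι] {X : ι → VField E M} {y : M}
    (h : LinearIndependent ℝ fun i => X i y)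
    (h' : Submodule.span ℝ (Set.range fun i => X i y) = ⊤) (i j : ι) :
    dualForm X i y (X j y) = if i = j then 1 else 0 := by
  unfold dualForm
  rw [dif_pos ⟨h, h'.ge⟩]
  have : X j y = Module.Basis.mk h h'.ge j := by simp
  rw [this, LinearMap.coe_toContinuousLinearMap', Module.Basis.coord_apply,
    Module.Basis.repr_self, Finsupp.single_apply]
  simp only [eq_comm]

theorem dualForm_sum {ι : Type*} [Fintype ι] {X : ι → VField E M} {y : M}
    (h : LinearIndependent ℝ fun i => X i y)
    (h' : Submodule.span ℝ (Set.range fun i => X i y) = ⊤) (v : TangentSpace 𝓘(ℝ, E) y) :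
    ∑ i, dualForm X i y v • X i y = v := by
  unfold dualForm
  simp only [dif_pos (show _ ∧ _ from ⟨h, h'.ge⟩), LinearMap.coe_toContinuousLinearMap',
    Module.Basis.coord_apply]
  simpa using (Module.Basis.mk h h'.ge).sum_repr v

/-- If `A` is the matrix of the fields in a smooth local frame, the dual coordinates of a field are
`A⁻¹` applied to its coordinates in that frame, and the inverse is smooth by Cramer's rule. -/
theorem dualForm_smoothAt {ι : Type*} [Fintype ι] {X : ι → VField E M} {x : M}
    (hX : ∀ i, (X i).SmoothAt x) (h : LinearIndependent ℝ fun i => X i x)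
    (h' : Submodule.span ℝ (Set.range fun i => X i x) = ⊤) (i : ι) : (dualForm X i).SmoothAt x := by
  classical
  have hcard : Fintype.card ι = Module.finrank ℝ E :=
    (Module.finrank_eq_card_basis (Module.Basis.mk h h'.ge)).symm
  have hLI := eventually_linearIndependent hX h
  refine OneForm.smoothAt_of_apply fun Y hY => ?_
  let t := trivializationAt E (TangentSpace 𝓘(ℝ, E) : M → Type _) x
  have hx : x ∈ t.baseSet := FiberBundle.mem_baseSet_trivializationAt' x
  let b : Module.Basis ι ℝ E := (Module.finBasis ℝ E).reindex (Fintype.equivOfCardEq (by simp [hcard]))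
  let c : ι → ∀ y : M, TangentSpace 𝓘(ℝ, E) y →ₗ[ℝ] ℝ := t.localFrameCoeff 𝓘(ℝ, E) b
  have hcs : ∀ Z : VField E M, ∀ i, Z.SmoothAt x → SmoothFnAt E (fun y => c i y (Z y)) x :=
    fun Z i hZ => contMDiffAt_localFrameCoeff b hx hZ i
  have hsum : ∀ y ∈ t.baseSet, ∀ v : TangentSpace 𝓘(ℝ, E) y,
      v = ∑ i, c i y v • t.localFrame b i y := by
    intro y hy v
    have := t.eq_sum_localFrameCoeff_smul (I := 𝓘(ℝ, E)) (b := b) (s := extend v) hy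
    rwa [extend_self] at this
  let A : M → Matrix ι ι ℝ := fun y => Matrix.of fun l k => c l y (X k y)
  have hA : ∀ y ∈ t.baseSet, LinearIndependent ℝ (fun i => X i y) → IsUnit (A y).det := by
    intro y hy hl
    rw [← Matrix.isUnit_iff_isUnit_det, ← Matrix.mulVec_injective_iff_isUnit]
    refine (injective_iff_map_eq_zero (A y).mulVecLin).2 fun w hw => ?_
    have hz : ∑ k, w k • X k y = 0 := by
      rw [hsum y hy (∑ k, w k • X k y)]
      refine Finset.sum_eq_zero fun l _ => ?_
      have := congrFun hw l
      simp only [Matrix.mulVecLin_apply, Matrix.mulVec, dotProduct, A, Matrix.of_apply,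
        Pi.zero_apply] at this
      rw [map_sum]
      simp only [map_smul, smul_eq_mul]
      rw [Finset.sum_congr rfl fun k _ => mul_comm (w k) _, this, zero_smul]
    exact funext (Fintype.linearIndependent_iff.1 hl w hz)
  have key : SmoothFnAt E (fun y => ∑ l, (A y)⁻¹ i l * c l y (Y y)) x :=
    SmoothFnAt.sum fun l _ => (SmoothFnAt.matrix_inv (fun l k => hcs _ _ (hX k))
      (hA x hx h).ne_zero i l).mul (hcs _ _ hY)
  refine key.congr ?_
  filter_upwards [hLI, t.open_baseSet.mem_nhds hx] with y hy hyb
  have hs := span_eq_top_of_linearIndependent hcard hy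
  have e : (fun l => c l y (Y y)) = (A y).mulVec fun k => dualForm X k y (Y y) := by
    ext l
    conv_lhs => rw [← dualForm_sum hy hs (Y y)]
    simp only [map_sum, map_smul, smul_eq_mul, Matrix.mulVec, dotProduct, A, Matrix.of_apply]
    exact Finset.sum_congr rfl fun k _ => mul_comm _ _
  have : (A y)⁻¹.mulVec (fun l => c l y (Y y)) = fun k => dualForm X k y (Y y) := by
    rw [e, Matrix.mulVec_mulVec, Matrix.nonsing_inv_mul _ (hA y hyb hy), Matrix.one_mulVec]
  exact (congrFun this i).symm

end Frames
end Smooth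

/-! ### Distributions and their smooth sections -/

section Subbundles

variable {E : Type*} [NormedAddCommGroup E] [NormedSpace ℝ E] [FiniteDimensional ℝ E]
variable {M : Type*} [TopologicalSpace M] [ChartedSpace E M] [IsManifold 𝓘(ℝ, E) ∞ M]

namespace VField.Smooth

variable {X Y : VField E M}

theorem add (hX : X.Smooth) (hY : Y.Smooth) : VField.Smooth fun y => X y + Y y :=
  fun y => (hX.smoothAt y).add (hY.smoothAt y)

theorem const_smul (c : ℝ) (hX : X.Smooth) : VField.Smooth fun y => c • X y :=
  fun y => (hX.smoothAt y).const_smul c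

theorem bracket (hX : X.Smooth) (hY : Y.Smooth) :
    VField.Smooth (VectorField.mlieBracket 𝓘(ℝ, E) X Y) :=
  fun y => (hX.smoothAt y).bracket (hY.smoothAt y)

end VField.Smooth

/-- `X` is a smooth section of `D` near `x`. -/
def VField.IsSectionNear (X : VField E M) (D : Distr E M) (x : M) : Prop :=
  ∀ᶠ y in 𝓝 x, X.SmoothAt y ∧ X y ∈ D y

/-- Every element of `D` is the value of a global smooth section. -/
def SectionSpanned (D : Distr E M) : Prop :=
  ∀ x, ∀ v ∈ D x, ∃ X : VField E M, X.Smooth ∧ (∀ y, X y ∈ D y) ∧ X x = v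

/-- The fields `X` form a frame of `D` near `x`. -/
def IsFrameNear {ι : Type*} (D : Distr E M) (X : ι → VField E M) (x : M) : Prop :=
  (∀ i, ∀ᶠ y in 𝓝 x, (X i).SmoothAt y) ∧
  ∀ᶠ y in 𝓝 x, (LinearIndependent ℝ fun i => X i y) ∧
    Submodule.span ℝ (Set.range fun i => X i y) = D y

namespace VField.IsSectionNear

variable {X Y : VField E M} {D : Distr E M} {x : M}

theorem smoothAt (h : X.IsSectionNear D x) : X.SmoothAt x := h.self_of_nhds.1

theorem mem (h : X.IsSectionNear D x) : X x ∈ D x := h.self_of_nhds.2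

theorem eventually (h : X.IsSectionNear D x) : ∀ᶠ y in 𝓝 x, X.IsSectionNear D y :=
  eventually_eventually_nhds.2 h

theorem mono {D' : Distr E M} (h : X.IsSectionNear D x) (hD : ∀ y, D y ≤ D' y) :
    X.IsSectionNear D' x := by
  filter_upwards [h] with y hy using ⟨hy.1, hD y hy.2⟩

theorem of_global (h : X.Smooth) (h' : ∀ y, X y ∈ D y) : X.IsSectionNear D x :=
  .of_forall fun y => ⟨h y, h' y⟩

theorem add (h : X.IsSectionNear D x) (h' : Y.IsSectionNear D x) :
    VField.IsSectionNear (fun y => X y + Y y) D x := by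
  filter_upwards [h, h'] with y h1 h2
  exact ⟨h1.1.add h2.1, (D y).add_mem h1.2 h2.2⟩

theorem sub (h : X.IsSectionNear D x) (h' : Y.IsSectionNear D x) :
    VField.IsSectionNear (fun y => X y - Y y) D x := by
  filter_upwards [h, h'] with y h1 h2
  exact ⟨h1.1.sub h2.1, (D y).sub_mem h1.2 h2.2⟩

theorem smul {f : M → ℝ} (hf : ∀ᶠ y in 𝓝 x, SmoothFnAt E f y) (h : X.IsSectionNear D x) :
    VField.IsSectionNear (fun y => f y • X y) D x := by
  filter_upwards [hf, h] with y h1 h2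
  exact ⟨h2.1.smul h1, (D y).smul_mem _ h2.2⟩

theorem const_smul (c : ℝ) (h : X.IsSectionNear D x) :
    VField.IsSectionNear (fun y => c • X y) D x :=
  h.smul (.of_forall fun _ => .const c)

theorem sum {ι : Type*} {s : Finset ι} {X : ι → VField E M}
    (h : ∀ i ∈ s, (X i).IsSectionNear D x) :
    VField.IsSectionNear (fun y => ∑ i ∈ s, X i y) D x := by
  filter_upwards [(Filter.eventually_all_finset s).2 h] with y hy
  exact ⟨.sum fun i hi => (hy i hi).1, (D y).sum_mem fun i hi => (hy i hi).2⟩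

theorem exists_global [T2Space M] (h : X.IsSectionNear D x) :
    ∃ Y : VField E M, Y.Smooth ∧ (∀ y, Y y ∈ D y) ∧ ∀ᶠ y in 𝓝 x, Y y = X y :=
  exists_global_section (Filter.Eventually.mono h fun _ h => h.1)
    (Filter.Eventually.mono h fun _ h => h.2)

end VField.IsSectionNear

theorem IsFrameNear.isSectionNear {ι : Type*} {D : Distr E M} {X : ι → VField E M} {x : M}
    (h : IsFrameNear D X x) (i : ι) : (X i).IsSectionNear D x := by
  filter_upwards [h.1 i, h.2] with y h1 h2
  exact ⟨h1, h2.2 ▸ Submodule.subset_span ⟨i, rfl⟩⟩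

theorem IsSmoothSubbundle.exists_frame {D : Distr E M} (hD : IsSmoothSubbundle D) (x : M) :
    ∃ (k : ℕ) (X : Fin k → VField E M), IsFrameNear D X x := by
  obtain ⟨O, hO, hx, k, X, hX, h⟩ := hD x
  refine ⟨k, X, fun i => ?_, ?_⟩
  · filter_upwards [hO.mem_nhds hx] with y hy using (hX i).smoothAt hO hy
  · filter_upwards [hO.mem_nhds hx] with y hy using h y hy

theorem isSmoothSubbundle_of_frames {D : Distr E M}
    (h : ∀ x, ∃ (ι : Type) (_ : Fintype ι) (X : ι → VField E M), IsFrameNear D X x) :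
    IsSmoothSubbundle D := by
  intro x
  obtain ⟨ι, _, X, hX, hf⟩ := h x
  obtain ⟨O, hO, hOo, hxO⟩ := eventually_nhds_iff.1 ((Filter.eventually_all.2 hX).and hf)
  let e := Fintype.equivFin ι
  refine ⟨O, hOo, hxO, Fintype.card ι, fun i => X (e.symm i),
    fun i y hy => ((hO y hy).1 _).contMDiffWithinAt, fun y hy => ⟨?_, ?_⟩⟩
  · exact (linearIndependent_equiv e.symm (f := fun i => X i y)).2 (hO y hy).2.1
  · rw [← (hO y hy).2.2]
    congr 1
    exact e.symm.surjective.range_comp fun i => X i y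

theorem IsSmoothSubbundle.sectionSpanned [T2Space M] {D : Distr E M} (hD : IsSmoothSubbundle D) :
    SectionSpanned D := by
  intro x v hv
  obtain ⟨k, X, hX⟩ := hD.exists_frame x
  rw [← hX.2.self_of_nhds.2, Submodule.mem_span_range_iff_exists_fun] at hv
  obtain ⟨c, rfl⟩ := hv
  obtain ⟨Y, hY, hYD, h⟩ := VField.IsSectionNear.exists_global
    (VField.IsSectionNear.sum (s := Finset.univ) fun i _ => (hX.isSectionNear i).const_smul (c i))
  exact ⟨Y, hY, hYD, h.self_of_nhds⟩

theorem SectionSpanned.exists_near {D : Distr E M} (hD : SectionSpanned D) {x : M}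
    {v : TangentSpace 𝓘(ℝ, E) x} (hv : v ∈ D x) :
    ∃ X : VField E M, X.IsSectionNear D x ∧ X x = v := by
  obtain ⟨X, h, h', e⟩ := hD x v hv
  exact ⟨X, .of_global h h', e⟩

theorem sectionSpanned_top [T2Space M] : SectionSpanned (E := E) (M := M) fun _ => ⊤ := by
  intro x v _
  obtain ⟨X, hX, e⟩ := exists_smooth_eq v
  exact ⟨X, hX, fun _ => trivial, e⟩

theorem sectionSpanned_bot : SectionSpanned (E := E) (M := M) fun _ => ⊥ := by
  intro x v hv
  exact ⟨fun _ => 0, fun _ => VField.SmoothAt.zero, fun y => Submodule.zero_mem _, ((Submodule.mem_bot ℝ).1 hv).symm⟩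

theorem SectionSpanned.sup {D D' : Distr E M} (h : SectionSpanned D) (h' : SectionSpanned D') :
    SectionSpanned fun x => D x ⊔ D' x := by
  intro x v hv
  obtain ⟨a, ha, b, hb, rfl⟩ := Submodule.mem_sup.1 hv
  obtain ⟨X, hX, hXD, rfl⟩ := h x a ha
  obtain ⟨Y, hY, hYD, rfl⟩ := h' x b hb
  exact ⟨fun y => X y + Y y, hX.add hY,
    fun y => Submodule.add_mem_sup (hXD y) (hYD y), rfl⟩

theorem SectionSpanned.finset_sup {ι : Type*} {s : Finset ι} {D : ι → Distr E M}
    (h : ∀ i ∈ s, SectionSpanned (D i)) : SectionSpanned fun x => s.sup fun i => D i x := by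
  classical
  induction s using Finset.induction_on with
  | empty => simpa using sectionSpanned_bot
  | insert a s ha ih =>
    simp only [Finset.sup_insert]
    exact (h a (by simp)).sup (ih fun i hi => h i (by simp [hi]))

/-- A linearly independent family of sections of `D` can be completed to a frame of `D`. -/
theorem SectionSpanned.exists_complement {D : Distr E M} (hD : SectionSpanned D) {n : ℕ}
    (hn : ∀ y, Module.finrank ℝ (D y) = n) {ι : Type*} [Fintype ι] {X : ι → VField E M} {x : M}
    (hX : ∀ i, (X i).IsSectionNear D x) (hLI : LinearIndependent ℝ fun i => X i x) :
    ∃ (p : ℕ) (Y : Fin p → VField E M), (∀ j, (Y j).IsSectionNear D x) ∧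
      IsFrameNear D (Sum.elim X Y) x := by
  have hle : Submodule.span ℝ (Set.range fun i => X i x) ≤ D x :=
    Submodule.span_le.2 (by rintro _ ⟨i, rfl⟩; exact (hX i).mem)
  obtain ⟨Q, hQ⟩ := (Submodule.span ℝ (Set.range fun i => X i x)).exists_isCompl
  -- By the modular law, `Q ⊓ D x` is a complement of the given span inside `D x`.
  let b := Module.finBasis ℝ (Q ⊓ D x : Submodule ℝ (TangentSpace 𝓘(ℝ, E) x))
  choose Y hY hYb using fun j => hD.exists_near (x := x) (v := (b j : TangentSpace 𝓘(ℝ, E) x))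
    (b j).2.2
  have hspanY : Submodule.span ℝ (Set.range fun j => Y j x) = Q ⊓ D x := by
    have h1 : (fun j => Y j x) = (Q ⊓ D x).subtype ∘ b := funext fun j => hYb j
    rw [h1, Set.range_comp, Submodule.span_image, b.span_eq, Submodule.map_top,
      Submodule.range_subtype]
  have hLIY : LinearIndependent ℝ fun j => Y j x := by
    have h1 : (fun j => Y j x) = (Q ⊓ D x).subtype ∘ b := funext fun j => hYb j
    rw [h1]
    exact b.linearIndependent.map' _ (Submodule.ker_subtype _)
  have hsec : ∀ s, (Sum.elim X Y s).IsSectionNear D x := by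
    rintro (i | j)
    · exact hX i
    · exact hY j
  have hLIx : LinearIndependent ℝ fun s => Sum.elim X Y s x := by
    have h1 : (fun s => Sum.elim X Y s x) = Sum.elim (fun i => X i x) fun j => Y j x := by
      ext (i | j) <;> rfl
    rw [h1]
    refine hLI.sum_type hLIY ?_
    rw [hspanY]
    exact hQ.disjoint.mono_right inf_le_left
  have hspanx : Submodule.span ℝ (Set.range fun s => Sum.elim X Y s x) = D x := by
    have h1 : (fun s => Sum.elim X Y s x) = Sum.elim (fun i => X i x) fun j => Y j x := by
      ext (i | j) <;> rfl
    rw [h1, Set.Sum.elim_range, Submodule.span_union, hspanY, ← sup_inf_assoc_of_le _ hle,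
      hQ.sup_eq_top, top_inf_eq]
  have hcard : Fintype.card (ι ⊕ Fin (Module.finrank ℝ (Q ⊓ D x : Submodule ℝ (TangentSpace 𝓘(ℝ, E) x)))) = n := by
    rw [← hn x, ← finrank_span_eq_card hLIx, hspanx]
  refine ⟨_, Y, hY, fun s => Filter.Eventually.mono (hsec s) fun y hy => hy.1, ?_⟩
  filter_upwards [eventually_linearIndependent (fun s => (hsec s).smoothAt) hLIx,
    Filter.eventually_all.2 hsec] with y hy hys
  -- Independence persists near `x`; since the rank of `D` is constant, the independent sections
  -- then still span `D y`.
  refine ⟨hy, Submodule.eq_of_le_of_finrank_eq (Submodule.span_le.2 ?_) ?_⟩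
  · rintro _ ⟨s, rfl⟩
    exact (hys s).2
  · rw [finrank_span_eq_card hy, hn y, hcard]

theorem SectionSpanned.exists_frame {D : Distr E M} (hD : SectionSpanned D) {n : ℕ}
    (hn : ∀ y, Module.finrank ℝ (D y) = n) (x : M) :
    ∃ (p : ℕ) (Y : Fin p → VField E M), IsFrameNear D Y x := by
  obtain ⟨p, Y, hY, h1, h2⟩ := hD.exists_complement hn (X := fun i : Fin 0 => i.elim0) (x := x)
    (fun i => i.elim0) (linearIndependent_empty_type)
  refine ⟨p, Y, fun j => h1 (Sum.inr j), h2.mono fun y hy => ⟨?_, ?_⟩⟩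
  · exact hy.1.comp _ Sum.inr_injective
  · rw [← hy.2]
    congr 1
    ext v
    simp

theorem SectionSpanned.isSmoothSubbundle {D : Distr E M} (hD : SectionSpanned D) {n : ℕ}
    (hn : ∀ y, Module.finrank ℝ (D y) = n) : IsSmoothSubbundle D :=
  isSmoothSubbundle_of_frames fun x => by
    obtain ⟨p, Y, h⟩ := hD.exists_frame hn x
    exact ⟨Fin p, inferInstance, Y, h⟩

theorem IsFrameNear.dualForm_spec {ι : Type*} [Fintype ι] [DecidableEq ι] {X : ι → VField E M}
    {x : M} (h : IsFrameNear (fun _ => ⊤) X x) :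
    ∀ᶠ y in 𝓝 x, (∀ i, (dualForm X i).SmoothAt y) ∧
      (∀ i j, dualForm X i y (X j y) = if i = j then 1 else 0) ∧
      ∀ v, ∑ i, dualForm X i y v • X i y = v := by
  filter_upwards [Filter.eventually_all.2 h.1, h.2] with y h1 h2
  exact ⟨dualForm_smoothAt h1 h2.1 h2.2, dualForm_apply_self h2.1 h2.2, dualForm_sum h2.1 h2.2⟩

theorem finrank_top_eq (y : M) :
    Module.finrank ℝ (⊤ : Submodule ℝ (TangentSpace 𝓘(ℝ, E) y)) = Module.finrank ℝ E :=
  finrank_top ℝ (TangentSpace 𝓘(ℝ, E) y)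

end Subbundles

/-! ### The flag generated by H -/

section Flag

variable {E : Type*} [NormedAddCommGroup E] [NormedSpace ℝ E] [FiniteDimensional ℝ E]
variable {M : Type*} [TopologicalSpace M] [ChartedSpace E M] [IsManifold 𝓘(ℝ, E) ∞ M]
variable {H : Distr E M}

theorem flag_le_succ (i : ℕ) (x : M) : flag H i x ≤ flag H (i + 1) x := by
  cases i with
  | zero => exact bot_le
  | succ i => exact le_sup_left

theorem flag_mono {i j : ℕ} (h : i ≤ j) (x : M) : flag H i x ≤ flag H j x := by
  induction h with
  | refl => exact le_rfl
  | step _ ih => exact ih.trans (flag_le_succ _ x)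

/-- The bracket at `x` sees only germs, so local sections may be replaced by global ones with the
same germs, as the definition of the flag demands. -/
theorem bracket_mem_flag [T2Space M] {k : ℕ} (hk : 1 ≤ k) {A B : VField E M} {x : M}
    (hA : A.IsSectionNear (flag H k) x) (hB : B.IsSectionNear H x) :
    VectorField.mlieBracket 𝓘(ℝ, E) A B x ∈ flag H (k + 1) x := by
  obtain ⟨A', hA', hAm, eA⟩ := hA.exists_global
  obtain ⟨B', hB', hBm, eB⟩ := hB.exists_global
  rw [← mlieBracket_congr eA eB]
  obtain ⟨i, rfl⟩ := Nat.exists_eq_add_of_le' hk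
  exact Submodule.mem_sup_right (Submodule.subset_span ⟨A', B', hA', hB', hAm, hBm, rfl⟩)

theorem VField.IsSectionNear.bracket [T2Space M] {k : ℕ} (hk : 1 ≤ k) {A B : VField E M} {x : M}
    (hA : A.IsSectionNear (flag H k) x) (hB : B.IsSectionNear H x) :
    VField.IsSectionNear (VectorField.mlieBracket 𝓘(ℝ, E) A B) (flag H (k + 1)) x := by
  filter_upwards [VField.IsSectionNear.eventually hA, VField.IsSectionNear.eventually hB] with y hAy hBy
  exact ⟨hAy.smoothAt.bracket hBy.smoothAt, bracket_mem_flag hk hAy hBy⟩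

/-- By recursion: the bracket of two admissible global fields is itself a global section of the next
term. -/
theorem flag_sectionSpanned [T2Space M] (hH : SectionSpanned H) (i : ℕ) :
    SectionSpanned (flag H i) := by
  match i with
  | 0 => exact sectionSpanned_bot
  | 1 => exact hH
  | (i + 2) =>
    refine (flag_sectionSpanned hH (i + 1)).sup (D' := fun x => Submodule.span ℝ _) ?_
    intro x v hv
    induction hv using Submodule.span_induction with
    | mem v hv =>
      obtain ⟨A, B, hA, hB, hAm, hBm, rfl⟩ := hv
      exact ⟨VectorField.mlieBracket 𝓘(ℝ, E) A B, hA.bracket hB,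
        fun y => Submodule.subset_span ⟨A, B, hA, hB, hAm, hBm, rfl⟩, rfl⟩
    | zero => exact ⟨fun _ => 0, fun _ => VField.SmoothAt.zero, fun y => Submodule.zero_mem _, rfl⟩
    | add v w _ _ hv hw =>
      obtain ⟨X, hX, hXm, rfl⟩ := hv
      obtain ⟨Y, hY, hYm, rfl⟩ := hw
      exact ⟨fun y => X y + Y y, hX.add hY,
        fun y => Submodule.add_mem _ (hXm y) (hYm y), rfl⟩
    | smul c v _ hv =>
      obtain ⟨X, hX, hXm, rfl⟩ := hv
      exact ⟨fun y => c • X y, hX.const_smul c,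
        fun y => Submodule.smul_mem _ _ (hXm y), rfl⟩

/-- Beyond index 1 each term is computed from the previous one by the same rule, so one repetition
repeats forever. -/
theorem flag_stationary {k : ℕ} (hk : 1 ≤ k) (h : flag H k = flag H (k + 1)) (j : ℕ) :
    flag H (k + j) = flag H k := by
  induction j with
  | zero => rfl
  | succ j ih =>
    obtain ⟨i, rfl⟩ := Nat.exists_eq_add_of_le' hk
    have e : i + 1 + (j + 1) = (i + j) + 2 := by ring
    have e' : i + 1 + j = i + j + 1 := by ring
    rw [e']  at ih
    rw [h, e]
    funext x
    simp only [flag]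
    rw [ih]

end Flag

namespace SubRiemannian

variable {E : Type*} [NormedAddCommGroup E] [NormedSpace ℝ E] [FiniteDimensional ℝ E]
variable {M : Type*} [TopologicalSpace M] [ChartedSpace E M] [IsManifold 𝓘(ℝ, E) ∞ M]
variable [T2Space M] (S : SubRiemannian E M) {r : ℕ}

theorem sectionSpanned_flag (i : ℕ) : SectionSpanned (flag S.H i) :=
  flag_sectionSpanned S.smooth_H.sectionSpanned i

variable {S}

theorem IsEquiregular.exists_rank (hr : S.IsEquiregular r) {i : ℕ} (hi : i ≤ r) :
    ∃ n : ℕ, ∀ x, Module.finrank ℝ (flag S.H i x) = n := by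
  rcases Nat.eq_zero_or_pos i with rfl | h
  · exact ⟨0, fun x => finrank_bot ℝ (TangentSpace 𝓘(ℝ, E) x)⟩
  · exact hr.const_rank i h hi

/-- Equality at one point spreads to all points by constant rank. The flag would then be stationary
from `k` on, so H_{r-1} would equal H_r, the whole tangent bundle. The outcome guarantees that
coframes are nonempty. -/
theorem IsEquiregular.flag_ne (hr : S.IsEquiregular r) {k : ℕ} (hk : 1 ≤ k) (hkr : k + 1 ≤ r)
    (x : M) : flag S.H k x ≠ flag S.H (k + 1) x := by
  intro h
  obtain ⟨n, hn⟩ := hr.exists_rank (i := k) (by omega)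
  obtain ⟨n', hn'⟩ := hr.exists_rank hkr
  have hnn : n = n' := by rw [← hn x, ← hn' x, h]
  have e : flag S.H k = flag S.H (k + 1) := funext fun y =>
    Submodule.eq_of_le_of_finrank_eq (flag_le_succ k y) (by rw [hn, hn', hnn])
  obtain ⟨z, hz⟩ := hr.ne_top (by omega)
  have h1 := flag_stationary hk e (r - 1 - k)
  have h2 := flag_stationary hk e (r - k)
  rw [show k + (r - 1 - k) = r - 1 by omega] at h1
  rw [show k + (r - k) = r by omega] at h2
  exact hz (by rw [h1, ← h2, hr.eq_top])

end SubRiemannian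

/-! ### Parseval frames and induced inner products -/

section Parseval

variable {W U : Type*} [AddCommGroup W] [Module ℝ W] [AddCommGroup U] [Module ℝ U]

/-- The form `b` is symmetric and `e` is a Parseval frame for it. -/
structure IsParseval (b : LinearMap.BilinForm ℝ W) {ι : Type*} [Fintype ι] (e : ι → W) :
    Prop where
  symm : ∀ v w, b v w = b w v
  sum_eq : ∀ w, ∑ s, b (e s) w • e s = w

namespace IsParseval

variable {b b' : LinearMap.BilinForm ℝ W} {ι : Type*} [Fintype ι] {e : ι → W}

theorem apply_eq (h : IsParseval b e) (v w : W) : b v w = ∑ s, b (e s) v * b (e s) w := by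
  conv_lhs => rw [← h.sum_eq w]
  rw [map_sum]
  refine Finset.sum_congr rfl fun s _ => ?_
  rw [map_smul, smul_eq_mul, h.symm v, mul_comm]

/-- By the Parseval identity b(w, w) is the sum of the squares of the coefficients b(e_s, w), and
these reconstruct w. -/
theorem pos (h : IsParseval b e) {w : W} (hw : w ≠ 0) : 0 < b w w := by
  rw [h.apply_eq]
  refine lt_of_le_of_ne (Finset.sum_nonneg fun s _ => mul_self_nonneg _) fun h0 => hw ?_
  have := (Finset.sum_eq_zero_iff_of_nonneg fun s _ => mul_self_nonneg (b (e s) w)).1 h0.symm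
  rw [← h.sum_eq w]
  exact Finset.sum_eq_zero fun s hs => by rw [mul_self_eq_zero.1 (this s hs), zero_smul]

/-- Expanding one argument with `b` and the other with `b'` leads to the same sum. A metric may
therefore be identified by a single Parseval frame. -/
theorem eq (h : IsParseval b e) (h' : IsParseval b' e) : b = b' := by
  ext u v
  conv_lhs => rw [← h'.sum_eq u]
  conv_rhs => rw [← h.sum_eq v]
  simp only [map_sum, map_smul, LinearMap.sum_apply, LinearMap.smul_apply, smul_eq_mul]
  exact Finset.sum_congr rfl fun s _ => by rw [h'.symm u, mul_comm]

theorem span_eq_top (h : IsParseval b e) : Submodule.span ℝ (Set.range e) = ⊤ :=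
  eq_top_iff.2 fun w _ => by
    rw [← h.sum_eq w]
    exact Submodule.sum_mem _ fun s _ => Submodule.smul_mem _ _ (Submodule.subset_span ⟨s, rfl⟩)

theorem finiteDimensional (h : IsParseval b e) : FiniteDimensional ℝ W :=
  Module.finite_def.2 (Submodule.fg_def.2 ⟨_, Set.finite_range e, h.span_eq_top⟩)

theorem reindex (h : IsParseval b e) {κ : Type*} [Fintype κ] (σ : κ ≃ ι) :
    IsParseval b (fun k => e (σ k)) :=
  ⟨h.symm, fun w => (σ.sum_comp fun s => b (e s) w • e s).trans (h.sum_eq w)⟩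

/-- A Parseval frame is mapped to a Parseval frame of a quotient. -/
theorem quotForm (h : IsParseval b e) {p : W →ₗ[ℝ] U} (hp : Function.Surjective p) :
    IsParseval (quotForm p b) fun s => p (e s) := by
  have := h.finiteDimensional
  have : FiniteDimensional ℝ U := Module.Finite.of_surjective p hp
  -- The adjoint of `p`: b(v, lift φ) = φ(p v). It takes values in the orthogonal complement of ker
  -- p. Composed with `p` it is an isomorphism from the dual of `U` to `U`, and the inverse
  -- isomorphism is the quotient form.
  let lift : Module.Dual ℝ U →ₗ[ℝ] W := ∑ s, (Module.Dual.eval ℝ U (p (e s))).smulRight (e s)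
  have hlift : ∀ φ, lift φ = ∑ s, φ (p (e s)) • e s := by
    intro φ
    simp [lift, LinearMap.sum_apply]
  have hb : ∀ φ v, b v (lift φ) = φ (p v) := by
    intro φ v
    rw [hlift]
    conv_rhs => rw [← h.sum_eq v]
    simp only [map_sum, map_smul, smul_eq_mul]
    exact Finset.sum_congr rfl fun s _ => by rw [h.symm v, mul_comm]
  have horth : ∀ φ, lift φ ∈ b.orthogonal (LinearMap.ker p) := by
    intro φ v hv
    change b v (lift φ) = 0
    rw [hb, LinearMap.mem_ker.1 hv, map_zero]
  have hinj : Function.Injective (p ∘ₗ lift) := by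
    refine (injective_iff_map_eq_zero _).2 fun φ hφ => ?_
    have h0 : b (lift φ) (lift φ) = 0 := by
      rw [hb]
      exact (congrArg φ hφ).trans (map_zero φ)
    have h1 : lift φ = 0 := by
      by_contra hne
      exact (h.pos hne).ne' h0
    ext u
    obtain ⟨v, rfl⟩ := hp u
    rw [← hb, h1, map_zero, LinearMap.zero_apply]
  have hsurj : Function.Surjective (p ∘ₗ lift) :=
    (LinearMap.injective_iff_surjective_of_finrank_eq_finrank Subspace.dual_finrank_eq).1 hinj
  let σ := LinearEquiv.ofBijective (p ∘ₗ lift) ⟨hinj, hsurj⟩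
  have hσ : ∀ φ, σ φ = p (lift φ) := fun _ => rfl
  have hex : ∃ β : LinearMap.BilinForm ℝ U, ∀ w ∈ b.orthogonal (LinearMap.ker p),
      ∀ w' ∈ b.orthogonal (LinearMap.ker p), β (p w) (p w') = b w w' := by
    refine ⟨σ.symm.toLinearMap, fun w hw w' _ => ?_⟩
    obtain ⟨sec, hsec⟩ := p.exists_rightInverse_of_surjective (LinearMap.range_eq_top.2 hp)
    let φ : Module.Dual ℝ U := (b.flip w) ∘ₗ sec
    have hφ : ∀ v, φ (p v) = b v w := by
      intro v
      have hk : sec (p v) - v ∈ LinearMap.ker p := by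
        rw [LinearMap.mem_ker, map_sub]
        exact sub_eq_zero.2 (LinearMap.congr_fun hsec (p v))
      have h0 : b (sec (p v) - v) w = 0 := hw _ hk
      rw [map_sub, LinearMap.sub_apply, sub_eq_zero] at h0
      exact h0
    have hpw : p w = σ φ := by
      rw [hσ, hlift]
      conv_lhs => rw [← h.sum_eq w]
      simp only [hφ]
    rw [hpw]
    simp only [LinearEquiv.coe_coe, LinearEquiv.symm_apply_apply]
    rw [hφ, h.symm]
  have hβ := Classical.epsilon_spec hex
  change ∀ w ∈ b.orthogonal (LinearMap.ker p), ∀ w' ∈ b.orthogonal (LinearMap.ker p),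
    SubRiem.quotForm p b (p w) (p w') = b w w' at hβ
  have hval : ∀ φ u, SubRiem.quotForm p b u (p (lift φ)) = φ u := by
    intro φ u
    obtain ⟨ψ, rfl⟩ := hsurj u
    rw [LinearMap.comp_apply, hβ _ (horth ψ) _ (horth φ), hb]
  refine ⟨fun u u' => ?_, fun u => ?_⟩
  · obtain ⟨ψ, rfl⟩ := hsurj u
    obtain ⟨φ, rfl⟩ := hsurj u'
    rw [LinearMap.comp_apply, LinearMap.comp_apply, hβ _ (horth ψ) _ (horth φ),
      hβ _ (horth φ) _ (horth ψ), h.symm]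
  · obtain ⟨φ, rfl⟩ := hsurj u
    simp only [LinearMap.comp_apply, hval]
    conv_rhs => rw [hlift, map_sum]
    simp only [map_smul]

theorem tmul {b : LinearMap.BilinForm ℝ W} {c : LinearMap.BilinForm ℝ U}
    {κ : Type*} [Fintype κ] {f : κ → U} (h : IsParseval b e) (h' : IsParseval c f) :
    IsParseval (b.tmul c) fun s : ι × κ => e s.1 ⊗ₜ[ℝ] f s.2 := by
  refine ⟨fun v w => ?_, fun w => ?_⟩
  · induction v using TensorProduct.induction_on with
    | zero => simp
    | add v v' hv hv' => simp only [map_add, LinearMap.add_apply, hv, hv']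
    | tmul x y =>
      induction w using TensorProduct.induction_on with
      | zero => simp
      | add v v' hv hv' => simp only [map_add, LinearMap.add_apply, hv, hv']
      | tmul z t =>
        simp only [LinearMap.BilinForm.tensorDistrib_tmul]
        rw [h.symm, h'.symm]
  · induction w using TensorProduct.induction_on with
    | zero => simp
    | add v v' hv hv' =>
      simp only [map_add, add_smul, Finset.sum_add_distrib, hv, hv']
    | tmul x y =>
      conv_rhs => rw [← h.sum_eq x, ← h'.sum_eq y]
      rw [Fintype.sum_prod_type, TensorProduct.sum_tmul]
      refine Finset.sum_congr rfl fun s _ => ?_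
      rw [TensorProduct.tmul_sum]
      refine Finset.sum_congr rfl fun t _ => ?_
      rw [TensorProduct.smul_tmul_smul]
      simp [mul_comm]

end IsParseval

theorem update_vec_zero (x y z : W) : Function.update ![x, y] 0 z = ![z, y] := by
  ext i; fin_cases i <;> rfl

theorem update_vec_one (x y z : W) : Function.update ![x, y] 1 z = ![x, z] := by
  ext i; fin_cases i <;> rfl

/-- The exterior product of two vectors, as a bilinear map. -/
def wedge₂ (W : Type*) [AddCommGroup W] [Module ℝ W] : W →ₗ[ℝ] W →ₗ[ℝ] ⋀[ℝ]^2 W :=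
  LinearMap.mk₂ ℝ (fun x y => exteriorPower.ιMulti ℝ 2 ![x, y])
    (fun x x' y => by
      have := (exteriorPower.ιMulti ℝ 2 (M := W)).map_update_add ![x, y] 0 x x'
      rwa [update_vec_zero, update_vec_zero, update_vec_zero] at this)
    (fun c x y => by
      have := (exteriorPower.ιMulti ℝ 2 (M := W)).map_update_smul ![x, y] 0 c x
      rwa [update_vec_zero, update_vec_zero] at this)
    (fun x y y' => by
      have := (exteriorPower.ιMulti ℝ 2 (M := W)).map_update_add ![x, y] 1 y y'
      rwa [update_vec_one, update_vec_one, update_vec_one] at this)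
    (fun c x y => by
      have := (exteriorPower.ιMulti ℝ 2 (M := W)).map_update_smul ![x, y] 1 c y
      rwa [update_vec_one, update_vec_one] at this)

theorem wedge₂_apply (x y : W) : wedge₂ W x y = exteriorPower.ιMulti ℝ 2 ![x, y] := rfl

theorem wedge₂_swap (x y : W) : wedge₂ W x y = -wedge₂ W y x := by
  have h : ∀ z : W, wedge₂ W z z = 0 := fun z =>
    (exteriorPower.ιMulti ℝ 2 (M := W)).map_eq_zero_of_eq ![z, z] (i := 0) (j := 1) rfl (by simp)
  have := h (x + y)
  simp only [map_add, LinearMap.add_apply, h, zero_add, add_zero] at this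
  rw [add_comm] at this
  exact eq_neg_of_add_eq_zero_left this

theorem wedgeForm_wedge₂ (b : LinearMap.BilinForm ℝ W) (x y z t : W) :
    wedgeForm b (wedge₂ W x y) (wedge₂ W z t) = b x z * b y t - b x t * b y z := by
  simp only [wedgeForm, wedge₂_apply, LinearMap.comp_apply, exteriorPower.map_apply_ιMulti,
    exteriorPower.pairingDual_ιMulti_ιMulti, Matrix.det_fin_two]
  simp
  ring

theorem wedge_induction {P : ⋀[ℝ]^2 W → Prop} (h : ∀ x y, P (wedge₂ W x y)) (h0 : P 0)
    (hadd : ∀ v w, P v → P w → P (v + w)) (hsmul : ∀ (c : ℝ) v, P v → P (c • v))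
    (v : ⋀[ℝ]^2 W) : P v := by
  have hv : v ∈ Submodule.span ℝ (Set.range (exteriorPower.ιMulti ℝ 2 (M := W))) := by
    rw [exteriorPower.ιMulti_span]; trivial
  induction hv using Submodule.span_induction with
  | mem v hv =>
    obtain ⟨u, rfl⟩ := hv
    have : u = ![u 0, u 1] := by ext i; fin_cases i <;> rfl
    rw [this]
    exact h _ _
  | zero => exact h0
  | add v w _ _ hv hw => exact hadd v w hv hw
  | smul c v _ hv => exact hsmul c v hv

/-- The family runs over ordered pairs, so each exterior product occurs twice up to sign; the factor
1/√2 compensates for this. -/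
theorem IsParseval.wedgeForm {b : LinearMap.BilinForm ℝ W} {ι : Type*} [Fintype ι] {e : ι → W}
    (h : IsParseval b e) :
    IsParseval (wedgeForm b) fun s : ι × ι => (√2)⁻¹ • wedge₂ W (e s.1) (e s.2) := by
  refine ⟨fun v w => ?_, fun w => ?_⟩
  · induction v using wedge_induction with
    | h0 => simp
    | hadd v v' hv hv' => simp only [map_add, LinearMap.add_apply, hv, hv']
    | hsmul c v hv => simp only [map_smul, LinearMap.smul_apply, hv]
    | h x y =>
      induction w using wedge_induction with
      | h0 => simp
      | hadd v v' hv hv' => simp only [map_add, LinearMap.add_apply, hv, hv']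
      | hsmul c v hv => simp only [map_smul, LinearMap.smul_apply, hv]
      | h z t =>
        rw [wedgeForm_wedge₂, wedgeForm_wedge₂, h.symm x, h.symm x, h.symm y, h.symm y]
        ring
  · induction w using wedge_induction with
    | h0 => simp
    | hadd v v' hv hv' =>
      simp only [map_add, add_smul, Finset.sum_add_distrib, hv, hv']
    | hsmul c v hv =>
      conv_rhs => rw [← hv, Finset.smul_sum]
      refine Finset.sum_congr rfl fun s _ => ?_
      rw [(SubRiem.wedgeForm b _).map_smul, smul_assoc]
    | h x y =>
      have key : ∀ x y : W, ∑ s : ι × ι, (b (e s.1) x * b (e s.2) y) • wedge₂ W (e s.1) (e s.2) =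
          wedge₂ W x y := by
        intro x y
        conv_rhs => rw [← h.sum_eq x, ← h.sum_eq y]
        rw [Fintype.sum_prod_type]
        simp only [map_sum, LinearMap.sum_apply, map_smul, LinearMap.smul_apply, Finset.smul_sum,
          smul_smul]
        refine Finset.sum_comm.trans ?_
        refine Finset.sum_congr rfl fun s _ => Finset.sum_congr rfl fun t _ => ?_
        rw [mul_comm]
      have h2 : (√2 : ℝ)⁻¹ * (√2)⁻¹ = 2⁻¹ := by
        rw [← mul_inv, Real.mul_self_sqrt (by norm_num)]
      calc ∑ s : ι × ι, SubRiem.wedgeForm b ((√2)⁻¹ • wedge₂ W (e s.1) (e s.2)) (wedge₂ W x y) •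
              (√2)⁻¹ • wedge₂ W (e s.1) (e s.2)
          = ∑ s : ι × ι, (2 : ℝ)⁻¹ • ((b (e s.1) x * b (e s.2) y) • wedge₂ W (e s.1) (e s.2) -
              (b (e s.1) y * b (e s.2) x) • wedge₂ W (e s.1) (e s.2)) := by
            refine Finset.sum_congr rfl fun s _ => ?_
            rw [map_smul, LinearMap.smul_apply, wedgeForm_wedge₂, smul_smul, smul_eq_mul,
              mul_right_comm, h2]
            module
        _ = wedge₂ W x y := by
            rw [← Finset.smul_sum, Finset.sum_sub_distrib, key, key, wedge₂_swap y x,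
              sub_neg_eq_add, ← two_smul ℝ, smul_smul]
            norm_num

theorem IsOrthonormalBasis.isParseval {b : LinearMap.BilinForm ℝ W} (hb : ∀ v w, b v w = b w v)
    {d : ℕ} {f : Fin d → W} (hf : IsOrthonormalBasis b f) : IsParseval b f := by
  refine ⟨hb, fun w => ?_⟩
  have hw : w ∈ Submodule.span ℝ (Set.range f) := by rw [hf.2]; trivial
  obtain ⟨c, rfl⟩ := (Submodule.mem_span_range_iff_exists_fun ℝ).1 hw
  simp [hf.1]

theorem IsOrthonormalBasis.linearIndependent {b : LinearMap.BilinForm ℝ W} {d : ℕ} {f : Fin d → W}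
    (hf : IsOrthonormalBasis b f) : LinearIndependent ℝ f := by
  refine Fintype.linearIndependent_iff.2 fun c hc i => ?_
  have := congrArg (b (f i)) hc
  simpa [hf.1] using this

theorem IsOrthonormalBasis.finrank {b : LinearMap.BilinForm ℝ W} {d : ℕ} {f : Fin d → W}
    (hf : IsOrthonormalBasis b f) : Module.finrank ℝ W = d := by
  rw [← finrank_top, ← hf.2, finrank_span_eq_card hf.linearIndependent, Fintype.card_fin]

end Parseval

/-! ### Bracket forms and the inner products on Ĥ_m -/

namespace SubRiemannian

variable {E : Type*} [NormedAddCommGroup E] [NormedSpace ℝ E] [FiniteDimensional ℝ E]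
variable {M : Type*} [TopologicalSpace M] [ChartedSpace E M] [IsManifold 𝓘(ℝ, E) ∞ M]
variable {S : SubRiemannian E M} {r : ℕ}

theorem H_le_flag (S : SubRiemannian E M) {k : ℕ} (hk : 1 ≤ k) (x : M) : S.H x ≤ flag S.H k x :=
  flag_mono (H := S.H) hk x

theorem cls_eq_iff {m : ℕ} {x : M} (v w : flag S.H m x) :
    S.cls m x v = S.cls m x w ↔
      (v : TangentSpace 𝓘(ℝ, E) x) - w ∈ flag S.H (m - 1) x :=
  Submodule.Quotient.eq _

theorem cls_eq_zero_iff {m : ℕ} {x : M} (v : flag S.H m x) :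
    S.cls m x v = 0 ↔ (v : TangentSpace 𝓘(ℝ, E) x) ∈ flag S.H (m - 1) x :=
  Submodule.Quotient.mk_eq_zero _

theorem cls_surjective (m : ℕ) (x : M) : Function.Surjective (S.cls m x) :=
  Submodule.mkQ_surjective _

theorem exists_cls {m : ℕ} {x : M} (a : S.Hat m x) :
    ∃ (v : TangentSpace 𝓘(ℝ, E) x) (hv : v ∈ flag S.H m x), S.cls m x ⟨v, hv⟩ = a := by
  obtain ⟨v, rfl⟩ := S.cls_surjective m x a
  exact ⟨v, v.2, rfl⟩

/-- The exterior derivative of a form that annihilates `H_k`, on `H_k` and `H`. -/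
theorem extDer_section {k : ℕ} (hk : 1 ≤ k) {φ : OneForm E M} {x : M} (hφ : φ.SmoothAt x)
    (hφ0 : ∀ᶠ y in 𝓝 x, ∀ v ∈ flag S.H k y, φ y v = 0) {A B : VField E M}
    (hA : A.IsSectionNear (flag S.H k) x) (hB : B.IsSectionNear S.H x) :
    extDer φ x (A x) (B x) = -φ x (VectorField.mlieBracket 𝓘(ℝ, E) A B x) := by
  refine extDer_apply_eq_neg hφ hA.smoothAt hB.smoothAt (c := 0) (c' := 0) ?_ ?_
  · filter_upwards [hφ0, hA] with y h1 h2 using h1 _ h2.2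
  · filter_upwards [hφ0, hB] with y h1 h2 using h1 _ (S.H_le_flag hk y h2.2)

variable [T2Space M]

/-- Extending to sections, dφ(A, B) = -φ[A, B], and the bracket of a section of H_{k-1} with one of
H lies in H_k, where φ vanishes. Thus dφ descends to Ĥ_k × H. For k = 1 the space H_0 is zero. -/
theorem extDer_lower {k : ℕ} (hk : 1 ≤ k) {φ : OneForm E M} {x : M} (hφ : φ.SmoothAt x)
    (hφ0 : ∀ᶠ y in 𝓝 x, ∀ v ∈ flag S.H k y, φ y v = 0) {v w : TangentSpace 𝓘(ℝ, E) x}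
    (hv : v ∈ flag S.H (k - 1) x) (hw : w ∈ S.H x) : extDer φ x v w = 0 := by
  rcases Nat.lt_or_ge 1 k with h | h
  · obtain ⟨A, hA, rfl⟩ := (S.sectionSpanned_flag (k - 1)).exists_near hv
    obtain ⟨B, hB, rfl⟩ := (S.sectionSpanned_flag 1).exists_near hw
    rw [extDer_section hk hφ hφ0 (hA.mono fun y => flag_mono (Nat.sub_le k 1) y) hB,
      hφ0.self_of_nhds, neg_zero]
    have := bracket_mem_flag (k := k - 1) (by omega) hA hB
    rwa [Nat.sub_add_cancel hk] at this
  · have : k - 1 = 0 := by omega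
    rw [this] at hv
    rw [(Submodule.mem_bot ℝ).1 hv, map_zero, LinearMap.zero_apply]

/-- A frame of H_k is completed to one of H_{k+1} and then to one of TM; the coframe is the part of
the dual basis that belongs to the middle block. It need not be orthonormal, and it serves until the
metric on Ĥ_{k+1} is known to be smooth. -/
theorem IsEquiregular.exists_flag_coframe (hr : S.IsEquiregular r) {k : ℕ} (hk : k + 1 ≤ r)
    (x : M) : ∃ (d : ℕ) (Y : Fin d → VField E M) (φ : Fin d → OneForm E M),
      (∀ i, (Y i).IsSectionNear (flag S.H (k + 1)) x) ∧
      ∀ᶠ y in 𝓝 x, (∀ i, (φ i).SmoothAt y) ∧ (∀ i j, φ i y (Y j y) = if i = j then 1 else 0) ∧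
        (∀ i, ∀ v ∈ flag S.H k y, φ i y v = 0) ∧
        ∀ v ∈ flag S.H (k + 1) y, v - ∑ i, φ i y v • Y i y ∈ flag S.H k y := by
  obtain ⟨n, hn⟩ := hr.exists_rank (i := k) (by omega)
  obtain ⟨n', hn'⟩ := hr.exists_rank hk
  obtain ⟨p, X, hX⟩ := (S.sectionSpanned_flag k).exists_frame hn x
  obtain ⟨d, Y, hY, hXY⟩ := (S.sectionSpanned_flag (k + 1)).exists_complement hn'
    (fun i => (hX.isSectionNear i).mono (flag_le_succ k)) hX.2.self_of_nhds.1
  obtain ⟨q, Z, hZ, hXYZ⟩ := (sectionSpanned_top (E := E) (M := M)).exists_complement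
    (fun y => finrank_top_eq y) (X := Sum.elim X Y)
    (fun i => (hXY.isSectionNear i).mono fun _ => le_top) hXY.2.self_of_nhds.1
  refine ⟨d, Y, fun i => dualForm (Sum.elim (Sum.elim X Y) Z) (Sum.inl (Sum.inr i)), hY, ?_⟩
  filter_upwards [hXYZ.dualForm_spec, hX.2, hXY.2] with y ⟨h1, h2, h3⟩ h4 h5
  have hkill : ∀ i, ∀ v ∈ flag S.H k y,
      dualForm (Sum.elim (Sum.elim X Y) Z) (Sum.inl (Sum.inr i)) y v = 0 := by
    intro i v hv
    rw [← h4.2] at hv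
    obtain ⟨c, rfl⟩ := (Submodule.mem_span_range_iff_exists_fun ℝ).1 hv
    rw [map_sum]
    refine Finset.sum_eq_zero fun j _ => ?_
    have := h2 (Sum.inl (Sum.inr i)) (Sum.inl (Sum.inl j))
    simp only [Sum.elim_inl, Sum.inl.injEq, reduceCtorEq, if_false] at this
    rw [map_smul, this, smul_zero]
  have hYY : ∀ i j, dualForm (Sum.elim (Sum.elim X Y) Z) (Sum.inl (Sum.inr i)) y (Y j y) =
      if i = j then 1 else 0 := by
    intro i j
    have := h2 (Sum.inl (Sum.inr i)) (Sum.inl (Sum.inr j))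
    simpa using this
  refine ⟨fun i => h1 _, hYY, hkill, fun v hv => ?_⟩
  rw [← h5.2] at hv
  obtain ⟨c, rfl⟩ := (Submodule.mem_span_range_iff_exists_fun ℝ).1 hv
  have hXm : ∀ j, X j y ∈ flag S.H k y := fun j => h4.2 ▸ Submodule.subset_span ⟨j, rfl⟩
  have e : ∀ i, dualForm (Sum.elim (Sum.elim X Y) Z) (Sum.inl (Sum.inr i)) y
      (∑ s, c s • Sum.elim X Y s y) = c (Sum.inr i) := by
    intro i
    rw [Fintype.sum_sum_type, map_add, map_sum, map_sum]
    simp only [Sum.elim_inl, Sum.elim_inr, map_smul, hYY, hkill _ _ (hXm _)]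
    simp
  simp only [e]
  rw [Fintype.sum_sum_type]
  simp only [Sum.elim_inl, Sum.elim_inr, add_sub_cancel_right]
  exact Submodule.sum_mem _ fun j _ => Submodule.smul_mem _ _ (hXm j)

/-- A form with the required property is Σ dφ_i(a, b) [Y_i]. It descends to Ĥ_k by `extDer_lower`,
and the sign in dφ(A, B) = -φ[A, B] is the sign in the definition of the bracket form. -/
theorem IsEquiregular.isBracketForm (hr : S.IsEquiregular r) {k : ℕ} (hk : 1 ≤ k)
    (hkr : k + 1 ≤ r) (x : M) : S.IsBracketForm k x (S.bracketForm k x) := by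
  obtain ⟨d, Y, φ, hY, h⟩ := hr.exists_flag_coframe hkr x
  have hφs : ∀ i, (φ i).SmoothAt x := h.self_of_nhds.1
  have hφ0 : ∀ i, ∀ᶠ y in 𝓝 x, ∀ v ∈ flag S.H k y, φ i y v = 0 :=
    fun i => h.mono fun y hy => hy.2.2.1 i
  let β₀ : flag S.H k x →ₗ[ℝ] S.H x →ₗ[ℝ] S.Hat (k + 1) x :=
    ∑ i, ((extDer (φ i) x).compl₁₂ (flag S.H k x).subtype (S.H x).subtype).compr₂
      (LinearMap.toSpanSingleton ℝ _ (S.cls (k + 1) x ⟨Y i x, (hY i).mem⟩))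
  have hβ₀ : ∀ a b, β₀ a b = ∑ i, extDer (φ i) x a b • S.cls (k + 1) x ⟨Y i x, (hY i).mem⟩ := by
    intro a b
    simp [β₀, LinearMap.sum_apply]
  refine Classical.epsilon_spec (p := S.IsBracketForm k x)
    ⟨Submodule.liftQ _ β₀ fun a ha => ?_, fun A B hA hB hAs hBs c hc => ?_⟩
  · rw [LinearMap.mem_ker]
    ext1 b
    rw [hβ₀, LinearMap.zero_apply]
    exact Finset.sum_eq_zero fun i _ => by
      rw [show extDer (φ i) x (a : TangentSpace 𝓘(ℝ, E) x) (b : TangentSpace 𝓘(ℝ, E) x) = 0 from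
        extDer_lower hk (hφs i) (hφ0 i) ha b.2, zero_smul]
  · have e : β₀ ⟨A x, hA x⟩ ⟨B x, hB x⟩ = S.cls (k + 1) x c := by
      rw [hβ₀]
      simp only [extDer_section hk (hφs _) (hφ0 _) (.of_global hAs hA) (.of_global hBs hB)]
      have hm := h.self_of_nhds.2.2.2 c c.2
      have := (S.cls_eq_iff (m := k + 1) c
        (∑ i, φ i x c • (⟨Y i x, (hY i).mem⟩ : flag S.H (k + 1) x))).2 (by
          simpa using hm)
      rw [this, map_sum]
      refine Finset.sum_congr rfl fun i _ => ?_
      rw [map_smul, hc, map_neg]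
    exact e

theorem IsEquiregular.bracketForm_section (hr : S.IsEquiregular r) {k : ℕ} (hk : 1 ≤ k)
    (hkr : k + 1 ≤ r) {x : M} {A B : VField E M} (hA : A.IsSectionNear (flag S.H k) x)
    (hB : B.IsSectionNear S.H x) (c : flag S.H (k + 1) x)
    (hc : (c : TangentSpace 𝓘(ℝ, E) x) = -VectorField.mlieBracket 𝓘(ℝ, E) A B x) :
    S.bracketForm k x (S.cls k x ⟨A x, hA.mem⟩) ⟨B x, hB.mem⟩ = S.cls (k + 1) x c := by
  obtain ⟨A', hA', hAm, eA⟩ := hA.exists_global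
  obtain ⟨B', hB', hBm, eB⟩ := hB.exists_global
  have := hr.isBracketForm hk hkr x A' B' hAm hBm hA' hB' c (by rw [hc, mlieBracket_congr eA eB])
  simpa only [eA.self_of_nhds, eB.self_of_nhds] using this

/-- A form that annihilates `H_k` near `x`, as a linear form on `Ĥ_{k+1}`. -/
theorem IsEquiregular.apply_bracketForm (hr : S.IsEquiregular r) {k : ℕ} (hk : 1 ≤ k)
    (hkr : k + 1 ≤ r) {x : M} {φ : OneForm E M} (hφ : φ.SmoothAt x)
    (hφ0 : ∀ᶠ y in 𝓝 x, ∀ v ∈ flag S.H k y, φ y v = 0)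
    {Φ : Module.Dual ℝ (S.Hat (k + 1) x)}
    (hΦ : ∀ c : flag S.H (k + 1) x, Φ (S.cls (k + 1) x c) = φ x c) (a : flag S.H k x) (b : S.H x) :
    Φ (S.bracketForm k x (S.cls k x a) b) = extDer φ x a b := by
  obtain ⟨A, hA, eA⟩ := (S.sectionSpanned_flag k).exists_near a.2
  obtain ⟨B, hB, eB⟩ := (S.sectionSpanned_flag 1).exists_near b.2
  have ea : a = ⟨A x, hA.mem⟩ := Subtype.ext eA.symm
  have eb : b = ⟨B x, VField.IsSectionNear.mem (D := S.H) hB⟩ := Subtype.ext eB.symm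
  rw [ea, eb, hr.bracketForm_section hk hkr hA hB
    ⟨-VectorField.mlieBracket 𝓘(ℝ, E) A B x, Submodule.neg_mem _ (bracket_mem_flag hk hA hB)⟩ rfl,
    hΦ, map_neg, extDer_section hk hφ hφ0 hA hB]

/-- Modulo H_k, the space H_{k+1} is by definition spanned by brackets. From this comes the
surjectivity of `piOne` and `piTensor`. -/
theorem IsEquiregular.bracketForm_span (hr : S.IsEquiregular r) {k : ℕ} (hk : 1 ≤ k)
    (hkr : k + 1 ≤ r) (x : M) (R : Submodule ℝ (S.Hat (k + 1) x))
    (hR : ∀ a b, S.bracketForm k x a b ∈ R) : R = ⊤ := by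
  refine eq_top_iff.2 fun u _ => ?_
  obtain ⟨v, hv, rfl⟩ := exists_cls u
  obtain ⟨i, rfl⟩ := Nat.exists_eq_add_of_le' hk
  have hv' : v ∈ flag S.H (i + 2) x := hv
  simp only [flag] at hv'
  obtain ⟨a, ha, b, hb, rfl⟩ := Submodule.mem_sup.1 hv'
  have key : b ∈ (R.comap (S.cls (i + 1 + 1) x)).map (flag S.H (i + 2) x).subtype := by
    refine Submodule.span_le.2 ?_ hb
    rintro w ⟨A, B, hA, hB, hAm, hBm, rfl⟩
    have hm := bracket_mem_flag (H := S.H) (k := i + 1) hk (x := x) (.of_global hA hAm)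
      (.of_global hB hBm)
    refine ⟨⟨_, hm⟩, ?_, rfl⟩
    have := hr.isBracketForm hk hkr x A B hAm hBm hA hB ⟨_, Submodule.neg_mem _ hm⟩ rfl
    have h2 := R.neg_mem (hR (S.cls (i + 1) x ⟨A x, hAm x⟩) ⟨B x, hBm x⟩)
    rw [this, ← map_neg] at h2
    change S.cls (i + 1 + 1) x _ ∈ R
    convert h2 using 2
    ext1
    simp
  obtain ⟨b', hb', rfl⟩ := key
  have : S.cls (i + 1 + 1) x ⟨a + b', hv⟩ = S.cls (i + 1 + 1) x b' :=
    (cls_eq_iff _ _).2 (by simpa using ha)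
  exact this ▸ hb'

/-- Since [A, A] = 0, the bracket form on H is alternating and so factors through the exterior
square; the choice in `piOne` therefore has a candidate. -/
theorem IsEquiregular.piOne_wedge₂ (hr : S.IsEquiregular r) (h2 : 2 ≤ r) (x : M) (X Y : S.H x) :
    S.piOne x (wedge₂ _ X Y) = S.bracketForm 1 x (S.cls 1 x X) Y := by
  let β : S.H x →ₗ[ℝ] S.H x →ₗ[ℝ] S.Hat 2 x := S.bracketForm 1 x ∘ₗ S.cls 1 x
  have halt : ∀ X, β X X = 0 := by
    intro X
    obtain ⟨A, hA, e⟩ := (S.sectionSpanned_flag 1).exists_near X.2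
    have eX : X = ⟨A x, VField.IsSectionNear.mem (D := S.H) hA⟩ := Subtype.ext e.symm
    have := hr.bracketForm_section le_rfl h2 hA hA 0 (by simp)
    rw [map_zero] at this
    rw [eX]
    exact this
  let f : S.H x [⋀^Fin 2]→ₗ[ℝ] S.Hat 2 x :=
    { toFun := fun v => β (v 0) (v 1)
      map_update_add' := by
        intro _ v i a b
        fin_cases i <;> simp [Function.update]
      map_update_smul' := by
        intro _ v i a b
        fin_cases i <;> simp [Function.update]
      map_eq_zero_of_eq' := by
        intro v i j hij hne
        have : v 0 = v 1 := by
          fin_cases i <;> fin_cases j <;> simp_all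
        simp only [this, halt] }
  have := Classical.epsilon_spec (p := fun p : ⋀[ℝ]^2 (S.H x) →ₗ[ℝ] S.Hat 2 x =>
    ∀ X Y : S.H x, p (exteriorPower.ιMulti ℝ 2 ![X, Y]) = S.bracketForm 1 x (S.cls 1 x X) Y)
    ⟨exteriorPower.alternatingMapLinearEquiv f, fun X Y => by
      rw [exteriorPower.alternatingMapLinearEquiv_apply_ιMulti]
      rfl⟩
  exact this X Y

theorem IsEquiregular.piOne_surjective (hr : S.IsEquiregular r) (h2 : 2 ≤ r) (x : M) :
    Function.Surjective (S.piOne x) := by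
  refine LinearMap.range_eq_top.1 (hr.bracketForm_span le_rfl h2 x _ fun a b => ?_)
  obtain ⟨X, rfl⟩ := S.cls_surjective 1 x a
  exact ⟨wedge₂ _ X b, hr.piOne_wedge₂ h2 x X b⟩

theorem piTensor_tmul (j : ℕ) (x : M) (X : S.H x) (b : S.Hat j x) :
    S.piTensor j x (X ⊗ₜ b) = -S.bracketForm j x b X := by
  simp [piTensor]

theorem IsEquiregular.piTensor_surjective (hr : S.IsEquiregular r) {j : ℕ} (hj : 1 ≤ j)
    (hjr : j + 1 ≤ r) (x : M) : Function.Surjective (S.piTensor j x) := by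
  refine LinearMap.range_eq_top.1 (hr.bracketForm_span hj hjr x _ fun a b => ?_)
  exact ⟨-(b ⊗ₜ a), by rw [map_neg, piTensor_tmul, neg_neg]⟩

theorem isParseval_hatForm_one {x : M} {ι : Type*} [Fintype ι] {X : ι → S.H x}
    (hX : IsParseval (S.g x) X) : IsParseval (S.hatForm x 1) fun a => S.cls 1 x (X a) :=
  hX.quotForm (S.cls_surjective 1 x)

theorem IsEquiregular.isParseval_hatForm_two (hr : S.IsEquiregular r) (h2 : 2 ≤ r) {x : M}
    {ι : Type*} [Fintype ι] {X : ι → S.H x} (hX : IsParseval (S.g x) X) :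
    IsParseval (S.hatForm x 2) fun s : ι × ι =>
      (√2)⁻¹ • S.bracketForm 1 x (S.cls 1 x (X s.1)) (X s.2) := by
  have := hX.wedgeForm.quotForm (hr.piOne_surjective h2 x)
  simp only [map_smul, hr.piOne_wedge₂ h2 x] at this
  exact this

theorem IsEquiregular.isParseval_hatForm_succ (hr : S.IsEquiregular r) {m : ℕ} (hm : 2 ≤ m)
    (hmr : m + 1 ≤ r) {x : M} {ι κ : Type*} [Fintype ι] [Fintype κ] {X : ι → S.H x}
    (hX : IsParseval (S.g x) X) {f : κ → S.Hat m x} (hf : IsParseval (S.hatForm x m) f) :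
    IsParseval (S.hatForm x (m + 1)) fun s : κ × ι => S.bracketForm m x (f s.1) (X s.2) := by
  obtain ⟨j, rfl⟩ := Nat.exists_eq_add_of_le' hm
  have := (hX.tmul hf).quotForm (hr.piTensor_surjective (by omega) hmr x)
  simp only [piTensor_tmul] at this
  have h2 := this.reindex (Equiv.prodComm κ ι)
  refine ⟨h2.symm, fun w => ?_⟩
  have h3 := h2.sum_eq w
  -- The sign in `piTensor` disappears because each frame vector occurs twice in the Parseval
  -- identity.
  simp only [map_neg, LinearMap.neg_apply, smul_neg, neg_smul, neg_neg] at h3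
  exact h3

end SubRiemannian

/-! ### Gram–Schmidt for smooth families of forms -/

section GramSchmidt

variable {E : Type*} [NormedAddCommGroup E] [NormedSpace ℝ E] [FiniteDimensional ℝ E]
variable {M : Type*} [TopologicalSpace M] [ChartedSpace E M] [IsManifold 𝓘(ℝ, E) ∞ M]
variable {D : Distr E M} {b : ∀ y, LinearMap.BilinForm ℝ (D y)}

/-- A family of bilinear forms on `D`, extended by zero to all tangent vectors. -/
def extForm (b : ∀ y, LinearMap.BilinForm ℝ (D y)) (y : M) (v w : TangentSpace 𝓘(ℝ, E) y) : ℝ :=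
  open Classical in if h : v ∈ D y ∧ w ∈ D y then b y ⟨v, h.1⟩ ⟨w, h.2⟩ else 0

theorem extForm_apply {y : M} {v w : TangentSpace 𝓘(ℝ, E) y} (hv : v ∈ D y) (hw : w ∈ D y) :
    extForm b y v w = b y ⟨v, hv⟩ ⟨w, hw⟩ := dif_pos ⟨hv, hw⟩

theorem extForm_coe {y : M} (v w : D y) : extForm b y v w = b y v w := extForm_apply v.2 w.2

/-- The family `b` of bilinear forms is smooth near `x`. -/
def SmoothFormNear (b : ∀ y, LinearMap.BilinForm ℝ (D y)) (x : M) : Prop :=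
  ∀ A B : VField E M, A.IsSectionNear D x → B.IsSectionNear D x →
    ∀ᶠ y in 𝓝 x, SmoothFnAt E (fun y => extForm b y (A y) (B y)) y

/-- Gram–Schmidt by induction on the number of fields. Positivity is needed at `x` only, since the
norm to be divided by stays positive nearby by continuity. The statement about spans at `x` keeps
the induction going: it lets the norm of the next vector be read off from `hpos`. -/
theorem SmoothFormNear.exists_orthonormal {x : M} (hb : SmoothFormNear b x)
    (hsymm : ∀ᶠ y in 𝓝 x, ∀ v w, b y v w = b y w v) {d : ℕ} (Y : Fin d → VField E M)
    (hY : ∀ i, (Y i).IsSectionNear D x)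
    (hpos : ∀ c : Fin d → ℝ, c ≠ 0 → 0 < extForm b x (∑ i, c i • Y i x) (∑ i, c i • Y i x)) :
    ∃ U : Fin d → VField E M, (∀ i, (U i).IsSectionNear D x) ∧
      (∀ i, U i x ∈ Submodule.span ℝ (Set.range fun i => Y i x)) ∧
      ∀ᶠ y in 𝓝 x, ∀ i j, extForm b y (U i y) (U j y) = if i = j then 1 else 0 := by
  induction d with
  | zero => exact ⟨Y, hY, fun i => i.elim0, .of_forall fun _ i => i.elim0⟩
  | succ d ih =>
    obtain ⟨U, hU, hUs, hUo⟩ := ih (fun i => Y i.castSucc) (fun i => hY _) fun c hc => by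
      have := hpos (Fin.snoc (α := fun _ => ℝ) c 0) fun h => hc (funext fun i => by
        simpa using congrFun h i.castSucc)
      simpa [Fin.sum_univ_castSucc] using this
    let L := Y (Fin.last d)
    have hL : L.IsSectionNear D x := hY _
    let Z : VField E M := fun y => L y - ∑ i, extForm b y (U i y) (L y) • U i y
    have hZ : Z.IsSectionNear D x :=
      hL.sub (.sum fun i _ => (hU i).smul (hb _ _ (hU i) hL))
    let N : M → ℝ := fun y => extForm b y (Z y) (Z y)
    have hNs : ∀ᶠ y in 𝓝 x, SmoothFnAt E N y := hb _ _ hZ hZ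
    have hNx : 0 < N x := by
      have hmem : ∑ i, extForm b x (U i x) (L x) • U i x ∈
          Submodule.span ℝ (Set.range fun i : Fin d => Y i.castSucc x) :=
        Submodule.sum_mem _ fun i _ => Submodule.smul_mem _ _ (hUs i)
      obtain ⟨c, hc⟩ := (Submodule.mem_span_range_iff_exists_fun ℝ).1 hmem
      have e : Z x = ∑ i, (Fin.snoc (α := fun _ => ℝ) (-c) 1 : Fin (d + 1) → ℝ) i • Y i x := by
        simp only [Fin.sum_univ_castSucc, Fin.snoc_castSucc, Fin.snoc_last, Pi.neg_apply, neg_smul,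
          Finset.sum_neg_distrib, hc, one_smul, Z, L]
        abel
      change 0 < extForm b x (Z x) (Z x)
      rw [e]
      refine hpos _ fun h => ?_
      have := congrFun h (Fin.last d)
      simp at this
    have hNpos : ∀ᶠ y in 𝓝 x, 0 < N y :=
      hNs.self_of_nhds.continuousAt.eventually (lt_mem_nhds hNx)
    let V : VField E M := fun y => (√(N y))⁻¹ • Z y
    have hV : V.IsSectionNear D x := hZ.smul (by
      filter_upwards [hNs, hNpos] with y h1 h2
      exact (h1.sqrt h2.ne').inv (Real.sqrt_ne_zero'.2 h2))
    refine ⟨Fin.snoc (α := fun _ => VField E M) U V, ?_, ?_, ?_⟩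
    · intro i
      refine Fin.lastCases ?_ (fun i => ?_) i
      · simpa using hV
      · simpa using hU i
    · have hle : Submodule.span ℝ (Set.range fun i : Fin d => Y i.castSucc x) ≤
          Submodule.span ℝ (Set.range fun i => Y i x) :=
        Submodule.span_mono (by rintro _ ⟨i, rfl⟩; exact ⟨_, rfl⟩)
      intro i
      refine Fin.lastCases ?_ (fun i => ?_) i
      · simp only [Fin.snoc_last]
        exact Submodule.smul_mem _ _ (Submodule.sub_mem _ (Submodule.subset_span ⟨_, rfl⟩)
          (Submodule.sum_mem _ fun i _ => Submodule.smul_mem _ _ (hle (hUs i))))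
      · simpa using hle (hUs i)
    · filter_upwards [hUo, hNpos, hL, hZ, Filter.eventually_all.2 hU, hsymm]
        with y h1 h2 h3 h4 h5 hsy
      let u : Fin d → D y := fun i => ⟨U i y, (h5 i).2⟩
      let l : D y := ⟨L y, h3.2⟩
      let z : D y := ⟨Z y, h4.2⟩
      have huu : ∀ i j, b y (u i) (u j) = if i = j then 1 else 0 := fun i j => by
        rw [← h1 i j]; exact (extForm_coe (u i) (u j)).symm
      have hz : z = l - ∑ i, b y (u i) l • u i := by
        ext1
        simp only [z, Z, u, l, Submodule.coe_sub, Submodule.coe_sum, Submodule.coe_smul]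
        congr 1
        exact Finset.sum_congr rfl fun i _ => by rw [extForm_apply (h5 i).2 h3.2]
      have huz : ∀ i, b y (u i) z = 0 := by
        intro i
        rw [hz]
        simp [huu]
      have hzz : b y z z = N y := (extForm_coe z z).symm
      have hVv : V y = ((√(N y))⁻¹ • z : D y) := rfl
      intro i j
      refine Fin.lastCases ?_ (fun i => ?_) i <;> refine Fin.lastCases ?_ (fun j => ?_) j
      · simp only [Fin.snoc_last, if_true]
        rw [hVv, extForm_coe]
        simp only [map_smul, LinearMap.smul_apply, smul_eq_mul, hzz]
        rw [← mul_assoc, ← mul_inv, Real.mul_self_sqrt h2.le, inv_mul_cancel₀ h2.ne']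
      · simp only [Fin.snoc_last, Fin.snoc_castSucc]
        rw [hVv, show U j y = u j from rfl, extForm_coe, hsy]
        simp [huz, (Fin.castSucc_lt_last j).ne']
      · simp only [Fin.snoc_last, Fin.snoc_castSucc]
        rw [hVv, show U i y = u i from rfl, extForm_coe]
        simp [huz, (Fin.castSucc_lt_last i).ne]
      · simp only [Fin.snoc_castSucc, h1, Fin.castSucc_inj]

end GramSchmidt

/-! ### Smooth orthonormal frames of Ĥ_m -/

namespace SubRiemannian

variable {E : Type*} [NormedAddCommGroup E] [NormedSpace ℝ E] [FiniteDimensional ℝ E]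
variable {M : Type*} [TopologicalSpace M] [ChartedSpace E M] [IsManifold 𝓘(ℝ, E) ∞ M]
variable {S : SubRiemannian E M} {r : ℕ}

/-- A form that annihilates `H_{m-1}`, as a linear form on `Ĥ_m`. -/
def hatDual {m : ℕ} {x : M} (φ : TangentSpace 𝓘(ℝ, E) x →L[ℝ] ℝ)
    (h : ∀ v ∈ flag S.H (m - 1) x, φ v = 0) : Module.Dual ℝ (S.Hat m x) :=
  Submodule.liftQ _ (φ.toLinearMap ∘ₗ (flag S.H m x).subtype) fun v hv => h v hv

theorem hatDual_cls {m : ℕ} {x : M} {φ : TangentSpace 𝓘(ℝ, E) x →L[ℝ] ℝ}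
    (h : ∀ v ∈ flag S.H (m - 1) x, φ v = 0) (v : flag S.H m x) :
    hatDual (S := S) φ h (S.cls m x v) = φ v := rfl

/-- The inner product of `Ĥ_m`, as a form on `H_m`. -/
def flagForm (S : SubRiemannian E M) (m : ℕ) (y : M) : LinearMap.BilinForm ℝ (flag S.H m y) :=
  (S.hatForm y m).compl₁₂ (S.cls m y) (S.cls m y)

theorem flagForm_apply (m : ℕ) (y : M) (v w : flag S.H m y) :
    S.flagForm m y v w = S.hatForm y m (S.cls m y v) (S.cls m y w) := rfl

theorem cls_sum_smul {m : ℕ} {x : M} {ι : Type*} [Fintype ι] {e : ι → TangentSpace 𝓘(ℝ, E) x}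
    (he : ∀ i, e i ∈ flag S.H m x) (c : ι → ℝ) (h : ∑ i, c i • e i ∈ flag S.H m x) :
    S.cls m x ⟨∑ i, c i • e i, h⟩ = ∑ i, c i • S.cls m x ⟨e i, he i⟩ := by
  simp only [← map_smul, ← map_sum]
  congr 1
  ext1
  simp

theorem cls_eq_sum {m : ℕ} {x : M} {ι : Type*} [Fintype ι] {e : ι → TangentSpace 𝓘(ℝ, E) x}
    (he : ∀ i, e i ∈ flag S.H m x) {c : ι → ℝ} (v : flag S.H m x)
    (h : (v : TangentSpace 𝓘(ℝ, E) x) - ∑ i, c i • e i ∈ flag S.H (m - 1) x) :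
    S.cls m x v = ∑ i, c i • S.cls m x ⟨e i, he i⟩ := by
  have hm : ∑ i, c i • e i ∈ flag S.H m x :=
    Submodule.sum_mem _ fun i _ => Submodule.smul_mem _ _ (he i)
  rw [← cls_sum_smul he c hm, cls_eq_iff]
  exact h

theorem IsFrameAt.mem {m : ℕ} {x : M} {d : ℕ} {e : Fin d → TangentSpace 𝓘(ℝ, E) x}
    (h : S.IsFrameAt m x e) (i : Fin d) : e i ∈ flag S.H m x := h.1 i

theorem IsFrameAt.eq_zero {m : ℕ} {x : M} {d : ℕ} {e : Fin d → TangentSpace 𝓘(ℝ, E) x}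
    (h : S.IsFrameAt m x e) {c : Fin d → ℝ} (hc : ∑ i, c i • e i ∈ flag S.H (m - 1) x) : c = 0 := by
  have hm : ∑ i, c i • e i ∈ flag S.H m x := flag_mono (Nat.sub_le m 1) x hc
  have := (S.cls_eq_zero_iff (⟨_, hm⟩ : flag S.H m x)).2 hc
  rw [S.cls_sum_smul h.1] at this
  exact funext (Fintype.linearIndependent_iff.1 h.2.linearIndependent c this)

theorem IsFrameAt.exists_sub_mem {m : ℕ} {x : M} {d : ℕ} {e : Fin d → TangentSpace 𝓘(ℝ, E) x}
    (h : S.IsFrameAt m x e) {v : TangentSpace 𝓘(ℝ, E) x} (hv : v ∈ flag S.H m x) :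
    ∃ c : Fin d → ℝ, v - ∑ i, c i • e i ∈ flag S.H (m - 1) x := by
  have : S.cls m x ⟨v, hv⟩ ∈ Submodule.span ℝ (Set.range fun i => S.cls m x ⟨e i, h.1 i⟩) := by
    rw [h.2.2]; trivial
  obtain ⟨c, hc⟩ := (Submodule.mem_span_range_iff_exists_fun ℝ).1 this
  have hm : ∑ i, c i • e i ∈ flag S.H m x :=
    Submodule.sum_mem _ fun i _ => Submodule.smul_mem _ _ (h.1 i)
  refine ⟨c, (S.cls_eq_iff ⟨v, hv⟩ ⟨_, hm⟩).1 ?_⟩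
  rw [S.cls_sum_smul h.1, hc]

variable [T2Space M]

theorem smoothFormNear_g (S : SubRiemannian E M) (x : M) : SmoothFormNear S.g x := by
  intro A B hA hB
  obtain ⟨A', hA', hAm, eA⟩ := hA.exists_global
  obtain ⟨B', hB', hBm, eB⟩ := hB.exists_global
  have h := S.smooth_g A' B' hAm hBm hA' hB'
  filter_upwards [eventually_eventually_nhds.2 eA, eventually_eventually_nhds.2 eB] with y h1 h2
  refine SmoothFnAt.congr (h y) ?_
  filter_upwards [h1, h2] with z h3 h4
  rw [← h3, ← h4, extForm_apply (hAm z) (hBm z)]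

theorem exists_orthonormal_H (S : SubRiemannian E M) (x : M) :
    ∃ (d : ℕ) (X : Fin d → VField E M), (∀ i, (X i).IsSectionNear S.H x) ∧
      ∀ᶠ y in 𝓝 x, ∀ h : ∀ i, X i y ∈ S.H y,
        IsOrthonormalBasis (S.g y) fun i => (⟨X i y, h i⟩ : S.H y) := by
  obtain ⟨d, Y, hY⟩ := S.smooth_H.exists_frame x
  obtain ⟨X, hX, -, hXo⟩ := (S.smoothFormNear_g x).exists_orthonormal
    (.of_forall S.g_symm) Y hY.isSectionNear
    fun c hc => by
      have hm : ∑ i, c i • Y i x ∈ S.H x :=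
        Submodule.sum_mem _ fun i _ => Submodule.smul_mem _ _ (hY.isSectionNear i).mem
      rw [extForm_apply hm hm]
      refine S.g_pos _ _ fun h0 => hc ?_
      exact funext (Fintype.linearIndependent_iff.1 hY.2.self_of_nhds.1 c (congrArg Subtype.val h0))
  refine ⟨d, X, hX, ?_⟩
  filter_upwards [hXo, hY.2] with y h1 h2 h
  have ho : ∀ i j, S.g y ⟨X i y, h i⟩ ⟨X j y, h j⟩ = if i = j then 1 else 0 := fun i j => by
    rw [← h1 i j, extForm_apply]
  refine ⟨ho, ?_⟩
  have hLI : LinearIndependent ℝ fun i => (⟨X i y, h i⟩ : S.H y) :=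
    Fintype.linearIndependent_iff.2 fun c hc i => by
      have := congrArg (S.g y ⟨X i y, h i⟩) hc
      simp only [map_sum, map_smul, ho, map_zero] at this
      simpa using this
  refine hLI.span_eq_top_of_card_eq_finrank' ?_
  rw [← h2.2, finrank_span_eq_card h2.1]

/-- At each point there is an orthonormal basis of `H`. -/
theorem exists_orthonormalBasis_H (S : SubRiemannian E M) (x : M) :
    ∃ (d : ℕ) (X : Fin d → S.H x), IsOrthonormalBasis (S.g x) X := by
  obtain ⟨d, X, hX, h⟩ := S.exists_orthonormal_H x
  exact ⟨d, _, h.self_of_nhds fun i => (hX i).mem⟩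

theorem IsEquiregular.exists_isParseval (hr : S.IsEquiregular r) {m : ℕ} (hm : 1 ≤ m)
    (hmr : m ≤ r) (x : M) :
    ∃ (ι : Type) (_ : Fintype ι) (f : ι → S.Hat m x), IsParseval (S.hatForm x m) f := by
  obtain ⟨d, X, hX⟩ := S.exists_orthonormalBasis_H x
  have hP := hX.isParseval (S.g_symm x)
  induction m, hm using Nat.le_induction with
  | base => exact ⟨_, _, _, isParseval_hatForm_one hP⟩
  | succ m hm ih =>
    rcases hm.eq_or_lt with rfl | hm2
    · exact ⟨_, _, _, hr.isParseval_hatForm_two hmr hP⟩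
    · obtain ⟨ι, _, f, hf⟩ := ih (by omega)
      exact ⟨_, _, _, hr.isParseval_hatForm_succ hm2 hmr hP hf⟩

theorem IsEquiregular.hatForm_symm (hr : S.IsEquiregular r) {m : ℕ} (hm : 1 ≤ m)
    (hmr : m ≤ r) (x : M) (a b : S.Hat m x) : S.hatForm x m a b = S.hatForm x m b a := by
  obtain ⟨ι, _, f, hf⟩ := hr.exists_isParseval hm hmr x
  exact hf.symm a b

/-- In a smooth coframe the dual metric has the matrix Σ_s φ_i(G_s) φ_j(G_s), which is visibly
smooth. The metric itself has the inverse matrix. -/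
theorem IsEquiregular.smoothFormNear_of_isParseval (hr : S.IsEquiregular r) {k : ℕ}
    (hk : k + 1 ≤ r) {x : M} {ι : Type*} [Fintype ι] {G : ι → VField E M}
    (hG : ∀ s, (G s).IsSectionNear (flag S.H (k + 1)) x)
    (hP : ∀ᶠ y in 𝓝 x, ∀ h : ∀ s, G s y ∈ flag S.H (k + 1) y,
      IsParseval (S.hatForm y (k + 1)) fun s => S.cls (k + 1) y ⟨G s y, h s⟩) :
    SmoothFormNear (S.flagForm (k + 1)) x := by
  intro A B hA hB
  obtain ⟨d, Y, φ, hY, h⟩ := hr.exists_flag_coframe hk x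
  let D : M → Matrix (Fin d) (Fin d) ℝ := fun y =>
    Matrix.of fun i j => ∑ s, φ i y (G s y) * φ j y (G s y)
  have key : ∀ᶠ y in 𝓝 x, (D y).det ≠ 0 ∧ extForm (S.flagForm (k + 1)) y (A y) (B y) =
      ∑ i, ∑ j, φ i y (A y) * φ j y (B y) * (D y)⁻¹ i j := by
    filter_upwards [h, Filter.eventually_all.2 hY, Filter.eventually_all.2 hG, hP, hA, hB]
      with y ⟨_, h2, h3, h4⟩ hYy hGy hPy hAy hBy
    have hP := hPy fun s => (hGy s).2
    let Yc : Fin d → S.Hat (k + 1) y := fun i => S.cls (k + 1) y ⟨Y i y, (hYy i).2⟩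
    have hexp : ∀ v : flag S.H (k + 1) y, S.cls (k + 1) y v = ∑ i, φ i y v • Yc i :=
      fun v => cls_eq_sum (fun i => (hYy i).2) v (h4 v v.2)
    have hDG : D y * Matrix.of (fun i j => S.hatForm y (k + 1) (Yc i) (Yc j)) = 1 := by
      ext l j
      have h5 := congrArg (hatDual (φ l y) (h3 l)) (hP.sum_eq (Yc j))
      simp only [map_sum, map_smul, hatDual_cls, Yc, h2] at h5
      rw [Matrix.one_apply, ← h5]
      simp only [Matrix.mul_apply, D, Matrix.of_apply]
      simp only [Finset.sum_mul]
      rw [Finset.sum_comm]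
      refine Finset.sum_congr rfl fun s _ => ?_
      rw [hexp ⟨G s y, _⟩]
      simp only [map_sum, map_smul, LinearMap.sum_apply, LinearMap.smul_apply, smul_eq_mul,
        Finset.sum_mul]
      exact Finset.sum_congr rfl fun i _ => by ring
    refine ⟨(Matrix.isUnit_det_of_right_inverse hDG).ne_zero, ?_⟩
    rw [extForm_apply hAy.2 hBy.2, flagForm_apply, hexp, hexp, Matrix.inv_eq_right_inv hDG]
    simp only [map_sum, map_smul, LinearMap.sum_apply, LinearMap.smul_apply, smul_eq_mul,
      Matrix.of_apply, Finset.mul_sum]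
    rw [Finset.sum_comm]
    exact Finset.sum_congr rfl fun i _ => Finset.sum_congr rfl fun j _ => by ring
  filter_upwards [eventually_eventually_nhds.2 key, h, Filter.eventually_all.2 hG, hA, hB]
    with y hy ⟨h1, _⟩ hGy hAy hBy
  refine SmoothFnAt.congr ?_ (hy.mono fun z hz => hz.2)
  refine SmoothFnAt.sum fun i _ => SmoothFnAt.sum fun j _ =>
    (((h1 i).apply hAy.1).mul ((h1 j).apply hBy.1)).mul (SmoothFnAt.matrix_inv (fun i j => ?_)
      hy.self_of_nhds.1 i j)
  exact SmoothFnAt.sum fun s _ => ((h1 i).apply (hGy s).1).mul ((h1 j).apply (hGy s).1)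

/-- Positivity comes with the Parseval frame, so Gram–Schmidt applies to the flag frame `Y`. The
resulting orthonormal classes span because their number is that of `Y`, whose classes span. -/
theorem IsEquiregular.exists_frame_of_isParseval (hr : S.IsEquiregular r) {k : ℕ}
    (hk : k + 1 ≤ r) {x : M} {ι : Type*} [Fintype ι] {G : ι → VField E M}
    (hG : ∀ s, (G s).IsSectionNear (flag S.H (k + 1)) x)
    (hP : ∀ᶠ y in 𝓝 x, ∀ h : ∀ s, G s y ∈ flag S.H (k + 1) y,
      IsParseval (S.hatForm y (k + 1)) fun s => S.cls (k + 1) y ⟨G s y, h s⟩) :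
    ∃ (d : ℕ) (F : Fin d → VField E M), (∀ i, (F i).IsSectionNear (flag S.H (k + 1)) x) ∧
      ∀ᶠ y in 𝓝 x, S.IsFrameAt (k + 1) y fun i => F i y := by
  have hb := hr.smoothFormNear_of_isParseval hk hG hP
  obtain ⟨d, Y, φ, hY, h⟩ := hr.exists_flag_coframe hk x
  have hPx := hP.self_of_nhds fun s => (hG s).mem
  obtain ⟨F, hF, -, hFo⟩ := hb.exists_orthonormal (by
    filter_upwards [hP, Filter.eventually_all.2 hG] with y hPy hGy v w
    exact (hPy fun s => (hGy s).2).symm _ _) Y hY fun c hc => by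
      have hm : ∑ i, c i • Y i x ∈ flag S.H (k + 1) x :=
        Submodule.sum_mem _ fun i _ => Submodule.smul_mem _ _ (hY i).mem
      rw [extForm_apply hm hm]
      refine hPx.pos fun h0 => hc (funext fun i => ?_)
      obtain ⟨-, h2, h3, -⟩ := h.self_of_nhds
      have h4 := h3 i _ ((cls_eq_zero_iff _).1 h0)
      simpa [h2] using h4
  refine ⟨d, F, hF, ?_⟩
  filter_upwards [hFo, Filter.eventually_all.2 hF, Filter.eventually_all.2 hY, h]
    with y hy hFy hYy ⟨_, _, _, h4⟩
  have ho : ∀ i j, S.hatForm y (k + 1) (S.cls (k + 1) y ⟨F i y, (hFy i).2⟩)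
      (S.cls (k + 1) y ⟨F j y, (hFy j).2⟩) = if i = j then 1 else 0 := fun i j => by
    rw [← hy i j, extForm_apply (hFy i).2 (hFy j).2, flagForm_apply]
  refine ⟨fun i => (hFy i).2, ho, ?_⟩
  have hLI : LinearIndependent ℝ fun i => S.cls (k + 1) y ⟨F i y, (hFy i).2⟩ :=
    Fintype.linearIndependent_iff.2 fun c hc i => by
      have := congrArg (S.hatForm y (k + 1) (S.cls (k + 1) y ⟨F i y, (hFy i).2⟩)) hc
      simp only [map_sum, map_smul, ho, map_zero] at this
      simpa using this
  refine hLI.span_eq_top_of_card_eq_finrank' (le_antisymm hLI.fintype_card_le_finrank ?_)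
  have hspan : Submodule.span ℝ (Set.range fun i => S.cls (k + 1) y ⟨Y i y, (hYy i).2⟩) = ⊤ := by
    refine eq_top_iff.2 fun u _ => ?_
    obtain ⟨v, hv, rfl⟩ := exists_cls u
    rw [cls_eq_sum (fun i => (hYy i).2) ⟨v, hv⟩ (h4 v hv)]
    exact Submodule.sum_mem _ fun i _ => Submodule.smul_mem _ _ (Submodule.subset_span ⟨i, rfl⟩)
  rw [← finrank_top, ← hspan]
  exact finrank_range_le_card _

/-- There are smooth local orthonormal frames of `Ĥ_m`. -/
theorem IsEquiregular.exists_frame (hr : S.IsEquiregular r) {m : ℕ} (hm : 1 ≤ m) (hmr : m ≤ r)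
    (x : M) : ∃ (d : ℕ) (F : Fin d → VField E M), (∀ i, (F i).IsSectionNear (flag S.H m) x) ∧
      ∀ᶠ y in 𝓝 x, S.IsFrameAt m y fun i => F i y := by
  obtain ⟨n, X, hX, hXo⟩ := S.exists_orthonormal_H x
  have hXe := Filter.eventually_all.2 fun i => (hX i).eventually
  induction m, hm using Nat.le_induction with
  | base =>
    refine hr.exists_frame_of_isParseval (k := 0) hmr (G := X) hX ?_
    filter_upwards [hXo] with y hy h
    exact isParseval_hatForm_one ((hy h).isParseval (S.g_symm y))
  | succ m hm ih =>
    rcases hm.eq_or_lt with rfl | hm2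
    -- Negated brackets of sections represent the values of the bracket form, so the algebraic
    -- Parseval frame of Ĥ_2 consists of classes of smooth fields.
    · refine hr.exists_frame_of_isParseval (k := 1) hmr (G := fun (s : Fin n × Fin n) y =>
        (√2)⁻¹ • ((-1 : ℝ) • VectorField.mlieBracket 𝓘(ℝ, E) (X s.1) (X s.2) y))
        (fun s => ((VField.IsSectionNear.bracket le_rfl (hX s.1) (hX s.2)).const_smul _).const_smul _)
        ?_
      filter_upwards [hXo, hXe] with y hy hXy h
      have hb := hy fun i => (hXy i).mem
      convert hr.isParseval_hatForm_two hmr (hb.isParseval (S.g_symm y)) using 2 with s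
      have hc := Submodule.neg_mem _ (bracket_mem_flag (H := S.H) le_rfl (hXy s.1) (hXy s.2))
      have e := hr.bracketForm_section (k := 1) le_rfl hmr (hXy s.1) (hXy s.2) ⟨_, hc⟩ rfl
      refine Eq.trans ?_ (congrArg ((√2)⁻¹ • ·) e.symm)
      simp only [← map_smul]
      congr 1
      ext1
      simp
    · obtain ⟨d, F, hF, hFo⟩ := ih (by omega)
      refine hr.exists_frame_of_isParseval (k := m) hmr (G := fun (s : Fin d × Fin n) y =>
        (-1 : ℝ) • VectorField.mlieBracket 𝓘(ℝ, E) (F s.1) (X s.2) y)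
        (fun s => (VField.IsSectionNear.bracket hm (hF s.1) (hX s.2)).const_smul _) ?_
      filter_upwards [hXo, hXe, hFo, Filter.eventually_all.2 fun i => (hF i).eventually]
        with y hy hXy hFy hFye h
      have hb := hy fun i => (hXy i).mem
      convert hr.isParseval_hatForm_succ hm2 hmr (hb.isParseval (S.g_symm y))
        (hFy.2.isParseval (hr.hatForm_symm hm (by omega) y)) using 2 with s
      have hc := Submodule.neg_mem _ (bracket_mem_flag (H := S.H) hm (hFye s.1) (hXy s.2))
      refine Eq.trans ?_ (hr.bracketForm_section hm hmr (hFye s.1) (hXy s.2) ⟨_, hc⟩ rfl).symm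
      congr 1
      ext1
      simp

end SubRiemannian

/-! ### Orthogonal changes of coframe -/

section Gauge

variable {E : Type*} [NormedAddCommGroup E] [NormedSpace ℝ E] [FiniteDimensional ℝ E]
variable {M : Type*} [TopologicalSpace M] [ChartedSpace E M] [IsManifold 𝓘(ℝ, E) ∞ M]

/-- The coframe fields `φ` and `φ'` are related near `x` by the field `a` of orthogonal matrices:
`φ' = a φ`. -/
structure IsGauge {ι ι' : Type*} [Fintype ι] [Fintype ι'] [DecidableEq ι] [DecidableEq ι'] (x : M)
    (φ : ι → OneForm E M) (φ' : ι' → OneForm E M) (a : ι' → ι → M → ℝ) : Prop where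
  smooth : ∀ i j, SmoothFnAt E (a i j) x
  eq : ∀ᶠ y in 𝓝 x, ∀ i, φ' i y = ∑ j, a i j y • φ j y
  row : ∀ᶠ y in 𝓝 x, ∀ i l, ∑ j, a i j y * a l j y = if i = l then 1 else 0
  col : ∀ j l, ∑ i, a i j x * a i l x = if j = l then 1 else 0

end Gauge

namespace SubRiemannian

variable {E : Type*} [NormedAddCommGroup E] [NormedSpace ℝ E] [FiniteDimensional ℝ E]
variable {M : Type*} [TopologicalSpace M] [ChartedSpace E M] [IsManifold 𝓘(ℝ, E) ∞ M]
variable {S : SubRiemannian E M} {r : ℕ}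

/-- The linear map `v ↦ sharp (dφ(v, ·)|_H)`. -/
def alpha (S : SubRiemannian E M) (φ : OneForm E M) (x : M) :
    TangentSpace 𝓘(ℝ, E) x →ₗ[ℝ] S.H x :=
  (S.sharp x).toLinearMap ∘ₗ (S.H x).subtype.dualMap ∘ₗ extDer φ x

theorem g_sharp (x : M) (α : Module.Dual ℝ (S.H x)) (X : S.H x) :
    S.g x (S.sharp x α) X = α X := by
  have := LinearMap.BilinForm.apply_toDual_symm_apply (hB := S.g_nondegenerate x) α X
  exact this

theorem g_ext {x : M} {v w : S.H x} (h : ∀ X, S.g x v X = S.g x w X) : v = w := by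
  refine sub_eq_zero.1 ((S.g_nondegenerate x).1 _ fun X => ?_)
  rw [map_sub, LinearMap.sub_apply, h, sub_self]

theorem g_alpha (φ : OneForm E M) (x : M) (v : TangentSpace 𝓘(ℝ, E) x) (X : S.H x) :
    S.g x (S.alpha φ x v) X = extDer φ x v X :=
  g_sharp x _ X

theorem matA_apply {x : M} {d d' : ℕ} (φ : Fin d → OneForm E M)
    (e : Fin d' → TangentSpace 𝓘(ℝ, E) x) (i : Fin d) (j : Fin d') :
    S.matA x φ e i j = S.alpha (φ i) x (e j) := rfl

/-- The transformation of exterior derivatives under an orthogonal change of coframe. -/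
theorem _root_.SubRiem.IsGauge.exists_sigma {ι ι' : Type*} [Fintype ι] [Fintype ι'] [DecidableEq ι]
    [DecidableEq ι'] {x : M} {φ : ι → OneForm E M} {φ' : ι' → OneForm E M} {a : ι' → ι → M → ℝ}
    (h : IsGauge x φ φ' a) (hφ : ∀ j, (φ j).SmoothAt x) (hφH : ∀ j, ∀ X ∈ S.H x, φ j x X = 0) :
    ∃ σ : ι' → ι → S.H x, (∀ i v, S.alpha (φ' i) x v =
        ∑ j, a i j x • S.alpha (φ j) x v - ∑ j, φ j x v • σ i j) ∧
      ∀ i l, ∑ j, (a l j x • σ i j + a i j x • σ l j) = 0 := by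
  -- σ_{ij} is dual to da_{ij} restricted to H. The other half of da ∧ φ drops out because φ
  -- vanishes on H, and the second identity is the derivative of a aᵀ = 1.
  let s : ι' → ι → Module.Dual ℝ (S.H x) := fun i j =>
    (S.H x).subtype.dualMap
      { toFun := fun v => dirDeriv (a i j) x v
        map_add' := dirDeriv_add_vec _
        map_smul' := dirDeriv_smul_vec _ }
  have hs : ∀ i j (X : S.H x), S.g x (S.sharp x (s i j)) X =
      dirDeriv (a i j) x (X : TangentSpace 𝓘(ℝ, E) x) :=
    fun i j X => g_sharp x _ X
  refine ⟨fun i j => S.sharp x (s i j), fun i v => g_ext fun X => ?_, fun i l => g_ext fun X => ?_⟩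
  · simp only [map_sub, map_sum, map_smul, LinearMap.sub_apply, LinearMap.sum_apply,
      LinearMap.smul_apply, smul_eq_mul, g_alpha, hs]
    rw [extDer_sum_smul (h.eq.mono fun y hy => hy i) hφ (h.smooth i), ← Finset.sum_sub_distrib]
    refine Finset.sum_congr rfl fun j _ => ?_
    rw [hφH j X X.2]
    ring
  · have h1 : dirDeriv (fun y => ∑ j, a i j y * a l j y) x (X : TangentSpace 𝓘(ℝ, E) x) = 0 :=
      dirDeriv_of_eventually_const _ (h.row.mono fun y hy => hy i l)
    rw [dirDeriv_sum _ fun j _ => (h.smooth i j).mul (h.smooth l j)] at h1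
    simp only [map_sum, map_add, map_smul, LinearMap.add_apply, LinearMap.sum_apply,
      LinearMap.smul_apply, smul_eq_mul, hs, map_zero, LinearMap.zero_apply]
    rw [← h1]
    refine Finset.sum_congr rfl fun j _ => ?_
    rw [dirDeriv_mul _ (h.smooth i j) (h.smooth l j)]
    ring

section CoframeAt

variable {m : ℕ} {x : M} {d : ℕ} {φ : Fin d → TangentSpace 𝓘(ℝ, E) x →L[ℝ] ℝ}

theorem IsCoframeAt.sub_mem (h : S.IsCoframeAt m x φ) {e : Fin d → TangentSpace 𝓘(ℝ, E) x}
    (he : ∀ i, e i ∈ flag S.H m x) (hd : ∀ i j, φ i (e j) = if i = j then 1 else 0)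
    {v : TangentSpace 𝓘(ℝ, E) x} (hv : v ∈ flag S.H m x) :
    v - ∑ i, φ i v • e i ∈ flag S.H (m - 1) x := by
  obtain ⟨h0, f, hf, hdf⟩ := h
  have key : ∀ w ∈ flag S.H m x, (∀ i, φ i w = 0) → w ∈ flag S.H (m - 1) x := by
    intro w hw hw0
    obtain ⟨c, hc⟩ := hf.exists_sub_mem hw
    have : c = 0 := funext fun i => by
      have := h0 i _ hc
      simpa [hw0, hdf] using this
    simpa [this] using hc
  refine key _ (Submodule.sub_mem _ hv (Submodule.sum_mem _ fun i _ =>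
    Submodule.smul_mem _ _ (he i))) fun i => ?_
  simp [hd]

theorem IsCoframeAt.mem_of_forall (h : S.IsCoframeAt m x φ) {v : TangentSpace 𝓘(ℝ, E) x}
    (hv : v ∈ flag S.H m x) (h0 : ∀ i, φ i v = 0) : v ∈ flag S.H (m - 1) x := by
  obtain ⟨f, hf, hdf⟩ := h.2
  simpa [h0] using h.sub_mem hf.mem hdf hv

theorem IsCoframeAt.hatForm_apply (h : S.IsCoframeAt m x φ) (v w : flag S.H m x) :
    S.hatForm x m (S.cls m x v) (S.cls m x w) = ∑ i, φ i v * φ i w := by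
  obtain ⟨f, hf, hdf⟩ := h.2
  rw [cls_eq_sum hf.mem v (h.sub_mem hf.mem hdf v.2), cls_eq_sum hf.mem w (h.sub_mem hf.mem hdf w.2)]
  have ho := hf.2.1
  simp only [map_sum, map_smul, LinearMap.sum_apply, LinearMap.smul_apply, ho]
  simp [mul_comm]

theorem IsCoframeAt.card_eq (h : S.IsCoframeAt m x φ) {d' : ℕ}
    {e : Fin d' → TangentSpace 𝓘(ℝ, E) x} (he : S.IsFrameAt m x e) : d = d' := by
  obtain ⟨f, hf, -⟩ := h.2
  exact hf.2.finrank.symm.trans he.2.finrank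

/-- The metric of Ĥ_m is Σ φ_i ⊗ φ_i, so evaluating a coframe on an orthonormal frame gives
orthonormal columns. As the matrix is square, its rows are orthonormal too. -/
theorem IsCoframeAt.col (h : S.IsCoframeAt m x φ) {d' : ℕ}
    {e : Fin d' → TangentSpace 𝓘(ℝ, E) x} (he : S.IsFrameAt m x e) :
    (Matrix.of fun i j => φ i (e j)).transpose * (Matrix.of fun i j => φ i (e j)) = 1 := by
  ext s t
  have := (h.hatForm_apply ⟨e s, he.mem s⟩ ⟨e t, he.mem t⟩).symm.trans (he.2.1 s t)
  rw [Matrix.one_apply, ← this]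
  rfl

theorem IsCoframeAt.row (h : S.IsCoframeAt m x φ) {d' : ℕ}
    {e : Fin d' → TangentSpace 𝓘(ℝ, E) x} (he : S.IsFrameAt m x e) :
    (Matrix.of fun i j => φ i (e j)) * (Matrix.of fun i j => φ i (e j)).transpose = 1 :=
  (Matrix.mul_eq_one_comm_of_card_eq _ _ _ (by simp [h.card_eq he])).1 (h.col he)

end CoframeAt

/-! ### Slices of the algorithm and adapted coframes -/

variable [T2Space M]

/-- A smooth section of the classes of `(m, k)`-frames, for every `m > k` apart from the pair
`(2, 0)`. -/
structure IsSlice (S : SubRiemannian E M) (r k : ℕ) (D : ℕ → Distr E M) : Prop where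
  smooth : ∀ m, 2 ≤ m → 3 ≤ m + k → m ≤ r → k < m → IsSmoothSubbundle (D m)
  sup_eq : ∀ m, 2 ≤ m → 3 ≤ m + k → m ≤ r → k < m → ∀ x,
    D m x ⊔ flag S.H (m - 1) x = flag S.H m x
  inf_eq : ∀ m, 2 ≤ m → 3 ≤ m + k → m ≤ r → k < m → ∀ x,
    D m x ⊓ flag S.H (m - 1) x = flag S.H k x

/-- The vectors annihilated by the `(k + 1)`-coframes adapted to `D`. -/
def adaptedKer (S : SubRiemannian E M) (r k : ℕ) (D : ℕ → Distr E M) : Distr E M := fun y =>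
  flag S.H k y ⊔ (Finset.Ioc (k + 1) r).sup fun j => D j y

theorem flag_le_adaptedKer (k : ℕ) (D : ℕ → Distr E M) (y : M) :
    flag S.H k y ≤ S.adaptedKer r k D y := le_sup_left

theorem le_adaptedKer {k j : ℕ} {D : ℕ → Distr E M} (hj : k + 1 < j) (hjr : j ≤ r) (y : M) :
    D j y ≤ S.adaptedKer r k D y :=
  (Finset.le_sup (f := fun j => D j y) (Finset.mem_Ioc.2 ⟨hj, hjr⟩)).trans le_sup_right

/-- Induction on the top index: `D (s + 1)` meets H_s only in H_k, so adding it does not enlarge the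
intersection with H_{k+1}. For s = r this identifies adapted covectors with the dual of Ĥ_{k+1}. -/
theorem IsSlice.adaptedKer_spec {k : ℕ} {D : ℕ → Distr E M} (hD : S.IsSlice r k D) (hk : 1 ≤ k)
    {s : ℕ} (hs : k + 1 ≤ s) (hsr : s ≤ r) (y : M) :
    S.adaptedKer s k D y ⊔ flag S.H (k + 1) y = flag S.H s y ∧
      S.adaptedKer s k D y ⊓ flag S.H (k + 1) y = flag S.H k y := by
  induction s, hs using Nat.le_induction with
  | base =>
    have := flag_le_succ (H := S.H) k y
    simp [adaptedKer, this]
  | succ s hs ih =>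
    obtain ⟨h1, h2⟩ := ih (by omega)
    have hsup := hD.sup_eq (s + 1) (by omega) (by omega) hsr (by omega) y
    have hinf := hD.inf_eq (s + 1) (by omega) (by omega) hsr (by omega) y
    simp only [Nat.add_sub_cancel] at hsup hinf
    have e : S.adaptedKer (s + 1) k D y = D (s + 1) y ⊔ S.adaptedKer s k D y := by
      unfold adaptedKer
      rw [← Finset.insert_Ioc_right_eq_Ioc_add_one (by omega), Finset.sup_insert, sup_left_comm]
    rw [e]
    constructor
    · rw [sup_assoc, h1, hsup]
    · refine le_antisymm (fun v hv => ?_) ?_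
      · obtain ⟨w, hw, p, hp, rfl⟩ := Submodule.mem_sup.1 hv.1
        have hps : p ∈ flag S.H s y := h1 ▸ Submodule.mem_sup_left hp
        have hws : w ∈ flag S.H s y := by
          have := Submodule.sub_mem _ (flag_mono hs y hv.2) hps
          simpa using this
        have hwk : w ∈ flag S.H k y := hinf ▸ ⟨hw, hws⟩
        rw [← h2]
        exact ⟨Submodule.add_mem _ (flag_le_adaptedKer k D y hwk) hp, hv.2⟩
      · exact le_inf ((flag_le_adaptedKer k D y).trans le_sup_right) (flag_le_succ k y)

theorem IsSlice.adaptedKer_sup {k : ℕ} {D : ℕ → Distr E M} (hD : S.IsSlice r k D)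
    (hr : S.IsEquiregular r) (hk : 1 ≤ k) (hkr : k + 1 ≤ r) (y : M) :
    S.adaptedKer r k D y ⊔ flag S.H (k + 1) y = ⊤ :=
  (hD.adaptedKer_spec hk hkr le_rfl y).1.trans (hr.eq_top y)

theorem IsSlice.adaptedKer_inf {k : ℕ} {D : ℕ → Distr E M} (hD : S.IsSlice r k D)
    (hk : 1 ≤ k) (hkr : k + 1 ≤ r) (y : M) :
    S.adaptedKer r k D y ⊓ flag S.H (k + 1) y = flag S.H k y :=
  (hD.adaptedKer_spec hk hkr le_rfl y).2

/-- `φ` is a smooth `(k + 1)`-coframe field near `x` adapted to `D`. -/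
def IsCoframeGerm (S : SubRiemannian E M) (r k : ℕ) (D : ℕ → Distr E M) (x : M) {d : ℕ}
    (φ : Fin d → OneForm E M) : Prop :=
  ∀ᶠ y in 𝓝 x, (∀ i, (φ i).SmoothAt y) ∧ S.IsCoframeAt (k + 1) y (fun i => φ i y) ∧
    ∀ i, ∀ v ∈ S.adaptedKer r k D y, φ i y v = 0

theorem isAdaptedCoframe_iff {W : ℕ → ℕ → Distr E M} {k : ℕ} {x : M} {d : ℕ}
    {φ : Fin d → OneForm E M} : S.IsAdaptedCoframe r W (k + 1) x φ ↔
      S.IsCoframeGerm r k (fun j => W j k) x φ := by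
  constructor
  · rintro ⟨O, hO, hx, hs, h⟩
    filter_upwards [hO.mem_nhds hx] with y hy
    refine ⟨fun i => (hs i).smoothAt hO hy, (h y hy).1, fun i => ?_⟩
    change S.adaptedKer r k (fun j => W j k) y ≤ LinearMap.ker (φ i y).toLinearMap
    refine sup_le (fun v hv => (h y hy).1.1 i v hv) (Finset.sup_le fun j hj v hv => ?_)
    rw [Finset.mem_Ioc] at hj
    exact (h y hy).2 i j hj.1 hj.2 v hv
  · intro h
    obtain ⟨O, hO, hOo, hx⟩ := eventually_nhds_iff.1 h
    refine ⟨O, hOo, hx, fun i => OneForm.smoothOn_of_smoothAt fun y hy => (hO y hy).1 i,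
      fun y hy => ⟨(hO y hy).2.1, fun i j hj hjr v hv => (hO y hy).2.2 i v ?_⟩⟩
    exact le_adaptedKer hj hjr y hv

/-- The dimension formula shows that `adaptedKer` has constant rank. A frame of it together with
representatives of an orthonormal frame of Ĥ_{k+1} is a frame of TM; the coframe is dual to the
second part. -/
theorem IsSlice.exists_coframe {k : ℕ} {D : ℕ → Distr E M} (hD : S.IsSlice r k D)
    (hr : S.IsEquiregular r) (hk : 1 ≤ k) (hkr : k + 1 ≤ r) (x : M) :
    ∃ (d : ℕ) (φ : Fin d → OneForm E M) (F : Fin d → VField E M), S.IsCoframeGerm r k D x φ ∧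
      (∀ i, (F i).IsSectionNear (flag S.H (k + 1)) x) ∧
      ∀ᶠ y in 𝓝 x, ∀ i j, φ i y (F j y) = if i = j then 1 else 0 := by
  obtain ⟨d, F, hF, hFo⟩ := hr.exists_frame (m := k + 1) (by omega) hkr x
  have hP : SectionSpanned (S.adaptedKer r k D) := by
    refine (S.sectionSpanned_flag k).sup (SectionSpanned.finset_sup fun j hj => ?_)
    rw [Finset.mem_Ioc] at hj
    exact (hD.smooth j (by omega) (by omega) hj.2 (by omega)).sectionSpanned
  obtain ⟨n, hn⟩ := hr.exists_rank (i := k) (by omega)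
  obtain ⟨n', hn'⟩ := hr.exists_rank hkr
  have hrank : ∀ y, Module.finrank ℝ (S.adaptedKer r k D y) = Module.finrank ℝ E + n - n' := by
    intro y
    have h := Submodule.finrank_sup_add_finrank_inf_eq (S.adaptedKer r k D y) (flag S.H (k + 1) y)
    rw [hD.adaptedKer_sup hr hk hkr, hD.adaptedKer_inf hk hkr, finrank_top_eq, hn, hn'] at h
    omega
  obtain ⟨p, Q, hQ⟩ := hP.exists_frame hrank x
  have hB : IsFrameNear (fun _ => ⊤) (Sum.elim F Q) x := by
    refine ⟨?_, ?_⟩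
    · rintro (i | j)
      · exact Filter.Eventually.mono (hF i) fun _ h => h.1
      · exact hQ.1 j
    · filter_upwards [hFo, hQ.2, Filter.eventually_all.2 hF] with y hy hQy hFy
      have e : (fun i => Sum.elim F Q i y) = Sum.elim (fun i => F i y) (fun j => Q j y) := by
        ext i; cases i <;> rfl
      have hle : Submodule.span ℝ (Set.range fun i => F i y) ≤ flag S.H (k + 1) y :=
        Submodule.span_le.2 (by rintro _ ⟨i, rfl⟩; exact (hFy i).2)
      rw [e]
      refine ⟨LinearIndependent.sum_type ?_ hQy.1 ?_, ?_⟩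
      · refine Fintype.linearIndependent_iff.2 fun c hc i => ?_
        rw [hy.eq_zero (c := c) (by rw [hc]; exact Submodule.zero_mem _)]; rfl
      · rw [hQy.2, Submodule.disjoint_def]
        intro v hv hvP
        have hv' : v ∈ flag S.H k y := hD.adaptedKer_inf hk hkr y ▸ ⟨hvP, hle hv⟩
        obtain ⟨c, rfl⟩ := (Submodule.mem_span_range_iff_exists_fun ℝ).1 hv
        rw [hy.eq_zero hv']
        simp
      · rw [Set.Sum.elim_range, Submodule.span_union, hQy.2]
        refine eq_top_iff.2 ?_
        rw [← hD.adaptedKer_sup hr hk hkr y]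
        refine sup_le le_sup_right fun v hv => ?_
        obtain ⟨c, hc⟩ := hy.exists_sub_mem hv
        have h1 : ∑ i, c i • F i y ∈ Submodule.span ℝ (Set.range fun i => F i y) :=
          Submodule.sum_mem _ fun i _ => Submodule.smul_mem _ (c i) (Submodule.subset_span ⟨i, rfl⟩)
        have := Submodule.add_mem_sup h1 (flag_le_adaptedKer (r := r) k D y hc)
        rwa [add_sub_cancel] at this
  refine ⟨d, fun i => dualForm (Sum.elim F Q) (Sum.inl i), F, ?_, hF, ?_⟩
  · filter_upwards [hB.dualForm_spec, hFo, hQ.2] with y ⟨h1, h2, h3⟩ hy hQy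
    have hker : ∀ i, ∀ v ∈ S.adaptedKer r k D y, dualForm (Sum.elim F Q) (Sum.inl i) y v = 0 := by
      intro i v hv
      rw [← hQy.2] at hv
      obtain ⟨c, rfl⟩ := (Submodule.mem_span_range_iff_exists_fun ℝ).1 hv
      have h4 : ∀ j, dualForm (Sum.elim F Q) (Sum.inl i) y (Q j y) = 0 := fun j => by
        simpa using h2 (Sum.inl i) (Sum.inr j)
      simp [h4]
    exact ⟨fun i => h1 _, ⟨fun i v hv => hker i v (flag_le_adaptedKer k D y hv), _, hy,
      fun i j => by simpa using h2 (Sum.inl i) (Sum.inl j)⟩, hker⟩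
  · filter_upwards [hB.dualForm_spec] with y ⟨_, h2, _⟩ i j
    simpa using h2 (Sum.inl i) (Sum.inl j)

theorem IsCoframeGerm.eventually {k : ℕ} {D : ℕ → Distr E M} {x : M} {d : ℕ}
    {φ : Fin d → OneForm E M} (h : S.IsCoframeGerm r k D x φ) :
    ∀ᶠ y in 𝓝 x, S.IsCoframeGerm r k D y φ :=
  eventually_eventually_nhds.2 h

/-- Two adapted coframe fields differ by a field of orthogonal matrices. -/
theorem IsCoframeGerm.exists_gauge {k : ℕ} {D : ℕ → Distr E M} (hD : S.IsSlice r k D)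
    (hr : S.IsEquiregular r) (hk : 1 ≤ k) (hkr : k + 1 ≤ r) {x : M} {d d' : ℕ}
    {φ : Fin d → OneForm E M} {φ' : Fin d' → OneForm E M} (h : S.IsCoframeGerm r k D x φ)
    (h' : S.IsCoframeGerm r k D x φ') : ∃ a : Fin d' → Fin d → M → ℝ, IsGauge x φ φ' a := by
  obtain ⟨n, F, hF, hFo⟩ := hr.exists_frame (m := k + 1) (by omega) hkr x
  -- Both coframes pair with one orthonormal frame `F` in orthogonal matrices `A` and `A'`, so the
  -- transition matrix is A' Aᵀ.
  let A : M → Matrix (Fin d) (Fin n) ℝ := fun y => Matrix.of fun i j => φ i y (F j y)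
  let A' : M → Matrix (Fin d') (Fin n) ℝ := fun y => Matrix.of fun i j => φ' i y (F j y)
  have hrow : ∀ᶠ y in 𝓝 x, (A' y * (A y).transpose) * (A' y * (A y).transpose).transpose = 1 ∧
      (A' y * (A y).transpose).transpose * (A' y * (A y).transpose) = 1 := by
    filter_upwards [hFo, h, h'] with y hy h1 h2
    have e1 : (A y).transpose * A y = 1 := h1.2.1.col hy
    have e2 : (A y) * (A y).transpose = 1 := h1.2.1.row hy
    have e1' : (A' y).transpose * A' y = 1 := h2.2.1.col hy
    have e2' : (A' y) * (A' y).transpose = 1 := h2.2.1.row hy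
    rw [Matrix.transpose_mul, Matrix.transpose_transpose]
    constructor
    · rw [Matrix.mul_assoc, ← Matrix.mul_assoc _ (A y), e1, Matrix.one_mul, e2']
    · rw [Matrix.mul_assoc, ← Matrix.mul_assoc _ (A' y), e1', Matrix.one_mul, e2]
  refine ⟨fun i j y => (A' y * (A y).transpose) i j, ?_, ?_, ?_, ?_⟩
  · intro i j
    simp only [Matrix.mul_apply]
    exact SmoothFnAt.sum fun s _ => ((h'.self_of_nhds.1 i).apply (hF s).smoothAt).mul
      ((h.self_of_nhds.1 j).apply (hF s).smoothAt)
  · filter_upwards [hFo, h, h'] with y hy h1 h2 i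
    have e1 : (A y).transpose * A y = 1 := h1.2.1.col hy
    change φ' i y = ∑ j, (A' y * (A y).transpose) i j • φ j y
    have key : ∀ s, φ' i y (F s y) = (∑ j, (A' y * (A y).transpose) i j • φ j y) (F s y) := by
      intro s
      have : A' y i s = ((A' y * (A y).transpose) * A y) i s := by
        rw [Matrix.mul_assoc, e1, Matrix.mul_one]
      rw [Matrix.mul_apply] at this
      rw [sum_apply]
      exact this
    have hψ : ∀ q ∈ S.adaptedKer r k D y,
        (∑ j, (A' y * (A y).transpose) i j • φ j y) q = 0 := fun q hq => by
      simp [fun j => h1.2.2 j q hq]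
    ext v
    have hv : v ∈ S.adaptedKer r k D y ⊔ flag S.H (k + 1) y := by
      rw [hD.adaptedKer_sup hr hk hkr]; trivial
    obtain ⟨p, hp, w, hw, rfl⟩ := Submodule.mem_sup.1 hv
    obtain ⟨c, hc⟩ := hy.exists_sub_mem hw
    have hc' := flag_le_adaptedKer (r := r) k D y hc
    have e : p + w = (p + (w - ∑ s, c s • F s y)) + ∑ s, c s • F s y := by abel
    generalize ∑ j, (A' y * (A y).transpose) i j • φ j y = ψ at key hψ ⊢
    rw [e, map_add, map_add ψ, h2.2.2 i _ (Submodule.add_mem _ hp hc'),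
      hψ _ (Submodule.add_mem _ hp hc'), map_sum, map_sum]
    simp only [map_smul, key]
  · filter_upwards [hrow] with y hy i l
    have := congrFun (congrFun hy.1 i) l
    rwa [Matrix.mul_apply, Matrix.one_apply] at this
  · intro j l
    have := congrFun (congrFun hrow.self_of_nhds.2 j) l
    rwa [Matrix.mul_apply, Matrix.one_apply] at this

end SubRiemannian

/-! ### First-order conditions and nondegeneracy -/

theorem eq_zero_of_forall_pos {b c : ℝ} (h : ∀ t : ℝ, t ≠ 0 → 0 < 2 * t * b + t ^ 2 * c) : b = 0 := by
  by_contra hb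
  have hC : 0 < |c| + 1 := by positivity
  -- A step against the sign of `b`, short enough for the linear term to dominate the quadratic one.
  have h1 := h (-b / (|c| + 1)) (div_ne_zero (neg_ne_zero.2 hb) hC.ne')
  have e : 2 * (-b / (|c| + 1)) * b + (-b / (|c| + 1)) ^ 2 * c =
      b ^ 2 / (|c| + 1) ^ 2 * (c - 2 * (|c| + 1)) := by
    field_simp
    ring
  rw [e] at h1
  have h2 : c - 2 * (|c| + 1) ≤ 0 := by linarith [le_abs_self c, abs_nonneg c]
  exact absurd h1 (not_lt.2 (mul_nonpos_of_nonneg_of_nonpos (by positivity) h2))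

namespace SubRiemannian

variable {E : Type*} [NormedAddCommGroup E] [NormedSpace ℝ E] [FiniteDimensional ℝ E]
variable {M : Type*} [TopologicalSpace M] [ChartedSpace E M] [IsManifold 𝓘(ℝ, E) ∞ M]
variable {S : SubRiemannian E M} {r : ℕ}

/-- The inner product of two matrices with entries in `H`. -/
def matForm (S : SubRiemannian E M) (x : M) {d d' : ℕ} (A B : Fin d → Fin d' → S.H x) : ℝ :=
  ∑ i, ∑ j, S.g x (A i j) (B i j)

theorem normSq_eq_matForm {x : M} {d d' : ℕ} (A : Fin d → Fin d' → S.H x) :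
    S.normSq x A = S.matForm x A A := rfl

theorem g_self_nonneg (x : M) (v : S.H x) : 0 ≤ S.g x v v := by
  rcases eq_or_ne v 0 with rfl | h
  · simp
  · exact (S.g_pos x v h).le

theorem eq_zero_of_g_self {x : M} {v : S.H x} (h : S.g x v v = 0) : v = 0 := by
  by_contra hv
  exact (S.g_pos x v hv).ne' h

theorem normSq_nonneg {x : M} {d d' : ℕ} (A : Fin d → Fin d' → S.H x) : 0 ≤ S.normSq x A :=
  Finset.sum_nonneg fun _ _ => Finset.sum_nonneg fun _ _ => g_self_nonneg _ _

theorem normSq_eq_zero {x : M} {d d' : ℕ} {A : Fin d → Fin d' → S.H x} (h : S.normSq x A = 0)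
    (i : Fin d) (j : Fin d') : A i j = 0 := by
  have h1 := (Finset.sum_eq_zero_iff_of_nonneg fun i _ =>
    Finset.sum_nonneg fun j _ => g_self_nonneg x (A i j)).1 h i (Finset.mem_univ i)
  exact eq_zero_of_g_self ((Finset.sum_eq_zero_iff_of_nonneg fun j _ =>
    g_self_nonneg x (A i j)).1 h1 j (Finset.mem_univ j))

theorem normSq_add_smul {x : M} {d d' : ℕ} (A B : Fin d → Fin d' → S.H x) (t : ℝ) :
    S.normSq x (A + t • B) =
      S.normSq x A + (2 * t * S.matForm x A B + t ^ 2 * S.normSq x B) := by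
  simp only [normSq, matForm, Finset.mul_sum, ← Finset.sum_add_distrib]
  refine Finset.sum_congr rfl fun i _ => Finset.sum_congr rfl fun j _ => ?_
  simp only [Pi.add_apply, Pi.smul_apply, map_add, map_smul, LinearMap.add_apply,
    LinearMap.smul_apply, smul_eq_mul, S.g_symm x (B i j) (A i j)]
  ring

theorem normSq_add {x : M} {d d' : ℕ} (A B : Fin d → Fin d' → S.H x) :
    S.normSq x (A + B) = S.normSq x A + (2 * S.matForm x A B + S.normSq x B) := by
  simpa using normSq_add_smul A B 1

theorem matForm_sub_left {x : M} {d d' : ℕ} (A A' B : Fin d → Fin d' → S.H x) :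
    S.matForm x (A - A') B = S.matForm x A B - S.matForm x A' B := by
  simp [matForm, ← Finset.sum_sub_distrib]

theorem matS_add {x : M} {d : ℕ} (φ : Fin d → OneForm E M) (e f : Fin d → TangentSpace 𝓘(ℝ, E) x) :
    S.matS x φ (e + f) = S.matS x φ e + S.matS x φ f := by
  ext1 i; ext1 j
  simp only [matS, matA_apply, Pi.add_apply, map_add]
  abel

theorem matS_smul {x : M} {d : ℕ} (φ : Fin d → OneForm E M) (t : ℝ)
    (e : Fin d → TangentSpace 𝓘(ℝ, E) x) : S.matS x φ (t • e) = t • S.matS x φ e := by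
  ext1 i; ext1 j
  simp only [matS, matA_apply, Pi.smul_apply, map_smul, smul_add]

theorem matS_sub {x : M} {d : ℕ} (φ : Fin d → OneForm E M) (e f : Fin d → TangentSpace 𝓘(ℝ, E) x) :
    S.matS x φ (e - f) = S.matS x φ e - S.matS x φ f := by
  ext1 i; ext1 j
  simp only [matS, matA_apply, Pi.sub_apply, map_sub]
  abel

theorem tr_add {x : M} {d : ℕ} (A B : Fin d → Fin d → S.H x) :
    S.tr x (A + B) = S.tr x A + S.tr x B := by
  simp [tr, Finset.sum_add_distrib]

theorem tr_smul {x : M} {d : ℕ} (t : ℝ) (A : Fin d → Fin d → S.H x) :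
    S.tr x (t • A) = t • S.tr x A := by
  simp [tr, Finset.smul_sum]

theorem tr_sub {x : M} {d : ℕ} (A B : Fin d → Fin d → S.H x) :
    S.tr x (A - B) = S.tr x A - S.tr x B := by
  simp [tr, Finset.sum_sub_distrib]

section Orthogonal

variable {x : M} {ι ι' : Type*} [Fintype ι] [Fintype ι'] [DecidableEq ι] {a : ι' → ι → ℝ}

theorem sum_g_orthogonal (ha : ∀ j l, ∑ i, a i j * a i l = if j = l then 1 else 0)
    (v w : ι → S.H x) :
    ∑ i, S.g x (∑ l, a i l • v l) (∑ l, a i l • w l) = ∑ l, S.g x (v l) (w l) := by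
  simp only [map_sum, map_smul, LinearMap.sum_apply, LinearMap.smul_apply, smul_eq_mul,
    Finset.mul_sum]
  rw [Finset.sum_comm]
  refine Finset.sum_congr rfl fun l _ => ?_
  rw [Finset.sum_comm]
  simp only [← mul_assoc, ← Finset.sum_mul, ha]
  simp

end Orthogonal

section Conj

variable {x : M} {d d' : ℕ} {a : Fin d' → Fin d → ℝ}

/-- The matrix `a A aᵀ`. -/
def conj (a : Fin d' → Fin d → ℝ) (A : Fin d → Fin d → S.H x) (i j : Fin d') : S.H x :=
  ∑ l, a i l • ∑ p, a j p • A l p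

theorem matForm_conj (ha : ∀ j l, ∑ i, a i j * a i l = if j = l then 1 else 0)
    (A B : Fin d → Fin d → S.H x) : S.matForm x (conj a A) (conj a B) = S.matForm x A B := by
  unfold matForm conj
  rw [Finset.sum_comm]
  simp only [fun j => sum_g_orthogonal ha (fun l => ∑ p, a j p • A l p)
    (fun l => ∑ p, a j p • B l p)]
  rw [Finset.sum_comm]
  exact Finset.sum_congr rfl fun l _ => sum_g_orthogonal ha (A l) (B l)

theorem tr_conj (ha : ∀ j l, ∑ i, a i j * a i l = if j = l then 1 else 0)
    (A : Fin d → Fin d → S.H x) : S.tr x (conj a A) = S.tr x A := by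
  unfold tr conj
  rw [Finset.sum_comm]
  refine Finset.sum_congr rfl fun l _ => ?_
  simp only [Finset.smul_sum, smul_smul]
  rw [Finset.sum_comm]
  simp only [← Finset.sum_smul, ha]
  simp

end Conj

variable [T2Space M]

section Germ

variable {k : ℕ} {D : ℕ → Distr E M} {x : M} {d : ℕ} {φ : Fin d → OneForm E M}

theorem IsCoframeGerm.eventually_flag (h : S.IsCoframeGerm r k D x φ) (i : Fin d) :
    ∀ᶠ y in 𝓝 x, ∀ v ∈ flag S.H k y, φ i y v = 0 := by
  filter_upwards [h] with y hy using hy.2.1.1 i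

theorem IsCoframeGerm.smoothAt (h : S.IsCoframeGerm r k D x φ) (i : Fin d) : (φ i).SmoothAt x :=
  h.self_of_nhds.1 i

theorem IsCoframeGerm.isCoframeAt (h : S.IsCoframeGerm r k D x φ) :
    S.IsCoframeAt (k + 1) x fun i => φ i x :=
  h.self_of_nhds.2.1

theorem IsCoframeGerm.apply_eq_zero (h : S.IsCoframeGerm r k D x φ) (i : Fin d)
    {v : TangentSpace 𝓘(ℝ, E) x} (hv : v ∈ flag S.H k x) : φ i x v = 0 :=
  (h.eventually_flag i).self_of_nhds v hv

theorem IsCoframeGerm.apply_eq_zero_of_mem_H (h : S.IsCoframeGerm r k D x φ) (hk : 1 ≤ k)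
    (i : Fin d) {v : TangentSpace 𝓘(ℝ, E) x} (hv : v ∈ S.H x) : φ i x v = 0 :=
  h.apply_eq_zero i (S.H_le_flag hk x hv)

theorem IsCoframeGerm.apply_eq_zero_of_mem (h : S.IsCoframeGerm r k D x φ) {m : ℕ} (hm : k + 1 < m)
    (hmr : m ≤ r) (i : Fin d) {v : TangentSpace 𝓘(ℝ, E) x} (hv : v ∈ D m x) : φ i x v = 0 :=
  h.self_of_nhds.2.2 i v (le_adaptedKer hm hmr x hv)

theorem IsCoframeGerm.alpha_eq_zero (h : S.IsCoframeGerm r k D x φ) (hk : 1 ≤ k) (i : Fin d)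
    {v : TangentSpace 𝓘(ℝ, E) x} (hv : v ∈ flag S.H (k - 1) x) : S.alpha (φ i) x v = 0 :=
  g_ext fun X => by
    rw [g_alpha, extDer_lower hk (h.smoothAt i) (h.eventually_flag i) hv X.2, map_zero,
      LinearMap.zero_apply]

/-- Both sides are dual to the same functional, as pairing a coframe with the bracket form computes
dφ. Through this identity the algebraic hypothesis acts on the matrices of the algorithm. -/
theorem IsCoframeGerm.J_cls (h : S.IsCoframeGerm r k D x φ) (hr : S.IsEquiregular r) (hk : 1 ≤ k)
    (hkr : k + 1 ≤ r) (i : Fin d) (v : flag S.H k x) :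
    S.J k x (hatDual (m := k + 1) (φ i x) (h.isCoframeAt.1 i)) (S.cls k x v) =
      S.alpha (φ i) x v := by
  refine g_ext fun X => ?_
  rw [g_alpha, ← hr.apply_bracketForm hk hkr (h.smoothAt i) (h.eventually_flag i)
    (Φ := hatDual (m := k + 1) (φ i x) (h.isCoframeAt.1 i)) (fun c => rfl)]
  exact g_sharp x _ X

theorem IsCoframeGerm.isOrthonormalCobasis (h : S.IsCoframeGerm r k D x φ) :
    IsOrthonormalCobasis (S.hatForm x (k + 1)) fun i =>
      hatDual (m := k + 1) (φ i x) (h.isCoframeAt.1 i) := by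
  obtain ⟨e, he, hd⟩ := h.isCoframeAt.2
  exact ⟨_, he.2, hd⟩

/-- Semi-`𝒥`-nondegeneracy in terms of exterior derivatives. -/
theorem IsCoframeGerm.mem_of_matS_eq_zero (h : S.IsCoframeGerm r k D x φ)
    (hr : S.IsEquiregular r) (hJ : S.IsSemiJNondegenerate r) (hk : 1 ≤ k) (hkr : k + 1 ≤ r)
    {z : Fin d → TangentSpace 𝓘(ℝ, E) x} (hz : ∀ j, z j ∈ flag S.H k x)
    (h0 : ∀ i j, S.matS x φ z i j = 0) (j : Fin d) : z j ∈ flag S.H (k - 1) x := by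
  have hinj := hJ x k hk hkr d _ h.isOrthonormalCobasis
  have := @hinj (fun j => S.cls k x ⟨z j, hz j⟩) 0 (by
    funext i j
    simp only [h.J_cls hr hk hkr, Pi.zero_apply, map_zero, add_zero]
    exact h0 i j)
  exact (cls_eq_zero_iff _).1 (congrFun this j)

theorem IsCoframeGerm.card_pos (h : S.IsCoframeGerm r k D x φ) (hr : S.IsEquiregular r)
    (hk : 1 ≤ k) (hkr : k + 1 ≤ r) : 0 < d := by
  rcases Nat.eq_zero_or_pos d with rfl | hd
  · refine absurd (le_antisymm (flag_le_succ k x) fun v hv => ?_) (hr.flag_ne hk hkr x)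
    exact h.isCoframeAt.mem_of_forall hv fun i => i.elim0
  · exact hd

/-- Nondegeneracy is applied to the row with all entries equal to `z`, which has at least one entry
because H_k ≠ H_{k+1}. -/
theorem IsCoframeGerm.mem_of_alpha_eq_zero (h : S.IsCoframeGerm r k D x φ)
    (hr : S.IsEquiregular r) (hJ : S.IsSemiJNondegenerate r) (hk : 1 ≤ k) (hkr : k + 1 ≤ r)
    {z : TangentSpace 𝓘(ℝ, E) x} (hz : z ∈ flag S.H k x)
    (h0 : ∀ i, S.alpha (φ i) x z = 0) : z ∈ flag S.H (k - 1) x :=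
  h.mem_of_matS_eq_zero hr hJ hk hkr (z := fun _ => z) (fun _ => hz)
    (fun i j => by simp [matS, matA_apply, h0]) ⟨0, h.card_pos hr hk hkr⟩

end Germ

section Select

variable {k : ℕ} {D : ℕ → Distr E M} {x : M} {d : ℕ} {φ : Fin d → OneForm E M}

/-- First order characterization of the row vectors selected by `𝒮`; the trace is prescribed
when `c` holds. -/
structure IsSelected (S : SubRiemannian E M) (k : ℕ) (c : Prop) (x : M) {d : ℕ}
    (φ : Fin d → OneForm E M) (ρ : S.H x) (e : Fin d → TangentSpace 𝓘(ℝ, E) x) : Prop where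
  mem : ∀ j, e j ∈ flag S.H (k + 1) x
  dual : ∀ i j, φ i x (e j) = if i = j then 1 else 0
  trace : c → S.tr x (S.matS x φ e) = ρ
  orth : ∀ z : Fin d → TangentSpace 𝓘(ℝ, E) x, (∀ j, z j ∈ flag S.H k x) →
    (c → S.tr x (S.matS x φ z) = 0) → S.matForm x (S.matS x φ e) (S.matS x φ z) = 0

theorem IsCoframeGerm.sub_mem_flag (h : S.IsCoframeGerm r k D x φ)
    {e e' : Fin d → TangentSpace 𝓘(ℝ, E) x} (he : ∀ j, e j ∈ flag S.H (k + 1) x)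
    (he' : ∀ j, e' j ∈ flag S.H (k + 1) x) (hd : ∀ i j, φ i x (e j) = if i = j then 1 else 0)
    (hd' : ∀ i j, φ i x (e' j) = if i = j then 1 else 0) (j : Fin d) :
    (e' - e) j ∈ flag S.H k x :=
  h.isCoframeAt.mem_of_forall (Submodule.sub_mem _ (he' j) (he j)) fun i => by
    rw [Pi.sub_apply, map_sub, hd, hd', sub_self]

/-- Pythagoras: the mixed term vanishes by orthogonality, and the squared norm of the variation is
positive by nondegeneracy unless all its entries lie in H_{k-1}. -/
theorem IsSelected.normSq_lt {c : Prop} {ρ : S.H x} {e : Fin d → TangentSpace 𝓘(ℝ, E) x}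
    (hs : S.IsSelected k c x φ ρ e) (h : S.IsCoframeGerm r k D x φ)
    (hr : S.IsEquiregular r) (hJ : S.IsSemiJNondegenerate r) (hk : 1 ≤ k) (hkr : k + 1 ≤ r)
    {e' : Fin d → TangentSpace 𝓘(ℝ, E) x} (he' : ∀ j, e' j ∈ flag S.H (k + 1) x)
    (hd' : ∀ i j, φ i x (e' j) = if i = j then 1 else 0)
    (ht : c → S.tr x (S.matS x φ e') = ρ) (hne : ∃ j, e' j - e j ∉ flag S.H (k - 1) x) :
    S.normSq x (S.matS x φ e) < S.normSq x (S.matS x φ e') := by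
  have hz := h.sub_mem_flag hs.mem he' hs.dual hd'
  have e1 : S.matS x φ e' = S.matS x φ e + S.matS x φ (e' - e) := by
    rw [← matS_add, add_sub_cancel]
  rw [e1, normSq_add, hs.orth _ hz fun hc => by
    rw [matS_sub, tr_sub, ht hc, hs.trace hc, sub_self]]
  have h0 : S.normSq x (S.matS x φ (e' - e)) ≠ 0 := by
    intro h0
    obtain ⟨j, hj⟩ := hne
    exact hj (h.mem_of_matS_eq_zero hr hJ hk hkr hz (normSq_eq_zero h0) j)
  have := lt_of_le_of_ne (normSq_nonneg _) h0.symm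
  linarith

/-- Every `e + t z` is a competitor, so the linear coefficient in `t` must vanish. Variations in
H_{k-1} are not genuine competitors, but they do not change 𝒮. -/
theorem IsCoframeGerm.isSelected_of_min (h : S.IsCoframeGerm r k D x φ) (hk : 1 ≤ k)
    {c : Prop} {ρ : S.H x}
    {e : Fin d → TangentSpace 𝓘(ℝ, E) x} (hm : ∀ j, e j ∈ flag S.H (k + 1) x)
    (hd : ∀ i j, φ i x (e j) = if i = j then 1 else 0) (ht : c → S.tr x (S.matS x φ e) = ρ)
    (hmin : ∀ e' : Fin d → TangentSpace 𝓘(ℝ, E) x, (∀ j, e' j ∈ flag S.H (k + 1) x) →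
      (∀ i j, φ i x (e' j) = if i = j then 1 else 0) → (c → S.tr x (S.matS x φ e') = ρ) →
      (∃ j, e' j - e j ∉ flag S.H (k - 1) x) →
      S.normSq x (S.matS x φ e) < S.normSq x (S.matS x φ e')) :
    S.IsSelected k c x φ ρ e := by
  refine ⟨hm, hd, ht, fun z hz hzt => ?_⟩
  by_cases hz0 : ∀ j, z j ∈ flag S.H (k - 1) x
  · have : S.matS x φ z = 0 := by
      ext1 i; ext1 j
      simp [matS, matA_apply, fun i j => h.alpha_eq_zero hk i (hz0 j)]
    simp [this, matForm]
  · push Not at hz0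
    obtain ⟨j, hj⟩ := hz0
    refine eq_zero_of_forall_pos (c := S.normSq x (S.matS x φ z)) fun t ht0 => ?_
    have := hmin (e + t • z)
      (fun j => Submodule.add_mem _ (hm j) (Submodule.smul_mem _ _ (flag_le_succ k x (hz j))))
      (fun i j => by simp [h.apply_eq_zero i (hz j), hd])
      (fun hc => by rw [matS_add, matS_smul, tr_add, tr_smul, hzt hc, ht hc, smul_zero, add_zero])
      ⟨j, fun hmem => hj (by
        simpa [Submodule.smul_mem_iff _ ht0] using hmem)⟩
    rw [matS_add, matS_smul, normSq_add_smul] at this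
    linarith

/-- The difference is an admissible variation for both rows, hence 𝒮 of it is orthogonal to itself.
-/
theorem IsSelected.sub_mem {c : Prop} {ρ : S.H x} {e e' : Fin d → TangentSpace 𝓘(ℝ, E) x}
    (hs : S.IsSelected k c x φ ρ e) (hs' : S.IsSelected k c x φ ρ e')
    (h : S.IsCoframeGerm r k D x φ)
    (hr : S.IsEquiregular r) (hJ : S.IsSemiJNondegenerate r) (hk : 1 ≤ k) (hkr : k + 1 ≤ r)
    (j : Fin d) : e' j - e j ∈ flag S.H (k - 1) x := by
  have hz := h.sub_mem_flag hs.mem hs'.mem hs.dual hs'.dual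
  have ht : c → S.tr x (S.matS x φ (e' - e)) = 0 := fun hc => by
    rw [matS_sub, tr_sub, hs.trace hc, hs'.trace hc, sub_self]
  have h1 := hs.orth _ hz ht
  have h2 := hs'.orth _ hz ht
  refine h.mem_of_matS_eq_zero hr hJ hk hkr hz (normSq_eq_zero ?_) j
  rw [normSq_eq_matForm]
  nth_rw 1 [matS_sub]
  rw [matForm_sub_left, h1, h2, sub_self]

end Select

/-! ### Independence of the coframe -/

section ChangeOfCoframe

variable {k : ℕ} {D : ℕ → Distr E M} {x : M} {d d' : ℕ} {φ : Fin d → OneForm E M}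
variable {φ' : Fin d' → OneForm E M} {a : Fin d' → Fin d → M → ℝ}

/-- When φ_i(e_j) = t δ_{ij}, the derivatives of `a` enter 𝒜 as -t σ aᵀ. This is skew and cancels in
the symmetrization. The case t = 1 concerns dual rows and t = 0 concerns variations. -/
theorem _root_.SubRiem.IsGauge.matS_conj (ha : IsGauge x φ φ' a) (hφ : ∀ j, (φ j).SmoothAt x)
    (hφH : ∀ j, ∀ X ∈ S.H x, φ j x X = 0) {t : ℝ} {e : Fin d → TangentSpace 𝓘(ℝ, E) x}
    (he : ∀ i j, φ i x (e j) = if i = j then t else 0) :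
    S.matS x φ' (fun j => ∑ p, a j p x • e p) = conj (fun i j => a i j x) (S.matS x φ e) := by
  obtain ⟨σ, h1, h2⟩ := ha.exists_sigma (S := S) hφ hφH
  ext1 i; ext1 j
  have h3 : ∀ i j, S.alpha (φ' i) x (∑ p, a j p x • e p) =
      (∑ l, ∑ p, (a i l x * a j p x) • S.alpha (φ l) x (e p)) - t • ∑ l, a j l x • σ i l := by
    intro i j
    rw [h1]
    congr 1
    · simp only [map_sum, map_smul, Finset.smul_sum, smul_smul]
    · simp [he, Finset.smul_sum, smul_smul, mul_comm]
  have h4 : ∑ l, a j l x • σ i l = -∑ l, a i l x • σ j l := by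
    have := h2 i j
    rw [Finset.sum_add_distrib] at this
    exact eq_neg_of_add_eq_zero_left this
  simp only [matS, matA_apply, h3]
  rw [h4, smul_neg]
  generalize t • ∑ l, a i l x • σ j l = u
  simp only [conj, matS, matA_apply, smul_add, Finset.sum_add_distrib, Finset.smul_sum, smul_smul]
  rw [Finset.sum_comm (f := fun l p => (a j l x * a i p x) • S.alpha (φ l) x (e p))]
  simp only [mul_comm (a j _ x)]
  abel

/-- Conjugation by an orthogonal matrix preserves the inner product of matrices and the trace;
variations are carried back by the transpose of `a`. -/
theorem IsSelected.gauge {c : Prop} {ρ : S.H x} {e : Fin d → TangentSpace 𝓘(ℝ, E) x}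
    (hs : S.IsSelected k c x φ ρ e) (h : S.IsCoframeGerm r k D x φ) (hk : 1 ≤ k)
    (ha : IsGauge x φ φ' a) :
    S.IsSelected k c x φ' ρ fun j => ∑ p, a j p x • e p := by
  have hsm := fun j => h.smoothAt j
  have hH : ∀ j, ∀ X ∈ S.H x, φ j x X = 0 := fun j X hX => h.apply_eq_zero_of_mem_H hk j hX
  have e1 := ha.matS_conj (S := S) hsm hH hs.dual
  refine ⟨fun j => Submodule.sum_mem _ fun p _ => Submodule.smul_mem _ _ (hs.mem p),
    fun i j => ?_, fun hc => ?_, fun z hz hzt => ?_⟩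
  · rw [ha.eq.self_of_nhds i, ← ha.row.self_of_nhds i j]
    simp [hs.dual, mul_comm]
  · rw [e1, tr_conj ha.col, hs.trace hc]
  · let w : Fin d → TangentSpace 𝓘(ℝ, E) x := fun p => ∑ j, a j p x • z j
    have hw : ∀ p, w p ∈ flag S.H k x := fun p =>
      Submodule.sum_mem _ fun j _ => Submodule.smul_mem _ _ (hz j)
    have hzw : z = fun j => ∑ p, a j p x • w p := by
      funext j
      simp only [w, Finset.smul_sum, smul_smul]
      rw [Finset.sum_comm]
      simp only [← Finset.sum_smul, ha.row.self_of_nhds]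
      simp
    have e2 := ha.matS_conj (S := S) hsm hH (t := 0) (e := w)
      fun i j => by simp [h.apply_eq_zero i (hw j)]
    rw [hzw] at hzt ⊢
    rw [e2] at hzt ⊢
    rw [e1, matForm_conj ha.col]
    exact hs.orth w hw fun hc => (tr_conj ha.col _).symm.trans (hzt hc)

/-- The subspace spanned by the selected vectors does not depend on the coframe field. -/
theorem IsSelected.span_eq (hD : S.IsSlice r k D) {c : Prop} {ρ : S.H x}
    {e : Fin d → TangentSpace 𝓘(ℝ, E) x}
    {e' : Fin d' → TangentSpace 𝓘(ℝ, E) x}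
    (hs : S.IsSelected k c x φ ρ e) (hs' : S.IsSelected k c x φ' ρ e')
    (h : S.IsCoframeGerm r k D x φ) (h' : S.IsCoframeGerm r k D x φ')
    (hr : S.IsEquiregular r) (hJ : S.IsSemiJNondegenerate r) (hk : 1 ≤ k) (hkr : k + 1 ≤ r) :
    Submodule.span ℝ (Set.range e) ⊔ flag S.H (k - 1) x =
      Submodule.span ℝ (Set.range e') ⊔ flag S.H (k - 1) x := by
  have key : ∀ {d d' : ℕ} {φ : Fin d → OneForm E M} {φ' : Fin d' → OneForm E M}
      {e : Fin d → TangentSpace 𝓘(ℝ, E) x} {e' : Fin d' → TangentSpace 𝓘(ℝ, E) x},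
      S.IsSelected k c x φ ρ e → S.IsSelected k c x φ' ρ e' → S.IsCoframeGerm r k D x φ →
      S.IsCoframeGerm r k D x φ' → Submodule.span ℝ (Set.range e') ⊔ flag S.H (k - 1) x ≤
        Submodule.span ℝ (Set.range e) ⊔ flag S.H (k - 1) x := by
    intro d d' φ φ' e e' hs hs' h h'
    obtain ⟨a, ha⟩ := h.exists_gauge hD hr hk hkr h'
    refine sup_le (Submodule.span_le.2 ?_) le_sup_right
    rintro _ ⟨j, rfl⟩
    have := (hs.gauge h hk ha).sub_mem hs' h' hr hJ hk hkr j
    have h2 : ∑ p, a j p x • e p ∈ Submodule.span ℝ (Set.range e) :=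
      Submodule.sum_mem _ fun p _ => Submodule.smul_mem _ _ (Submodule.subset_span ⟨p, rfl⟩)
    have := Submodule.add_mem_sup h2 this
    rwa [add_sub_cancel] at this
  exact le_antisymm (key hs' hs h' h) (key hs hs' h h')

/-- As `V` meets H_k trivially, the row in `V` dual to a coframe is unique. It therefore transforms
by the same matrix as the coframe, and the trace is invariant under conjugation. This makes R well
defined. -/
theorem IsCoframeGerm.tr_matS_eq (hD : S.IsSlice r k D) (h : S.IsCoframeGerm r k D x φ)
    (h' : S.IsCoframeGerm r k D x φ') (hr : S.IsEquiregular r) (hk : 1 ≤ k) (hkr : k + 1 ≤ r)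
    {V : Submodule ℝ (TangentSpace 𝓘(ℝ, E) x)} (hV : V ≤ flag S.H (k + 1) x)
    (hV0 : V ⊓ flag S.H k x = ⊥)
    {e : Fin d → TangentSpace 𝓘(ℝ, E) x} {e' : Fin d' → TangentSpace 𝓘(ℝ, E) x}
    (he : ∀ j, e j ∈ V) (he' : ∀ j, e' j ∈ V)
    (hd : ∀ i j, φ i x (e j) = if i = j then 1 else 0)
    (hd' : ∀ i j, φ' i x (e' j) = if i = j then 1 else 0) :
    S.tr x (S.matS x φ' e') = S.tr x (S.matS x φ e) := by
  obtain ⟨a, ha⟩ := h.exists_gauge hD hr hk hkr h'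
  have e1 : e' = fun j => ∑ p, a j p x • e p := by
    funext j
    have hm : ∑ p, a j p x • e p ∈ V :=
      Submodule.sum_mem _ fun p _ => Submodule.smul_mem _ _ (he p)
    refine sub_eq_zero.1 ((Submodule.mem_bot ℝ).1 ?_)
    rw [← hV0]
    refine ⟨Submodule.sub_mem _ (he' j) hm, ?_⟩
    refine h'.isCoframeAt.mem_of_forall (hV (Submodule.sub_mem _ (he' j) hm)) fun i => ?_
    rw [map_sub, hd', ha.eq.self_of_nhds i, ← ha.row.self_of_nhds i j]
    simp [hd, mul_comm]
  rw [e1, ha.matS_conj (fun j => h.smoothAt j) (fun j X hX => h.apply_eq_zero_of_mem_H hk j hX) hd,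
    tr_conj ha.col]

end ChangeOfCoframe

end SubRiemannian

/-! ### Smooth dependence of constrained critical points -/

section Critical

variable {E : Type*} [NormedAddCommGroup E] [NormedSpace ℝ E] [FiniteDimensional ℝ E]
variable {M : Type*} [TopologicalSpace M] [ChartedSpace E M] [IsManifold 𝓘(ℝ, E) ∞ M]

/-- Constrained critical points of smooth families of positive definite quadratic functions. -/
theorem exists_smooth_critical {A C : Type*} [Fintype A] [Fintype C] {x : M}
    {Q : A → A → M → ℝ} {L : C → A → M → ℝ} {b : A → M → ℝ} {ρ : C → M → ℝ}
    (hQs : ∀ a a', ∀ᶠ y in 𝓝 x, SmoothFnAt E (Q a a') y)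
    (hLs : ∀ c a, ∀ᶠ y in 𝓝 x, SmoothFnAt E (L c a) y)
    (hbs : ∀ a, ∀ᶠ y in 𝓝 x, SmoothFnAt E (b a) y)
    (hρs : ∀ c, ∀ᶠ y in 𝓝 x, SmoothFnAt E (ρ c) y)
    (hQ : ∀ᶠ y in 𝓝 x, ∀ ζ : A → ℝ, ∑ a, ζ a * ∑ a', Q a a' y * ζ a' = 0 → ζ = 0)
    (hL : ∀ᶠ y in 𝓝 x, ∀ l : C → ℝ, (∀ a, ∑ c, L c a y * l c = 0) → l = 0) :
    ∃ ζ : A → M → ℝ, (∀ a, ∀ᶠ y in 𝓝 x, SmoothFnAt E (ζ a) y) ∧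
      ∀ᶠ y in 𝓝 x, (∀ c, ∑ a, L c a y * ζ a y = ρ c y) ∧
        ∀ η : A → ℝ, (∀ c, ∑ a, L c a y * η a = 0) →
          ∑ a, η a * (∑ a', Q a a' y * ζ a' y + b a y) = 0 := by
  classical
  -- The matrix of the Lagrange system. For a kernel vector the constraint rows annihilate the
  -- multiplier term, leaving ζᵀQζ = 0 and so ζ = 0; the multipliers then vanish by `hL`.
  let K : M → Matrix (A ⊕ C) (A ⊕ C) ℝ := fun y =>
    Matrix.fromBlocks (Matrix.of fun a a' => Q a a' y) (Matrix.of fun a c => L c a y)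
      (Matrix.of fun c a => L c a y) 0
  let R : A ⊕ C → M → ℝ := Sum.elim (fun a y => -b a y) ρ
  have hK : ∀ᶠ y in 𝓝 x, (K y).det ≠ 0 := by
    filter_upwards [hQ, hL] with y h1 h2 hdet
    obtain ⟨v, hv0, hv⟩ := Matrix.exists_mulVec_eq_zero_iff.2 hdet
    have e1 : ∀ a, ∑ a', Q a a' y * v (Sum.inl a') + ∑ c, L c a y * v (Sum.inr c) = 0 := fun a => by
      simpa [K, Matrix.mulVec, dotProduct] using congrFun hv (Sum.inl a)
    have e2 : ∀ c, ∑ a, L c a y * v (Sum.inl a) = 0 := fun c => by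
      simpa [K, Matrix.mulVec, dotProduct] using congrFun hv (Sum.inr c)
    have e3 : ∑ a, v (Sum.inl a) * ∑ c, L c a y * v (Sum.inr c) = 0 := by
      simp only [Finset.mul_sum]
      rw [Finset.sum_comm]
      refine Finset.sum_eq_zero fun c _ => ?_
      have := congrArg (v (Sum.inr c) * ·) (e2 c)
      simp only [mul_zero, Finset.mul_sum] at this
      rw [← this]
      exact Finset.sum_congr rfl fun a _ => by ring
    have e4 := h1 (fun a => v (Sum.inl a)) (by
      have : ∑ a, v (Sum.inl a) *
          (∑ a', Q a a' y * v (Sum.inl a') + ∑ c, L c a y * v (Sum.inr c)) = 0 :=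
        Finset.sum_eq_zero fun a _ => by rw [e1, mul_zero]
      simp only [mul_add, Finset.sum_add_distrib, e3, add_zero] at this
      exact this)
    have e4' : ∀ a, v (Sum.inl a) = 0 := fun a => congrFun e4 a
    have e5 := h2 (fun c => v (Sum.inr c)) fun a => by simpa [e4'] using e1 a
    refine hv0 (funext fun s => ?_)
    rcases s with a | c
    · exact e4' a
    · exact congrFun e5 c
  have hKs : ∀ s t, ∀ᶠ y in 𝓝 x, SmoothFnAt E (fun y => K y s t) y := by
    rintro (a | c) (a' | c')
    · exact hQs a a'
    · exact hLs c' a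
    · exact hLs c a'
    · exact .of_forall fun _ => .const 0
  have hRs : ∀ s, ∀ᶠ y in 𝓝 x, SmoothFnAt E (R s) y := by
    rintro (a | c)
    · filter_upwards [hbs a] with y hy using hy.neg
    · exact hρs c
  refine ⟨fun a y => ∑ s, (K y)⁻¹ (Sum.inl a) s * R s y, fun a => ?_, ?_⟩
  · filter_upwards [hK, Filter.eventually_all.2 fun s => Filter.eventually_all.2 (hKs s),
      Filter.eventually_all.2 hRs] with y h1 h2 h3
    exact SmoothFnAt.sum fun s _ => (SmoothFnAt.matrix_inv h2 h1 _ _).mul (h3 s)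
  · filter_upwards [hK] with y hy
    let v : A ⊕ C → ℝ := (K y)⁻¹.mulVec fun s => R s y
    have hv : (K y).mulVec v = fun s => R s y := by
      simp only [v, Matrix.mulVec_mulVec]
      rw [Matrix.mul_nonsing_inv _ (isUnit_iff_ne_zero.2 hy), Matrix.one_mulVec]
    have e1 : ∀ a, ∑ a', Q a a' y * v (Sum.inl a') + ∑ c, L c a y * v (Sum.inr c) = -b a y :=
      fun a => by simpa [K, R, Matrix.mulVec, dotProduct] using congrFun hv (Sum.inl a)
    have e2 : ∀ c, ∑ a, L c a y * v (Sum.inl a) = ρ c y := fun c => by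
      simpa [K, R, Matrix.mulVec, dotProduct] using congrFun hv (Sum.inr c)
    refine ⟨e2, fun η hη => ?_⟩
    have e3 : ∑ a, η a * ∑ c, L c a y * v (Sum.inr c) = 0 := by
      simp only [Finset.mul_sum]
      rw [Finset.sum_comm]
      refine Finset.sum_eq_zero fun c _ => ?_
      have := congrArg (v (Sum.inr c) * ·) (hη c)
      simp only [mul_zero, Finset.mul_sum] at this
      rw [← this]
      exact Finset.sum_congr rfl fun a _ => by ring
    rw [← neg_eq_zero, ← e3, ← Finset.sum_neg_distrib]
    refine Finset.sum_congr rfl fun a _ => ?_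
    have := e1 a
    change -(η a * (∑ a', Q a a' y * v (Sum.inl a') + b a y)) = _
    linear_combination (-η a) * this

end Critical

/-! ### Smoothness of the matrices -/

namespace SubRiemannian

variable {E : Type*} [NormedAddCommGroup E] [NormedSpace ℝ E] [FiniteDimensional ℝ E]
variable {M : Type*} [TopologicalSpace M] [ChartedSpace E M] [IsManifold 𝓘(ℝ, E) ∞ M]
variable {S : SubRiemannian E M} {r : ℕ}

theorem matForm_symm {x : M} {d d' : ℕ} (A B : Fin d → Fin d' → S.H x) :
    S.matForm x A B = S.matForm x B A := by
  simp only [matForm, S.g_symm x (A _ _)]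

theorem matForm_add_right {x : M} {d d' : ℕ} (A B C : Fin d → Fin d' → S.H x) :
    S.matForm x A (B + C) = S.matForm x A B + S.matForm x A C := by
  simp [matForm, Finset.sum_add_distrib]

theorem matForm_sum_right {x : M} {d d' : ℕ} {ι : Type*} [Fintype ι] (A : Fin d → Fin d' → S.H x)
    (c : ι → ℝ) (B : ι → Fin d → Fin d' → S.H x) :
    S.matForm x A (∑ s, c s • B s) = ∑ s, c s * S.matForm x A (B s) := by
  simp only [matForm, Finset.sum_apply, Pi.smul_apply, map_sum, map_smul, smul_eq_mul,
    Finset.mul_sum]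
  rw [Finset.sum_comm]
  conv_rhs => rw [Finset.sum_comm]
  rw [Finset.sum_comm]
  refine Finset.sum_congr rfl fun i _ => ?_
  rw [Finset.sum_comm]

theorem matS_sum {x : M} {d : ℕ} {ι : Type*} [Fintype ι] (φ : Fin d → OneForm E M) (c : ι → ℝ)
    (f : ι → Fin d → TangentSpace 𝓘(ℝ, E) x) :
    S.matS x φ (∑ s, c s • f s) = ∑ s, c s • S.matS x φ (f s) := by
  ext1 i; ext1 j
  simp only [matS, matA_apply, Finset.sum_apply, Pi.smul_apply, map_sum, map_smul,
    smul_add, Finset.sum_add_distrib]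

theorem tr_sum {x : M} {d : ℕ} {ι : Type*} [Fintype ι] (c : ι → ℝ)
    (A : ι → Fin d → Fin d → S.H x) :
    S.tr x (∑ s, c s • A s) = ∑ s, c s • S.tr x (A s) := by
  simp only [tr, Finset.sum_apply, Pi.smul_apply, Finset.smul_sum]
  rw [Finset.sum_comm]

theorem g_tr_matS {x : M} {d : ℕ} (φ : Fin d → OneForm E M) (e : Fin d → TangentSpace 𝓘(ℝ, E) x)
    (X : S.H x) : S.g x (S.tr x (S.matS x φ e)) X = 2 * ∑ i, extDer (φ i) x (e i) X := by
  simp only [tr, matS, matA_apply, map_sum, map_add, LinearMap.sum_apply, LinearMap.add_apply,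
    g_alpha, Finset.mul_sum]
  exact Finset.sum_congr rfl fun i _ => by ring

/-- `φ` is smooth and annihilates `H`, and `φ V` is constant, near `x`. -/
def PairedNear (S : SubRiemannian E M) (φ : OneForm E M) (V : VField E M) (x : M) : Prop :=
  ∃ c : ℝ, ∀ᶠ y in 𝓝 x, φ.SmoothAt y ∧ V.SmoothAt y ∧ (∀ v ∈ S.H y, φ y v = 0) ∧ φ y (V y) = c

variable [T2Space M]

/-- With φ(V) and φ(X) constant nearby, dφ(V, X) reduces to -φ[V, X], a smooth function by the
smoothness of brackets. -/
theorem PairedNear.extDer {φ : OneForm E M} {V X : VField E M} {x : M} (h : S.PairedNear φ V x)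
    (hX : X.IsSectionNear S.H x) :
    ∀ᶠ y in 𝓝 x, SmoothFnAt E (fun y => extDer φ y (V y) (X y)) y := by
  obtain ⟨c, h⟩ := h
  filter_upwards [eventually_eventually_nhds.2 h, VField.IsSectionNear.eventually hX] with y hy hXy
  obtain ⟨h1, h2, -, -⟩ := hy.self_of_nhds
  refine (h1.apply (h2.bracket hXy.smoothAt)).neg.congr ?_
  filter_upwards [eventually_eventually_nhds.2 hy, VField.IsSectionNear.eventually hXy] with z hz hXz
  obtain ⟨h3, h4, -, -⟩ := hz.self_of_nhds
  refine extDer_apply_eq_neg h3 h4 hXz.smoothAt (hz.mono fun w hw => hw.2.2.2) (c' := 0) ?_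
  filter_upwards [hz, hXz] with w hw hXw using hw.2.2.1 _ hXw.2

/-- In a smooth orthonormal frame X_a of H the inner product is Σ_a dφ(V, X_a) dψ(W, X_a). -/
theorem PairedNear.g_alpha {φ ψ : OneForm E M} {V W : VField E M} {x : M}
    (h : S.PairedNear φ V x) (h' : S.PairedNear ψ W x) :
    ∀ᶠ y in 𝓝 x, SmoothFnAt E
      (fun y => S.g y (S.alpha φ y (V y)) (S.alpha ψ y (W y))) y := by
  obtain ⟨n, X, hX, hXo⟩ := S.exists_orthonormal_H x
  filter_upwards [Filter.eventually_all.2 fun a => h.extDer (hX a),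
    Filter.eventually_all.2 fun a => h'.extDer (hX a), eventually_eventually_nhds.2 hXo,
    eventually_eventually_nhds.2 (Filter.eventually_all.2 hX)] with y h1 h2 h3 h4
  refine SmoothFnAt.congr (SmoothFnAt.sum (s := Finset.univ) fun a _ => (h1 a).mul (h2 a)) ?_
  filter_upwards [h3, h4] with z h5 h6
  have hP := (h5 fun a => (h6 a).2).isParseval (S.g_symm z)
  rw [hP.apply_eq]
  refine Finset.sum_congr rfl fun a _ => ?_
  rw [S.g_symm, SubRiemannian.g_alpha, S.g_symm, SubRiemannian.g_alpha]

theorem smooth_matForm {d : ℕ} {φ : Fin d → OneForm E M} {e f : Fin d → VField E M} {x : M}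
    (he : ∀ i j, S.PairedNear (φ i) (e j) x) (hf : ∀ i j, S.PairedNear (φ i) (f j) x) :
    ∀ᶠ y in 𝓝 x, SmoothFnAt E (fun y => S.matForm y (S.matS y φ fun j => e j y)
      (S.matS y φ fun j => f j y)) y := by
  have h := Filter.eventually_all.2 fun i => Filter.eventually_all.2 fun j =>
    Filter.eventually_all.2 fun i' => Filter.eventually_all.2 fun j' =>
      (he i j).g_alpha (hf i' j')
  filter_upwards [h] with y hy
  refine SmoothFnAt.sum fun i _ => SmoothFnAt.sum fun j _ => ?_
  simp only [matS, matA_apply, map_add, LinearMap.add_apply]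
  exact ((hy i j i j).add (hy j i i j)).add ((hy i j j i).add (hy j i j i))

theorem smooth_g_tr {d : ℕ} {φ : Fin d → OneForm E M} {e : Fin d → VField E M} {x : M}
    (he : ∀ i j, S.PairedNear (φ i) (e j) x) {X : VField E M} (hX : X.IsSectionNear S.H x) :
    ∀ᶠ y in 𝓝 x, SmoothFnAt E
      (fun y => extForm S.g y (S.tr y (S.matS y φ fun j => e j y)) (X y)) y := by
  filter_upwards [Filter.eventually_all.2 fun i => (he i i).extDer hX,
    eventually_eventually_nhds.2 hX] with y hy hXy
  refine SmoothFnAt.congr ((SmoothFnAt.const 2).mul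
    (SmoothFnAt.sum (s := Finset.univ) fun i _ => hy i)) ?_
  filter_upwards [hXy] with z hz
  rw [extForm_apply (SetLike.coe_mem _) hz.2]
  exact g_tr_matS φ _ ⟨X z, hz.2⟩

theorem IsCoframeGerm.pairedNear {k : ℕ} {D : ℕ → Distr E M} {x : M} {d : ℕ}
    {φ : Fin d → OneForm E M} (h : S.IsCoframeGerm r k D x φ) (hk : 1 ≤ k) (i : Fin d)
    {V : VField E M} (hV : ∀ᶠ y in 𝓝 x, V.SmoothAt y) {c : ℝ} (hc : ∀ᶠ y in 𝓝 x, φ i y (V y) = c) :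
    S.PairedNear (φ i) V x :=
  ⟨c, by
    filter_upwards [h, hV, hc] with y h1 h2 h3
    exact ⟨h1.1 i, h2, fun v hv => h1.2.1.1 i v (S.H_le_flag hk y hv), h3⟩⟩

/-! ### Selection by 𝒜 -/

section StepA

variable {k m : ℕ} {D : ℕ → Distr E M} {x : M} {d : ℕ} {φ : Fin d → OneForm E M}

/-- The subspace of `D` selected by `𝒜`. -/
def stepA (S : SubRiemannian E M) (k : ℕ) (x : M) {d : ℕ} (φ : Fin d → OneForm E M)
    (D : Submodule ℝ (TangentSpace 𝓘(ℝ, E) x)) : Submodule ℝ (TangentSpace 𝓘(ℝ, E) x) where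
  carrier := {v | v ∈ D ∧ ∀ z ∈ flag S.H k x,
    ∑ i, S.g x (S.alpha (φ i) x v) (S.alpha (φ i) x z) = 0}
  add_mem' := by
    rintro v w ⟨hv, hv'⟩ ⟨hw, hw'⟩
    refine ⟨D.add_mem hv hw, fun z hz => ?_⟩
    simp only [map_add, LinearMap.add_apply, Finset.sum_add_distrib, hv' z hz, hw' z hz, add_zero]
  zero_mem' := ⟨D.zero_mem, fun z _ => by simp⟩
  smul_mem' := by
    rintro c v ⟨hv, hv'⟩
    refine ⟨D.smul_mem c hv, fun z hz => ?_⟩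
    simp only [map_smul, LinearMap.smul_apply, ← Finset.smul_sum, hv' z hz, smul_zero]

theorem stepA_le (k : ℕ) (x : M) {d : ℕ} (φ : Fin d → OneForm E M)
    (D : Submodule ℝ (TangentSpace 𝓘(ℝ, E) x)) : S.stepA k x φ D ≤ D := fun _ h => h.1

/-- Adapted coframes annihilate `D m x` for m > k + 1, and also H_k. On these vectors the
derivatives of the gauge matrix do not enter, and the sum over the coframe is invariant under
orthogonal matrices. -/
theorem stepA_eq_of_gauge (hD : S.IsSlice r k D) (hr : S.IsEquiregular r) (hk : 1 ≤ k)
    (hkm : k + 1 < m) (hmr : m ≤ r) (h : S.IsCoframeGerm r k D x φ)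
    {d' : ℕ} {φ' : Fin d' → OneForm E M} (h' : S.IsCoframeGerm r k D x φ') :
    S.stepA k x φ' (D m x) = S.stepA k x φ (D m x) := by
  obtain ⟨a, ha⟩ := h.exists_gauge hD hr hk (by omega) h'
  obtain ⟨σ, h1, -⟩ := ha.exists_sigma (S := S) (fun j => h.smoothAt j)
    fun j X hX => h.apply_eq_zero_of_mem_H hk j hX
  have key : ∀ v ∈ D m x, ∀ z ∈ flag S.H k x,
      ∑ i, S.g x (S.alpha (φ' i) x v) (S.alpha (φ' i) x z) =
        ∑ i, S.g x (S.alpha (φ i) x v) (S.alpha (φ i) x z) := by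
    intro v hv z hz
    rw [← sum_g_orthogonal ha.col]
    refine Finset.sum_congr rfl fun i _ => ?_
    rw [h1, h1]
    simp [fun j => h.apply_eq_zero_of_mem hkm hmr j hv, fun j => h.apply_eq_zero j hz]
  ext v
  exact and_congr_right fun hv => forall₂_congr fun z hz => by rw [key v hv z hz]

theorem sum_g_alpha_add (φ : Fin d → OneForm E M) (v w z : TangentSpace 𝓘(ℝ, E) x) :
    ∑ i, S.g x (S.alpha (φ i) x (v + w)) (S.alpha (φ i) x z) =
      ∑ i, S.g x (S.alpha (φ i) x v) (S.alpha (φ i) x z) +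
      ∑ i, S.g x (S.alpha (φ i) x w) (S.alpha (φ i) x z) := by
  simp only [map_add, LinearMap.add_apply, Finset.sum_add_distrib]

theorem IsCoframeGerm.mem_of_sum_g_alpha (h : S.IsCoframeGerm r k D x φ)
    (hr : S.IsEquiregular r) (hJ : S.IsSemiJNondegenerate r) (hk : 1 ≤ k) (hkr : k + 1 ≤ r)
    {z : TangentSpace 𝓘(ℝ, E) x} (hz : z ∈ flag S.H k x)
    (h0 : ∑ i, S.g x (S.alpha (φ i) x z) (S.alpha (φ i) x z) = 0) : z ∈ flag S.H (k - 1) x :=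
  h.mem_of_alpha_eq_zero hr hJ hk hkr hz fun i => eq_zero_of_g_self
    ((Finset.sum_eq_zero_iff_of_nonneg fun _ _ => g_self_nonneg x _).1 h0 i (Finset.mem_univ i))

/-- A section of `D m` through `v` is corrected by a combination of representatives `Z` of a frame
of Ĥ_k. The coefficients solve the normal equations, with an empty set of constraints. Testing
against `Z` suffices because H_{k-1} contributes nothing to the condition. -/
theorem IsCoframeGerm.exists_stepA_section (hD : S.IsSlice r k D) (hr : S.IsEquiregular r)
    (hJ : S.IsSemiJNondegenerate r) (hk : 1 ≤ k) (hkm : k + 1 < m) (hmr : m ≤ r)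
    (h : S.IsCoframeGerm r k D x φ) {v : TangentSpace 𝓘(ℝ, E) x} (hv : v ∈ D m x) :
    ∃ V : VField E M, (∀ᶠ y in 𝓝 x, V.SmoothAt y ∧ V y ∈ S.stepA k y φ (D m y)) ∧
      v - V x ∈ flag S.H k x := by
  have hkr : k + 1 ≤ r := by omega
  obtain ⟨V, hV, rfl⟩ :=
    (hD.smooth m (by omega) (by omega) hmr (by omega)).sectionSpanned.exists_near hv
  obtain ⟨p, Z, hZ, hZo⟩ := hr.exists_frame (m := k) hk (by omega) x
  have hVs : ∀ᶠ y in 𝓝 x, V.SmoothAt y := Filter.Eventually.mono hV fun _ h => h.1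
  have hpZ : ∀ i a, S.PairedNear (φ i) (Z a) x := fun i a =>
    h.pairedNear hk i (Filter.Eventually.mono (hZ a) fun _ h => h.1) (c := 0) (by
      filter_upwards [h, hZ a] with y h1 h2 using h1.2.1.1 i _ h2.2)
  have hpV : ∀ i, S.PairedNear (φ i) V x := fun i =>
    h.pairedNear hk i hVs (c := 0) (by
      filter_upwards [h, hV] with y h1 h2 using h1.2.2 i _ (le_adaptedKer hkm hmr y h2.2))
  obtain ⟨ζ, hζ, hζe⟩ := exists_smooth_critical (A := Fin p) (C := Fin 0) (x := x)
    (Q := fun a a' y => ∑ i, S.g y (S.alpha (φ i) y (Z a y)) (S.alpha (φ i) y (Z a' y)))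
    (L := fun c => c.elim0) (ρ := fun c => c.elim0)
    (b := fun a y => ∑ i, S.g y (S.alpha (φ i) y (Z a y)) (S.alpha (φ i) y (V y)))
    (fun a a' => by
      filter_upwards [Filter.eventually_all.2 fun i => (hpZ i a).g_alpha (hpZ i a')] with y hy
      exact SmoothFnAt.sum fun i _ => hy i)
    (fun c => c.elim0)
    (fun a => by
      filter_upwards [Filter.eventually_all.2 fun i => (hpZ i a).g_alpha (hpV i)] with y hy
      exact SmoothFnAt.sum fun i _ => hy i)
    (fun c => c.elim0)
    (by
      filter_upwards [h.eventually, hZo] with y hy hZy ζ hζ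
      refine hZy.eq_zero (hy.mem_of_sum_g_alpha hr hJ hk hkr
        (Submodule.sum_mem _ fun a _ => Submodule.smul_mem _ _ (hZy.mem a)) ?_)
      rw [← hζ]
      simp only [map_sum, map_smul, LinearMap.sum_apply, LinearMap.smul_apply, smul_eq_mul,
        Finset.mul_sum, Finset.sum_mul]
      rw [Finset.sum_comm]
      conv_rhs => rw [Finset.sum_comm]
      refine Finset.sum_congr rfl fun a _ => ?_
      rw [Finset.sum_comm]
      exact Finset.sum_congr rfl fun a' _ => Finset.sum_congr rfl fun _ _ => by
        rw [S.g_symm]; ring)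
    (.of_forall fun _ l _ => funext fun c => c.elim0)
  have hz : VField.IsSectionNear (fun y => ∑ a, ζ a y • Z a y) (flag S.H k) x :=
    .sum fun a _ => (hZ a).smul (hζ a)
  refine ⟨fun y => V y + ∑ a, ζ a y • Z a y, ?_, ?_⟩
  · filter_upwards [h.eventually, hZo, hV, hz, hζe] with y hy hZy hVy hzy hζy
    have hzD : ∑ a, ζ a y • Z a y ∈ D m y := by
      have := hD.inf_eq m (by omega) (by omega) hmr (by omega) y
      exact (this.ge hzy.2).1
    refine ⟨hVy.1.add hzy.1, Submodule.add_mem _ hVy.2 hzD, fun w hw => ?_⟩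
    have hZ0 : ∀ a, ∑ i, S.g y (S.alpha (φ i) y (V y + ∑ a, ζ a y • Z a y))
        (S.alpha (φ i) y (Z a y)) = 0 := by
      intro a
      have := hζy.2 (Pi.single a 1) fun c => c.elim0
      rw [Finset.sum_eq_single a (fun b _ hb => by simp [Pi.single_eq_of_ne hb])
        (by simp), Pi.single_eq_same, one_mul] at this
      rw [sum_g_alpha_add, ← this, add_comm]
      congr 1
      · simp only [map_sum, map_smul, LinearMap.sum_apply, LinearMap.smul_apply, smul_eq_mul,
          Finset.sum_mul]
        rw [Finset.sum_comm]
        exact Finset.sum_congr rfl fun a' _ => Finset.sum_congr rfl fun i _ => by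
          rw [S.g_symm]; ring
      · exact Finset.sum_congr rfl fun i _ => by rw [S.g_symm]
    obtain ⟨c, hc⟩ := hZy.exists_sub_mem hw
    have e : ∀ i, S.alpha (φ i) y w = ∑ a, c a • S.alpha (φ i) y (Z a y) := by
      intro i
      have := hy.alpha_eq_zero hk i hc
      rw [map_sub, sub_eq_zero] at this
      rw [this]
      simp only [map_sum, map_smul]
    simp only [e]
    generalize V y + ∑ a, ζ a y • Z a y = u at hZ0 ⊢
    simp only [map_sum, map_smul, smul_eq_mul]
    rw [Finset.sum_comm]
    refine Finset.sum_eq_zero fun a _ => ?_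
    rw [← Finset.mul_sum, hZ0, mul_zero]
  · have : V x - (V x + ∑ a, ζ a x • Z a x) = -∑ a, ζ a x • Z a x := by abel
    rw [this]
    exact Submodule.neg_mem _ hz.mem

/-- An element of the intersection lies in H_k and satisfies its orthogonality condition against
itself, so nondegeneracy puts it in H_{k-1}. -/
theorem IsCoframeGerm.stepA_inf (hD : S.IsSlice r k D) (hr : S.IsEquiregular r)
    (hJ : S.IsSemiJNondegenerate r) (hk : 1 ≤ k) (hkm : k + 1 < m) (hmr : m ≤ r)
    (h : S.IsCoframeGerm r k D x φ) :
    S.stepA k x φ (D m x) ⊓ flag S.H (m - 1) x = flag S.H (k - 1) x := by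
  have hinf := hD.inf_eq m (by omega) (by omega) hmr (by omega) x
  refine le_antisymm ?_ fun z hz => ?_
  · rintro z ⟨⟨hzD, hz⟩, hzm⟩
    have hzk : z ∈ flag S.H k x := hinf ▸ ⟨hzD, hzm⟩
    exact h.mem_of_sum_g_alpha hr hJ hk (by omega) hzk (hz z hzk)
  · have hzk : z ∈ flag S.H k x := flag_mono (Nat.sub_le k 1) x hz
    have := hinf.ge hzk
    refine ⟨⟨this.1, fun w _ => ?_⟩, this.2⟩
    simp [fun i => h.alpha_eq_zero hk i hz]

theorem IsCoframeGerm.stepA_sup (hD : S.IsSlice r k D) (hr : S.IsEquiregular r)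
    (hJ : S.IsSemiJNondegenerate r) (hk : 1 ≤ k) (hkm : k + 1 < m) (hmr : m ≤ r)
    (h : S.IsCoframeGerm r k D x φ) :
    S.stepA k x φ (D m x) ⊔ flag S.H (m - 1) x = flag S.H m x := by
  have hsup := hD.sup_eq m (by omega) (by omega) hmr (by omega) x
  refine le_antisymm ?_ ?_
  · exact (sup_le_sup_right (stepA_le k x φ _) _).trans hsup.le
  · rw [← hsup]
    refine sup_le (fun v hv => ?_) le_sup_right
    obtain ⟨V, hV, hVx⟩ := h.exists_stepA_section hD hr hJ hk hkm hmr hv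
    have := Submodule.add_mem_sup hV.self_of_nhds.2
      (flag_mono (show k ≤ m - 1 by omega) x hVx)
    rwa [add_sub_cancel] at this

/-- The corrected section misses `v` by an element of `stepA` that lies in H_k, hence in H_{k-1}.
The error is removed by a section of H_{k-1}, which lies in `stepA`. -/
theorem IsCoframeGerm.stepA_extend (hD : S.IsSlice r k D) (hr : S.IsEquiregular r)
    (hJ : S.IsSemiJNondegenerate r) (hk : 1 ≤ k) (hkm : k + 1 < m) (hmr : m ≤ r)
    (h : S.IsCoframeGerm r k D x φ) {v : TangentSpace 𝓘(ℝ, E) x}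
    (hv : v ∈ S.stepA k x φ (D m x)) :
    ∃ V : VField E M, (∀ᶠ y in 𝓝 x, V.SmoothAt y ∧ V y ∈ S.stepA k y φ (D m y)) ∧ V x = v := by
  obtain ⟨V, hV, hVx⟩ := h.exists_stepA_section hD hr hJ hk hkm hmr hv.1
  have h1 : v - V x ∈ S.stepA k x φ (D m x) ⊓ flag S.H (m - 1) x :=
    ⟨Submodule.sub_mem _ hv hV.self_of_nhds.2, flag_mono (show k ≤ m - 1 by omega) x hVx⟩
  rw [h.stepA_inf hD hr hJ hk hkm hmr] at h1
  obtain ⟨Y, hY, hYx⟩ := (S.sectionSpanned_flag (k - 1)).exists_near h1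
  refine ⟨fun y => V y + Y y, ?_, (congrArg (V x + ·) hYx).trans (add_sub_cancel _ _)⟩
  filter_upwards [hV, hY, h.eventually] with y h2 h3 h4
  refine ⟨h2.1.add h3.1, Submodule.add_mem _ h2.2 ?_⟩
  exact ((h4.stepA_inf hD hr hJ hk hkm hmr).ge h3.2).1

end StepA

/-! ### Selection by 𝒮 -/

section StepS

variable {k : ℕ} {D : ℕ → Distr E M} {x : M}

/-- Smooth local rows selected by `𝒮`. -/
theorem IsSlice.exists_selected (hD : S.IsSlice r k D) (hr : S.IsEquiregular r)
    (hJ : S.IsSemiJNondegenerate r) (hk : 1 ≤ k) (hkr : k + 1 ≤ r) {c : Prop} (hc : c → k = 1)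
    {ρ : ∀ y, S.H y} (hρ : c → ∀ X : VField E M, X.IsSectionNear S.H x →
      ∀ᶠ y in 𝓝 x, SmoothFnAt E (fun y => extForm S.g y (ρ y) (X y)) y) :
    ∃ (d : ℕ) (φ : Fin d → OneForm E M) (e : Fin d → VField E M), S.IsCoframeGerm r k D x φ ∧
      (∀ j, (e j).IsSectionNear (flag S.H (k + 1)) x) ∧
      ∀ᶠ y in 𝓝 x, S.IsSelected k c y φ (ρ y) fun j => e j y := by
  classical
  obtain ⟨d, φ, F, h, hF, hd⟩ := hD.exists_coframe hr hk hkr x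
  obtain ⟨p, Z, hZ, hZo⟩ := hr.exists_frame (m := k) hk (by omega) x
  obtain ⟨n, X, hX, hXo⟩ := S.exists_orthonormal_H x
  -- Rows with a single nonzero entry; modulo H_{k-1} they form a basis of the admissible
  -- variations.
  let row : Fin p × Fin d → Fin d → VField E M := fun s l y => if l = s.2 then Z s.1 y else 0
  have hrow : ∀ s l, (row s l).IsSectionNear (flag S.H k) x := by
    intro s l
    by_cases hl : l = s.2
    · simpa [row, hl] using hZ s.1
    · simp only [row, hl, if_false]
      exact .of_forall fun y => ⟨VField.SmoothAt.zero, Submodule.zero_mem _⟩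
  have hpR : ∀ s i l, S.PairedNear (φ i) (row s l) x := fun s i l =>
    h.pairedNear hk i (Filter.Eventually.mono (hrow s l) fun _ h => h.1) (c := 0) (by
      filter_upwards [h, hrow s l] with y h1 h2 using h1.2.1.1 i _ h2.2)
  have hpF : ∀ i j, S.PairedNear (φ i) (F j) x := fun i j =>
    h.pairedNear hk i (Filter.Eventually.mono (hF j) fun _ h => h.1)
      (hd.mono fun y hy => hy i j)
  have hsum : ∀ (y : M) (ζ : Fin p × Fin d → ℝ) (l : Fin d),
      (∑ s, ζ s • fun l => row s l y) l = ∑ a, ζ (a, l) • Z a y := by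
    intro y ζ l
    rw [Finset.sum_apply, Fintype.sum_prod_type]
    refine Finset.sum_congr rfl fun a _ => ?_
    rw [Finset.sum_eq_single l]
    · simp [row]
    · intro j _ hj
      simp [row, hj.symm]
    · simp
  have htr : ∀ (y : M) (s : Fin p × Fin d) (w : S.H y),
      S.g y (S.tr y (S.matS y φ fun l => row s l y)) w = 2 * extDer (φ s.2) y (Z s.1 y) w := by
    intro y s w
    rw [g_tr_matS, Finset.sum_eq_single s.2]
    · simp [row]
    · intro j _ hj
      simp [row, hj]
    · simp
  -- One scalar constraint for each vector of an orthonormal frame of H if `c` holds, and none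
  -- otherwise.
  obtain ⟨ζ, hζ, hζe⟩ := exists_smooth_critical (A := Fin p × Fin d) (C := {_i : Fin n // c})
    (x := x)
    (Q := fun s t y => S.matForm y (S.matS y φ fun l => row s l y) (S.matS y φ fun l => row t l y))
    (L := fun q s y => extForm S.g y (S.tr y (S.matS y φ fun l => row s l y)) (X q.1 y))
    (ρ := fun q y => extForm S.g y (ρ y) (X q.1 y) -
      extForm S.g y (S.tr y (S.matS y φ fun j => F j y)) (X q.1 y))
    (b := fun s y => S.matForm y (S.matS y φ fun l => row s l y) (S.matS y φ fun j => F j y))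
    (fun s t => smooth_matForm (hpR s) (hpR t))
    (fun q s => smooth_g_tr (hpR s) (hX _))
    (fun s => smooth_matForm (hpR s) hpF)
    (fun q => by
      filter_upwards [hρ q.2 _ (hX q.1), smooth_g_tr hpF (hX q.1)] with y h1 h2 using h1.sub h2)
    (by
      filter_upwards [h.eventually, hZo] with y hy hZy ζ hζ
      have h0 : S.normSq y (S.matS y φ (∑ s, ζ s • fun l => row s l y)) = 0 := by
        rw [normSq_eq_matForm, matS_sum, matForm_sum_right, ← hζ]
        refine Finset.sum_congr rfl fun s _ => ?_
        rw [matForm_symm, matForm_sum_right]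
        simp only [mul_comm]
      have h1 := hy.mem_of_matS_eq_zero hr hJ hk hkr (fun l => by
        rw [hsum]
        exact Submodule.sum_mem _ fun a _ => Submodule.smul_mem _ _ (hZy.mem a))
        (normSq_eq_zero h0)
      funext s
      have h2 := h1 s.2
      rw [hsum] at h2
      exact congrFun (hZy.eq_zero h2) s.1)
    (by
      filter_upwards [h.eventually, hZo, hXo, Filter.eventually_all.2 hX] with y hy hZy hXy hXm l hl
      funext q
      have hcq := q.2
      -- A combination of constraints that annihilates all variations is a horizontal `w` with
      -- dφ_i(Z, w) = 0 for all horizontal Z. As k = 1 here, `w` may itself be inserted into the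
      -- nondegeneracy condition, after exchanging the arguments of dφ; so w lies in H_0 = 0.
      obtain rfl := hc hcq
      have hb := hXy fun i => (hXm i).2
      let w : S.H y := ∑ q, l q • ⟨X q.1 y, (hXm q.1).2⟩
      have hw : ∀ s, S.g y (S.tr y (S.matS y φ fun l => row s l y)) w = 0 := by
        intro s
        simp only [w, map_sum, map_smul, smul_eq_mul]
        rw [← hl s]
        refine Finset.sum_congr rfl fun q _ => ?_
        rw [extForm_apply (SetLike.coe_mem _) (hXm q.1).2, mul_comm]
      have hw0 : (w : TangentSpace 𝓘(ℝ, E) y) ∈ flag S.H (1 - 1) y := by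
        refine hy.mem_of_alpha_eq_zero hr hJ hk hkr w.2 fun i => g_ext fun u => ?_
        obtain ⟨a, ha⟩ := hZy.exists_sub_mem (v := (u : TangentSpace 𝓘(ℝ, E) y)) u.2
        have e : (u : TangentSpace 𝓘(ℝ, E) y) = ∑ s, a s • Z s y :=
          sub_eq_zero.1 ((Submodule.mem_bot ℝ).1 ha)
        rw [g_alpha, extDer_swap (hy.smoothAt i), e, map_zero, LinearMap.zero_apply]
        simp only [map_sum, map_smul, LinearMap.sum_apply, LinearMap.smul_apply]
        rw [neg_eq_zero]
        refine Finset.sum_eq_zero fun s _ => ?_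
        have := hw (s, i)
        rw [htr] at this
        simp only at this
        rw [(mul_eq_zero.1 this).resolve_left two_ne_zero, smul_zero]
      have hw1 : w = 0 := Subtype.ext ((Submodule.mem_bot ℝ).1 hw0)
      have := congrArg (S.g y ⟨X q.1 y, (hXm q.1).2⟩) hw1
      simp only [w, map_sum, map_smul, hb.1, smul_eq_mul, map_zero] at this
      rw [Finset.sum_eq_single q] at this
      · simpa using this
      · intro q' _ hq'
        have : q.1 ≠ q'.1 := fun e => hq' (Subtype.ext e.symm)
        simp [this]
      · simp)
  have hz : ∀ l, VField.IsSectionNear (fun y => ∑ a, ζ (a, l) y • Z a y) (flag S.H k) x :=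
    fun l => .sum fun a _ => (hZ a).smul (hζ _)
  refine ⟨d, φ, fun j y => F j y + ∑ a, ζ (a, j) y • Z a y, h, fun j =>
    (hF j).add ((hz j).mono (flag_le_succ k)), ?_⟩
  filter_upwards [h.eventually, hZo, Filter.eventually_all.2 hF, Filter.eventually_all.2 hz, hζe, hd,
    hXo, Filter.eventually_all.2 hX] with y hy hZy hFy hzy hζy hdy hXy hXm
  have hb := hXy fun i => (hXm i).2
  have he : (fun j => F j y + ∑ a, ζ (a, j) y • Z a y) =
      (fun j => F j y) + ∑ s, ζ s y • fun l => row s l y := by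
    funext j
    rw [Pi.add_apply, hsum y fun s => ζ s y]
  have hL : ∀ η : Fin p × Fin d → ℝ, ∀ i (hi : c), ∑ s, extForm S.g y
      (S.tr y (S.matS y φ fun l => row s l y)) (X i y) * η s =
      S.g y (S.tr y (S.matS y φ (∑ s, η s • fun l => row s l y))) ⟨X i y, (hXm i).2⟩ := by
    intro η i hi
    rw [matS_sum, tr_sum]
    simp only [map_sum, map_smul, LinearMap.sum_apply, LinearMap.smul_apply, smul_eq_mul]
    exact Finset.sum_congr rfl fun s _ => by
      rw [extForm_apply (SetLike.coe_mem _) (hXm i).2, mul_comm]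
  refine ⟨fun j => Submodule.add_mem _ (hFy j).2 (flag_le_succ k y (hzy j).2), fun i j => ?_,
    fun hc => ?_, fun z hz hzt => ?_⟩
  · rw [map_add, hdy, hy.apply_eq_zero i (hzy j).2, add_zero]
  · have key : ∀ i, S.g y ⟨X i y, (hXm i).2⟩
        (S.tr y (S.matS y φ fun j => F j y + ∑ a, ζ (a, j) y • Z a y)) =
        S.g y ⟨X i y, (hXm i).2⟩ (ρ y) := by
      intro i
      have := (hL (fun s => ζ s y) i hc).symm.trans (hζy.1 ⟨i, hc⟩)
      rw [extForm_apply (SetLike.coe_mem _) (hXm i).2,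
        extForm_apply (SetLike.coe_mem _) (hXm i).2] at this
      rw [he, matS_add, tr_add, map_add, S.g_symm y _ (S.tr y _), S.g_symm y _ (S.tr y _),
        S.g_symm y _ (ρ y), this]
      exact add_sub_cancel _ _
    have hP := hb.isParseval (S.g_symm y)
    rw [← hP.sum_eq (ρ y), ← hP.sum_eq (S.tr y _)]
    simp only [key]
  · have h1 : ∀ l, ∃ a : Fin p → ℝ, z l - ∑ s, a s • Z s y ∈ flag S.H (k - 1) y :=
      fun l => hZy.exists_sub_mem (hz l)
    choose a ha using h1
    -- Modulo H_{k-1}, which 𝒮 does not see, every variation is a combination of the basic rows.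
    have hSz : S.matS y φ z = S.matS y φ (∑ s, a s.2 s.1 • fun l => row s l y) := by
      rw [← sub_eq_zero, ← matS_sub]
      ext1 i; ext1 j
      have h0 : ∀ i l, S.alpha (φ i) y ((z - ∑ s, a s.2 s.1 • fun l => row s l y) l) = 0 := by
        intro i l
        refine hy.alpha_eq_zero hk i ?_
        rw [Pi.sub_apply, hsum y (fun s => a s.2 s.1)]
        exact ha l
      simp only [matS, matA_apply, h0, add_zero, Pi.zero_apply]
    have h2 := hζy.2 (fun s => a s.2 s.1) fun q => by
      rw [hL _ _ q.2, ← hSz, hzt q.2, map_zero, LinearMap.zero_apply]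
    rw [hSz, matS_sum, matForm_sum_right, ← h2]
    refine Finset.sum_congr rfl fun s _ => ?_
    rw [he, matS_add, matS_sum, matForm_symm, matForm_add_right, matForm_sum_right, add_comm]
    simp only [mul_comm]

end StepS

end SubRiemannian

/-! ### One step of the algorithm: existence and uniqueness -/

section Sections

variable {E : Type*} [NormedAddCommGroup E] [NormedSpace ℝ E] [FiniteDimensional ℝ E]
variable {M : Type*} [TopologicalSpace M] [ChartedSpace E M] [IsManifold 𝓘(ℝ, E) ∞ M] [T2Space M]

theorem sectionSpanned_of_near {D : Distr E M}
    (h : ∀ x, ∀ v ∈ D x, ∃ V : VField E M, V.IsSectionNear D x ∧ V x = v) : SectionSpanned D := by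
  intro x v hv
  obtain ⟨V, hV, rfl⟩ := h x v hv
  obtain ⟨Y, hY, hYD, e⟩ := hV.exists_global
  exact ⟨Y, hY, hYD, e.self_of_nhds⟩

end Sections

namespace SubRiemannian

variable {E : Type*} [NormedAddCommGroup E] [NormedSpace ℝ E] [FiniteDimensional ℝ E]
variable {M : Type*} [TopologicalSpace M] [ChartedSpace E M] [IsManifold 𝓘(ℝ, E) ∞ M] [T2Space M]
variable {S : SubRiemannian E M} {r : ℕ}

/-- The dimension formula determines the rank as dim H_m + dim H_k - dim H_{m-1}, so spanning by
sections is all that remains to be checked. -/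
theorem IsEquiregular.isSmoothSubbundle (hr : S.IsEquiregular r) {D : Distr E M}
    (hD : SectionSpanned D) {m k : ℕ} (hm : m ≤ r) (hk : k ≤ r)
    (hsup : ∀ x, D x ⊔ flag S.H (m - 1) x = flag S.H m x)
    (hinf : ∀ x, D x ⊓ flag S.H (m - 1) x = flag S.H k x) : IsSmoothSubbundle D := by
  obtain ⟨n, hn⟩ := hr.exists_rank hm
  obtain ⟨n', hn'⟩ := hr.exists_rank (i := m - 1) (by omega)
  obtain ⟨n'', hn''⟩ := hr.exists_rank hk
  refine hD.isSmoothSubbundle (n := n + n'' - n') fun y => ?_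
  have h := Submodule.finrank_sup_add_finrank_inf_eq (D y) (flag S.H (m - 1) y)
  rw [hsup, hinf, hn, hn', hn''] at h
  omega

/-- The selection that leads from the slice `D` at level `k` to the slice `D'` at level `k - 1`. -/
structure IsNext (S : SubRiemannian E M) (r k : ℕ) (D D' : ℕ → Distr E M) : Prop where
  slice : S.IsSlice r (k - 1) D'
  nested : ∀ m, k < m → m ≤ r → 3 ≤ m + (k - 1) → ∀ x, D' m x ≤ D m x
  min_A : ∀ m, k + 2 ≤ m → m ≤ r →
    ∀ (x : M) (d d' : ℕ) (φ : Fin d → OneForm E M) (e e' : Fin d' → TangentSpace 𝓘(ℝ, E) x),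
      S.IsCoframeGerm r k D x φ → S.IsFrameAt m x e → (∀ j, e j ∈ D' m x) →
      (∀ j, e' j ∈ D m x) → (∀ j, e' j - e j ∈ flag S.H (m - 1) x) →
      (∃ j, e' j - e j ∉ flag S.H (k - 1) x) →
      S.normSq x (S.matA x φ e) < S.normSq x (S.matA x φ e')
  min_S : 2 ≤ k →
    ∀ (x : M) (d : ℕ) (φ : Fin d → OneForm E M) (e e' : Fin d → TangentSpace 𝓘(ℝ, E) x),
      S.IsCoframeGerm r k D x φ →
      (∀ j, e j ∈ D' (k + 1) x) → (∀ i j, φ i x (e j) = if i = j then 1 else 0) →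
      (∀ j, e' j ∈ D (k + 1) x) → (∀ i j, φ i x (e' j) = if i = j then 1 else 0) →
      (∃ j, e' j - e j ∉ flag S.H (k - 1) x) →
      S.normSq x (S.matS x φ e) < S.normSq x (S.matS x φ e')

section Pointwise

variable {k m : ℕ} {D : ℕ → Distr E M} {x : M} {d : ℕ} {φ : Fin d → OneForm E M}

theorem matA_add_smul {d' : ℕ} (φ : Fin d → OneForm E M) (e f : Fin d' → TangentSpace 𝓘(ℝ, E) x)
    (t : ℝ) : S.matA x φ (e + t • f) = S.matA x φ e + t • S.matA x φ f := by
  ext1 i; ext1 j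
  simp only [matA_apply, Pi.add_apply, Pi.smul_apply, map_add, map_smul]

theorem matForm_matA {d' : ℕ} (φ : Fin d → OneForm E M) (e f : Fin d' → TangentSpace 𝓘(ℝ, E) x) :
    S.matForm x (S.matA x φ e) (S.matA x φ f) =
      ∑ j, ∑ i, S.g x (S.alpha (φ i) x (e j)) (S.alpha (φ i) x (f j)) :=
  Finset.sum_comm

theorem IsCoframeGerm.normSq_matA_lt (h : S.IsCoframeGerm r k D x φ) (hr : S.IsEquiregular r)
    (hJ : S.IsSemiJNondegenerate r) (hk : 1 ≤ k) (hkr : k + 1 ≤ r) {d' : ℕ}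
    {V : Submodule ℝ (TangentSpace 𝓘(ℝ, E) x)} {e e' : Fin d' → TangentSpace 𝓘(ℝ, E) x}
    (he : ∀ j, e j ∈ S.stepA k x φ V) (hsub : ∀ j, e' j - e j ∈ flag S.H k x)
    (hne : ∃ j, e' j - e j ∉ flag S.H (k - 1) x) :
    S.normSq x (S.matA x φ e) < S.normSq x (S.matA x φ e') := by
  have e1 : S.matA x φ e' = S.matA x φ e + S.matA x φ (e' - e) := by
    have := matA_add_smul (S := S) φ e (e' - e) 1
    simpa using this
  have h0 : S.matForm x (S.matA x φ e) (S.matA x φ (e' - e)) = 0 := by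
    rw [matForm_matA]
    exact Finset.sum_eq_zero fun j _ => (he j).2 _ (hsub j)
  rw [e1, normSq_add, h0]
  have h1 : S.normSq x (S.matA x φ (e' - e)) ≠ 0 := by
    intro h1
    obtain ⟨j, hj⟩ := hne
    exact hj (h.mem_of_alpha_eq_zero hr hJ hk hkr (hsub j) fun i => normSq_eq_zero h1 i j)
  have := lt_of_le_of_ne (normSq_nonneg _) h1.symm
  linarith

/-- The norm of 𝒜 is a sum over the columns, so varying the single entry `j` isolates the
orthogonality condition for `e j`. -/
theorem IsCoframeGerm.mem_stepA_of_min (h : S.IsCoframeGerm r k D x φ) (hk : 1 ≤ k) {d' : ℕ}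
    {V : Submodule ℝ (TangentSpace 𝓘(ℝ, E) x)} (hV : flag S.H k x ≤ V)
    {e : Fin d' → TangentSpace 𝓘(ℝ, E) x} (he : ∀ j, e j ∈ V)
    (hmin : ∀ e' : Fin d' → TangentSpace 𝓘(ℝ, E) x, (∀ j, e' j ∈ V) →
      (∀ j, e' j - e j ∈ flag S.H k x) → (∃ j, e' j - e j ∉ flag S.H (k - 1) x) →
      S.normSq x (S.matA x φ e) < S.normSq x (S.matA x φ e')) (j : Fin d') :
    e j ∈ S.stepA k x φ V := by
  refine ⟨he j, fun z hz => ?_⟩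
  by_cases hz0 : z ∈ flag S.H (k - 1) x
  · simp [fun i => h.alpha_eq_zero hk i hz0]
  · let f : Fin d' → TangentSpace 𝓘(ℝ, E) x := Pi.single j z
    have hf : ∀ l, f l ∈ flag S.H k x := fun l => by
      by_cases hl : l = j
      · subst hl; simpa [f] using hz
      · simp [f, Pi.single_eq_of_ne hl]
    have e1 : S.matForm x (S.matA x φ e) (S.matA x φ f) =
        ∑ i, S.g x (S.alpha (φ i) x (e j)) (S.alpha (φ i) x z) := by
      rw [matForm_matA, Finset.sum_eq_single j]
      · simp [f]
      · intro l _ hl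
        simp [f, Pi.single_eq_of_ne hl]
      · simp
    rw [← e1]
    refine eq_zero_of_forall_pos (c := S.normSq x (S.matA x φ f)) fun t ht0 => ?_
    have := hmin (e + t • f) (fun l => Submodule.add_mem _ (he l) (hV (Submodule.smul_mem _ _ (hf l))))
      (fun l => by simpa using Submodule.smul_mem _ t (hf l))
      ⟨j, fun hmem => hz0 (by simpa [f, Submodule.smul_mem_iff _ ht0] using hmem)⟩
    rw [matA_add_smul, normSq_add_smul] at this
    linarith

theorem IsFrameAt.of_sub_mem {e f : Fin d → TangentSpace 𝓘(ℝ, E) x} (hf : S.IsFrameAt m x f)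
    (he : ∀ j, e j ∈ flag S.H m x) (h : ∀ j, e j - f j ∈ flag S.H (m - 1) x) :
    S.IsFrameAt m x e := by
  refine ⟨he, ?_⟩
  have : (fun j => S.cls m x ⟨e j, he j⟩) = fun j => S.cls m x ⟨f j, hf.mem j⟩ :=
    funext fun j => (S.cls_eq_iff _ _).2 (h j)
  rw [this]
  exact hf.2

theorem IsFrameAt.exists_frame_in {f : Fin d → TangentSpace 𝓘(ℝ, E) x} (hf : S.IsFrameAt m x f)
    {V : Submodule ℝ (TangentSpace 𝓘(ℝ, E) x)} (hV : V ⊔ flag S.H (m - 1) x = flag S.H m x) :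
    ∃ e : Fin d → TangentSpace 𝓘(ℝ, E) x, (∀ j, e j ∈ V) ∧ S.IsFrameAt m x e ∧
      ∀ j, e j - f j ∈ flag S.H (m - 1) x := by
  have h : ∀ j, ∃ v ∈ V, v - f j ∈ flag S.H (m - 1) x := by
    intro j
    obtain ⟨v, hv, w, hw, e⟩ := Submodule.mem_sup.1 (hV.ge (hf.mem j))
    refine ⟨v, hv, ?_⟩
    rw [← e, sub_add_cancel_left]
    exact Submodule.neg_mem _ hw
  choose e he hef using h
  exact ⟨e, he, hf.of_sub_mem (fun j => (le_sup_left.trans hV.le) (he j)) hef, hef⟩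

theorem IsCoframeAt.exists_dual_in {ψ : Fin d → TangentSpace 𝓘(ℝ, E) x →L[ℝ] ℝ}
    (h : S.IsCoframeAt m x ψ) {V : Submodule ℝ (TangentSpace 𝓘(ℝ, E) x)}
    (hV : V ⊔ flag S.H (m - 1) x = flag S.H m x) :
    ∃ e : Fin d → TangentSpace 𝓘(ℝ, E) x, (∀ j, e j ∈ V) ∧
      ∀ i j, ψ i (e j) = if i = j then 1 else 0 := by
  obtain ⟨h0, f, hf, hd⟩ := h
  obtain ⟨e, he, -, hef⟩ := hf.exists_frame_in hV
  refine ⟨e, he, fun i j => ?_⟩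
  have := h0 i _ (hef j)
  rw [map_sub, sub_eq_zero] at this
  rw [this, hd]

theorem IsCoframeAt.span_sup {ψ : Fin d → TangentSpace 𝓘(ℝ, E) x →L[ℝ] ℝ}
    (h : S.IsCoframeAt m x ψ) {e : Fin d → TangentSpace 𝓘(ℝ, E) x} (he : ∀ j, e j ∈ flag S.H m x)
    (hd : ∀ i j, ψ i (e j) = if i = j then 1 else 0) {l : ℕ} (hl : l ≤ m - 1) :
    Submodule.span ℝ (Set.range e) ⊔ flag S.H l x ⊔ flag S.H (m - 1) x = flag S.H m x := by
  refine le_antisymm (sup_le (sup_le (Submodule.span_le.2 ?_) (flag_mono (by omega) x))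
    (flag_mono (by omega) x)) fun v hv => ?_
  · rintro _ ⟨j, rfl⟩; exact he j
  · have h1 : ∑ i, ψ i v • e i ∈ Submodule.span ℝ (Set.range e) ⊔ flag S.H l x :=
      Submodule.mem_sup_left (Submodule.sum_mem _ fun i _ =>
        Submodule.smul_mem _ _ (Submodule.subset_span ⟨i, rfl⟩))
    have := Submodule.add_mem_sup h1 (h.sub_mem he hd hv)
    rwa [add_sub_cancel] at this

theorem IsCoframeAt.span_inf {ψ : Fin d → TangentSpace 𝓘(ℝ, E) x →L[ℝ] ℝ}
    (h : S.IsCoframeAt m x ψ) {e : Fin d → TangentSpace 𝓘(ℝ, E) x}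
    (hd : ∀ i j, ψ i (e j) = if i = j then 1 else 0) {l : ℕ} (hl : l ≤ m - 1) :
    (Submodule.span ℝ (Set.range e) ⊔ flag S.H l x) ⊓ flag S.H (m - 1) x = flag S.H l x := by
  refine le_antisymm ?_ (le_inf le_sup_right (flag_mono hl x))
  rintro v ⟨hv, hvm⟩
  obtain ⟨u, hu, w, hw, rfl⟩ := Submodule.mem_sup.1 hv
  obtain ⟨c, rfl⟩ := (Submodule.mem_span_range_iff_exists_fun ℝ).1 hu
  have : c = 0 := funext fun i => by
    have h1 := h.1 i _ hvm
    rw [map_add, h.1 i w (flag_mono hl x hw), add_zero] at h1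
    simpa [hd] using h1
  simpa [this] using hw

/-- A dual row in the selected subspace differs from the transformed selected row by elements of
H_{k-1}, which do not change 𝒮. Minimality thus becomes a property of the subspace. -/
theorem IsSelected.of_mem_span (hD : S.IsSlice r k D) {c : Prop} {ρ : S.H x}
    {e : Fin d → TangentSpace 𝓘(ℝ, E) x} (hs : S.IsSelected k c x φ ρ e)
    (h : S.IsCoframeGerm r k D x φ) (hr : S.IsEquiregular r) (hk : 1 ≤ k) (hkr : k + 1 ≤ r)
    {d' : ℕ} {φ' : Fin d' → OneForm E M} (h' : S.IsCoframeGerm r k D x φ')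
    {e' : Fin d' → TangentSpace 𝓘(ℝ, E) x}
    (he' : ∀ j, e' j ∈ Submodule.span ℝ (Set.range e) ⊔ flag S.H (k - 1) x)
    (hd' : ∀ i j, φ' i x (e' j) = if i = j then 1 else 0) :
    S.IsSelected k c x φ' ρ e' := by
  obtain ⟨a, ha⟩ := h.exists_gauge hD hr hk hkr h'
  have hs' := hs.gauge h hk ha
  set f : Fin d' → TangentSpace 𝓘(ℝ, E) x := fun j => ∑ p, a j p x • e p with hf
  have hle : Submodule.span ℝ (Set.range e) ⊔ flag S.H (k - 1) x ≤ flag S.H (k + 1) x :=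
    sup_le (Submodule.span_le.2 (by rintro _ ⟨j, rfl⟩; exact hs.mem j)) (flag_mono (by omega) x)
  have hm : ∀ j, e' j ∈ flag S.H (k + 1) x := fun j => hle (he' j)
  have hsub : ∀ j, (e' - f) j ∈ flag S.H (k - 1) x := fun j => by
    have h1 := h'.sub_mem_flag hs'.mem hm hs'.dual hd' j
    have h2 := h.isCoframeAt.span_inf hs.dual (l := k - 1) (by omega)
    refine h2.le ⟨Submodule.sub_mem _ (he' j) (Submodule.mem_sup_left ?_), h1⟩
    exact Submodule.sum_mem _ fun p _ => Submodule.smul_mem _ _ (Submodule.subset_span ⟨p, rfl⟩)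
  have hSe : S.matS x φ' e' = S.matS x φ' f := by
    rw [← sub_eq_zero, ← matS_sub]
    ext1 i; ext1 j
    simp only [matS, matA_apply, h'.alpha_eq_zero hk _ (hsub _), add_zero, Pi.zero_apply]
  exact ⟨hm, hd', fun hc => by rw [hSe, hs'.trace hc], fun z hz hzt => by
    rw [hSe]; exact hs'.orth z hz hzt⟩

end Pointwise

section Next

variable {k m : ℕ} {D D' : ℕ → Distr E M}

/-- At m = k + 1 the intersection condition says that H_k is contained in `D (k + 1)`, so nothing is
left to choose. -/
theorem IsSlice.eq_flag (hD : S.IsSlice r k D) (hk : 1 ≤ k) (hkr : k + 1 ≤ r) (x : M) :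
    D (k + 1) x = flag S.H (k + 1) x := by
  have h1 := hD.sup_eq (k + 1) (by omega) (by omega) hkr (by omega) x
  have h2 := hD.inf_eq (k + 1) (by omega) (by omega) hkr (by omega) x
  rw [← h1, left_eq_sup]
  exact inf_eq_right.1 h2

theorem IsSlice.flag_le (hD : S.IsSlice r k D) (h2 : 2 ≤ m) (h3 : 3 ≤ m + k) (hm : m ≤ r)
    (hkm : k < m) (x : M) : flag S.H k x ≤ D m x :=
  (hD.inf_eq m h2 h3 hm hkm x).ge.trans inf_le_left

/-- The family of subspaces spanned by selected rows is smooth. -/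
theorem IsSlice.sectionSpanned_selected (hD : S.IsSlice r k D) (hr : S.IsEquiregular r)
    (hJ : S.IsSemiJNondegenerate r) (hk : 1 ≤ k) (hkr : k + 1 ≤ r) {c : Prop} (hc : c → k = 1)
    {ρ : ∀ y, S.H y} (hρ : c → ∀ (x : M) (X : VField E M), X.IsSectionNear S.H x →
      ∀ᶠ y in 𝓝 x, SmoothFnAt E (fun y => extForm S.g y (ρ y) (X y)) y)
    {d : M → ℕ} {φ : ∀ x, Fin (d x) → OneForm E M} {e : ∀ x, Fin (d x) → TangentSpace 𝓘(ℝ, E) x}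
    (hφ : ∀ x, S.IsCoframeGerm r k D x (φ x)) (he : ∀ x, S.IsSelected k c x (φ x) (ρ x) (e x)) :
    SectionSpanned (E := E) fun x => Submodule.span ℝ (Set.range (e x)) ⊔ flag S.H (k - 1) x := by
  refine sectionSpanned_of_near fun x v hv => ?_
  obtain ⟨d₀, φ₀, e₀, h₀, hs₀, hsel₀⟩ := hD.exists_selected hr hJ hk hkr (x := x) hc
    fun h => hρ h x
  -- The rows `e y` were chosen point by point without continuity; by independence of the coframe
  -- they span, together with H_{k-1}, the same subspaces as a smooth local choice.
  have key : ∀ᶠ y in 𝓝 x, Submodule.span ℝ (Set.range (e y)) ⊔ flag S.H (k - 1) y =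
      Submodule.span ℝ (Set.range fun j => e₀ j y) ⊔ flag S.H (k - 1) y := by
    filter_upwards [hsel₀, h₀.eventually] with y h1 h2
    exact IsSelected.span_eq hD (he y) h1 (hφ y) h2 hr hJ hk hkr
  change v ∈ Submodule.span ℝ (Set.range (e x)) ⊔ flag S.H (k - 1) x at hv
  rw [key.self_of_nhds] at hv
  obtain ⟨u, hu, w, hw, rfl⟩ := Submodule.mem_sup.1 hv
  obtain ⟨c, rfl⟩ := (Submodule.mem_span_range_iff_exists_fun ℝ).1 hu
  obtain ⟨Y, hY, rfl⟩ := (S.sectionSpanned_flag (k - 1)).exists_near hw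
  refine ⟨fun y => ∑ j, c j • e₀ j y + Y y, ?_, rfl⟩
  have h1 : VField.IsSectionNear (fun y => ∑ j, c j • e₀ j y) (flag S.H (k + 1)) x :=
    .sum fun j _ => (hs₀ j).const_smul _
  filter_upwards [key, h1, hY] with y h2 h3 h4
  refine ⟨h3.1.add h4.1, ?_⟩
  rw [h2]
  exact Submodule.add_mem_sup (Submodule.sum_mem _ fun j _ => Submodule.smul_mem _ _
    (Submodule.subset_span ⟨j, rfl⟩)) h4.2

theorem IsSlice.exists_next (hD : S.IsSlice r k D) (hr : S.IsEquiregular r)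
    (hJ : S.IsSemiJNondegenerate r) (hk : 1 ≤ k) (hkr : k + 1 ≤ r) :
    ∃ D', S.IsNext r k D D' := by
  have hsel : ∀ x, ∃ (d : ℕ) (φ : Fin d → OneForm E M) (e : Fin d → TangentSpace 𝓘(ℝ, E) x),
      S.IsCoframeGerm r k D x φ ∧ S.IsSelected k False x φ 0 e := by
    intro x
    obtain ⟨d, φ, e, h, -, hs⟩ := hD.exists_selected hr hJ hk hkr (x := x) (c := False)
      (fun h => h.elim) (ρ := fun _ => 0) (fun h => h.elim)
    exact ⟨d, φ, _, h, hs.self_of_nhds⟩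
  choose d φ e hφ he using hsel
  let D' : ℕ → Distr E M := fun m x => if m = k then flag S.H k x else if m = k + 1 then
    Submodule.span ℝ (Set.range (e x)) ⊔ flag S.H (k - 1) x else S.stepA k x (φ x) (D m x)
  have hk0 : D' k = flag S.H k := funext fun x => if_pos rfl
  have hk1 : D' (k + 1) = fun x => Submodule.span ℝ (Set.range (e x)) ⊔ flag S.H (k - 1) x :=
    funext fun x => by simp [D']
  have hk2 : ∀ m, k + 1 < m → D' m = fun x => S.stepA k x (φ x) (D m x) := fun m hm =>
    funext fun x => by simp [D', show m ≠ k by omega, show m ≠ k + 1 by omega]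
  have hsup : ∀ m, 2 ≤ m → m ≤ r → k - 1 < m → ∀ x,
      D' m x ⊔ flag S.H (m - 1) x = flag S.H m x := by
    intro m h2 hm hkm x
    rcases (show m = k ∨ m = k + 1 ∨ k + 1 < m by omega) with rfl | rfl | h
    · rw [hk0]; exact sup_eq_left.2 (flag_mono (by omega) x)
    · rw [hk1]; exact (hφ x).isCoframeAt.span_sup (he x).mem (he x).dual (by omega)
    · rw [hk2 m h]; exact (hφ x).stepA_sup hD hr hJ hk h hm
  have hinf : ∀ m, 2 ≤ m → m ≤ r → k - 1 < m → ∀ x,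
      D' m x ⊓ flag S.H (m - 1) x = flag S.H (k - 1) x := by
    intro m h2 hm hkm x
    rcases (show m = k ∨ m = k + 1 ∨ k + 1 < m by omega) with rfl | rfl | h
    · rw [hk0]; exact inf_eq_right.2 (flag_mono (by omega) x)
    · rw [hk1]; exact (hφ x).isCoframeAt.span_inf (he x).dual (by omega)
    · rw [hk2 m h]; exact (hφ x).stepA_inf hD hr hJ hk h hm
  have hspan : ∀ m, 2 ≤ m → m ≤ r → k - 1 < m → SectionSpanned (D' m) := by
    intro m h2 hm hkm
    rcases (show m = k ∨ m = k + 1 ∨ k + 1 < m by omega) with rfl | rfl | h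
    · rw [hk0]; exact S.sectionSpanned_flag m
    · rw [hk1]
      exact hD.sectionSpanned_selected hr hJ hk hkr (c := False) (fun h => h.elim)
        (ρ := fun _ => 0) (fun h => h.elim) hφ he
    · rw [hk2 m h]
      refine sectionSpanned_of_near fun x v hv => ?_
      obtain ⟨V, hV, hVx⟩ := (hφ x).stepA_extend hD hr hJ hk h hm hv
      refine ⟨V, ?_, hVx⟩
      filter_upwards [hV, (hφ x).eventually] with y h1 h3
      refine ⟨h1.1, ?_⟩
      rw [stepA_eq_of_gauge hD hr hk h hm h3 (hφ y)]
      exact h1.2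
  refine ⟨D', ⟨⟨fun m h2 _ hm hkm => ?_, fun m h2 _ => hsup m h2, fun m h2 _ => hinf m h2⟩,
    fun m hkm hm h3 x => ?_, ?_, ?_⟩⟩
  · exact hr.isSmoothSubbundle (hspan m h2 hm hkm) hm (by omega) (hsup m h2 hm hkm)
      (hinf m h2 hm hkm)
  · rcases (show m = k + 1 ∨ k + 1 < m by omega) with rfl | h
    · rw [hD.eq_flag hk hkr]
      exact le_sup_left.trans (hsup _ (by omega) hm (by omega) x).le
    · rw [hk2 m h]; exact stepA_le ..
  · intro m hkm hm x d d' ψ e e' hψ hf hem he'm hsub hne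
    have hem' : ∀ j, e j ∈ S.stepA k x ψ (D m x) := fun j => by
      rw [stepA_eq_of_gauge hD hr hk (by omega) hm (hφ x) hψ]
      have := hem j
      rwa [hk2 m (by omega)] at this
    refine hψ.normSq_matA_lt hr hJ hk hkr hem' (fun j => ?_) hne
    rw [← hD.inf_eq m (by omega) (by omega) hm (by omega)]
    exact ⟨Submodule.sub_mem _ (he'm j) (hem' j).1, hsub j⟩
  · intro _ x d ψ f f' hψ hf hd hf' hd' hne
    have hs : S.IsSelected k False x ψ 0 f := (he x).of_mem_span hD (hφ x) hr hk hkr hψ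
      (fun j => by have := hf j; rwa [hk1] at this) hd
    refine hs.normSq_lt hψ hr hJ hk hkr (fun j => ?_) hd' (fun h => h.elim) hne
    rw [← hD.eq_flag hk hkr]
    exact hf' j

/-- Minimality puts a frame of `D' m x`, and with it the whole subspace, into `stepA`. Both have the
same sum and intersection with H_{m-1}, so the inclusion is an equality by modularity. -/
theorem IsNext.eq_stepA (h : S.IsNext r k D D') (hD : S.IsSlice r k D) (hr : S.IsEquiregular r)
    (hJ : S.IsSemiJNondegenerate r) (hk : 1 ≤ k) (hkm : k + 2 ≤ m) (hmr : m ≤ r) {x : M} {d : ℕ}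
    {φ : Fin d → OneForm E M} (hφ : S.IsCoframeGerm r k D x φ) :
    D' m x = S.stepA k x φ (D m x) := by
  have hsup := h.slice.sup_eq m (by omega) (by omega) hmr (by omega) x
  have hinf := h.slice.inf_eq m (by omega) (by omega) hmr (by omega) x
  obtain ⟨n, F, hF, hFo⟩ := hr.exists_frame (m := m) (by omega) hmr x
  obtain ⟨e, he, hef, -⟩ := hFo.self_of_nhds.exists_frame_in hsup
  have hnest := h.nested m (by omega) hmr (by omega) x
  have heA : ∀ j, e j ∈ S.stepA k x φ (D m x) := hφ.mem_stepA_of_min hk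
    (hD.flag_le (by omega) (by omega) hmr (by omega) x) (fun j => hnest (he j))
    fun e' he' hsub hne => h.min_A m hkm hmr x _ _ φ e e' hφ hef he he'
      (fun j => flag_mono (show k ≤ m - 1 by omega) x (hsub j)) hne
  have hle : D' m x ≤ S.stepA k x φ (D m x) := by
    intro v hv
    obtain ⟨c, hc⟩ := hef.exists_sub_mem (hsup.le (Submodule.mem_sup_left hv))
    have h1 : v - ∑ j, c j • e j ∈ flag S.H (k - 1) x := hinf ▸
      ⟨Submodule.sub_mem _ hv (Submodule.sum_mem _ fun j _ => Submodule.smul_mem _ _ (he j)), hc⟩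
    have h2 := ((hφ.stepA_inf hD hr hJ hk (by omega) hmr).ge h1).1
    have := Submodule.add_mem _ h2 (Submodule.sum_mem _ fun j (_ : j ∈ Finset.univ) =>
      Submodule.smul_mem _ (c j) (heA j))
    rwa [sub_add_cancel] at this
  refine eq_of_le_of_inf_le_of_sup_le (z := flag S.H (m - 1) x) hle ?_ ?_
  · exact ((hφ.stepA_inf hD hr hJ hk (by omega) hmr).trans hinf.symm).le
  · exact ((hφ.stepA_sup hD hr hJ hk (by omega) hmr).trans hsup.symm).le

/-- A selected row inside `T` agrees modulo H_{k-1} with `e`, so `e` lies in `T` too; the sum and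
intersection conditions leave no room for more. -/
theorem eq_span_of_selected {x : M} {d : ℕ} {φ : Fin d → OneForm E M}
    (hφ : S.IsCoframeGerm r k D x φ) (hr : S.IsEquiregular r)
    (hJ : S.IsSemiJNondegenerate r) (hk : 1 ≤ k) (hkr : k + 1 ≤ r) {c : Prop} {ρ : S.H x}
    {T : Submodule ℝ (TangentSpace 𝓘(ℝ, E) x)} (hsup : T ⊔ flag S.H k x = flag S.H (k + 1) x)
    (hinf : T ⊓ flag S.H k x = flag S.H (k - 1) x) {e f : Fin d → TangentSpace 𝓘(ℝ, E) x}
    (he : S.IsSelected k c x φ ρ e) (hf : S.IsSelected k c x φ ρ f) (hfT : ∀ j, f j ∈ T) :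
    T = Submodule.span ℝ (Set.range e) ⊔ flag S.H (k - 1) x := by
  have hsub := he.sub_mem hf hφ hr hJ hk hkr
  have hle : flag S.H (k - 1) x ≤ T := hinf ▸ inf_le_left
  have heT : ∀ j, e j ∈ T := fun j => by
    have := Submodule.sub_mem _ (hfT j) (hle (hsub j))
    rwa [sub_sub_cancel] at this
  refine le_antisymm (fun v hv => ?_) (sup_le (Submodule.span_le.2 ?_) hle)
  · have h1 := hφ.isCoframeAt.sub_mem he.mem he.dual (hsup.le (Submodule.mem_sup_left hv))
    have h2 : v - ∑ i, φ i x v • e i ∈ flag S.H (k - 1) x := hinf ▸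
      ⟨Submodule.sub_mem _ hv (Submodule.sum_mem _ fun j _ => Submodule.smul_mem _ _ (heT j)), h1⟩
    have h3 : ∑ i, φ i x v • e i ∈ Submodule.span ℝ (Set.range e) :=
      Submodule.sum_mem _ fun j _ => Submodule.smul_mem _ _ (Submodule.subset_span ⟨j, rfl⟩)
    have := Submodule.add_mem_sup h3 h2
    rwa [add_sub_cancel] at this
  · rintro _ ⟨j, rfl⟩
    exact heT j

theorem IsNext.eq_span (h : S.IsNext r k D D') (hD : S.IsSlice r k D) (hr : S.IsEquiregular r)
    (hJ : S.IsSemiJNondegenerate r) (hk : 2 ≤ k) (hkr : k + 1 ≤ r) {x : M} {d : ℕ}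
    {φ : Fin d → OneForm E M} (hφ : S.IsCoframeGerm r k D x φ)
    {e : Fin d → TangentSpace 𝓘(ℝ, E) x} (he : S.IsSelected k False x φ 0 e) :
    D' (k + 1) x = Submodule.span ℝ (Set.range e) ⊔ flag S.H (k - 1) x := by
  have hsup := h.slice.sup_eq (k + 1) (by omega) (by omega) hkr (by omega) x
  have hinf := h.slice.inf_eq (k + 1) (by omega) (by omega) hkr (by omega) x
  obtain ⟨f, hf, hd⟩ := hφ.isCoframeAt.exists_dual_in hsup
  refine eq_span_of_selected hφ hr hJ (by omega) hkr hsup hinf he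
    (hφ.isSelected_of_min (by omega) (fun j => hsup.le (Submodule.mem_sup_left (hf j))) hd
      (fun h => h.elim) fun e' he' hd' _ hne => ?_) hf
  exact h.min_S hk x d φ f e' hφ hf hd (fun j => by rw [hD.eq_flag (by omega) hkr]; exact he' j)
    hd' hne

/-- A selection is determined by the previous slice. -/
theorem IsNext.unique {D'' : ℕ → Distr E M} (h : S.IsNext r k D D') (h' : S.IsNext r k D D'')
    (hD : S.IsSlice r k D) (hr : S.IsEquiregular r) (hJ : S.IsSemiJNondegenerate r) (hk : 1 ≤ k)
    (hkr : k + 1 ≤ r) (h2 : 2 ≤ m) (h3 : 3 ≤ m + (k - 1)) (hmr : m ≤ r) (hkm : k - 1 < m) :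
    D' m = D'' m := by
  funext x
  obtain ⟨d, φ, e, hφ, -, he⟩ := hD.exists_selected hr hJ hk hkr (x := x) (c := False)
    (fun h => h.elim) (ρ := fun _ => 0) (fun h => h.elim)
  rcases (show m = k ∨ m = k + 1 ∨ k + 2 ≤ m by omega) with rfl | rfl | hm
  · obtain ⟨l, rfl⟩ := Nat.exists_eq_add_of_le' hk
    exact (h.slice.eq_flag (by omega) hmr x).trans (h'.slice.eq_flag (by omega) hmr x).symm
  · rw [h.eq_span hD hr hJ (by omega) hkr hφ he.self_of_nhds,
      h'.eq_span hD hr hJ (by omega) hkr hφ he.self_of_nhds]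
  · rw [h.eq_stepA hD hr hJ hk hm hmr hφ, h'.eq_stepA hD hr hJ hk hm hmr hφ]

end Next

end SubRiemannian

/-! ### Runs without the last selection -/

namespace SubRiemannian

variable {E : Type*} [NormedAddCommGroup E] [NormedSpace ℝ E] [FiniteDimensional ℝ E]
variable {M : Type*} [TopologicalSpace M] [ChartedSpace E M] [IsManifold 𝓘(ℝ, E) ∞ M] [T2Space M]
variable {S : SubRiemannian E M} {r : ℕ}

section Congr

variable {k : ℕ} {D D₁ D' D₁' : ℕ → Distr E M}

theorem IsCoframeGerm.congr {x : M} {d : ℕ} {φ : Fin d → OneForm E M}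
    (h : S.IsCoframeGerm r k D x φ) (hD : ∀ m, k + 1 < m → m ≤ r → D₁ m = D m) :
    S.IsCoframeGerm r k D₁ x φ := by
  have : S.adaptedKer r k D₁ = S.adaptedKer r k D := by
    funext y
    unfold adaptedKer
    congr 1
    refine Finset.sup_congr rfl fun j hj => ?_
    rw [Finset.mem_Ioc] at hj
    rw [hD j hj.1 hj.2]
  unfold IsCoframeGerm
  rw [this]
  exact h

theorem IsSlice.congr (h : S.IsSlice r k D)
    (hD : ∀ m, 2 ≤ m → 3 ≤ m + k → m ≤ r → k < m → D₁ m = D m) : S.IsSlice r k D₁ := by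
  constructor
  · intro m h2 h3 hm hk
    rw [hD m h2 h3 hm hk]; exact h.smooth m h2 h3 hm hk
  · intro m h2 h3 hm hk
    rw [hD m h2 h3 hm hk]; exact h.sup_eq m h2 h3 hm hk
  · intro m h2 h3 hm hk
    rw [hD m h2 h3 hm hk]; exact h.inf_eq m h2 h3 hm hk

theorem IsNext.congr (h : S.IsNext r k D D') (hk : 1 ≤ k) (hkr : k + 1 ≤ r)
    (hD : ∀ m, k < m → m ≤ r → D₁ m = D m)
    (hD' : ∀ m, 2 ≤ m → 3 ≤ m + (k - 1) → m ≤ r → k - 1 < m → D₁' m = D' m) :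
    S.IsNext r k D₁ D₁' := by
  have hg : ∀ {x : M} {d : ℕ} {φ : Fin d → OneForm E M}, S.IsCoframeGerm r k D₁ x φ →
      S.IsCoframeGerm r k D x φ := fun h => h.congr fun m h1 h2 => (hD m (by omega) h2).symm
  refine ⟨h.slice.congr hD', fun m hkm hm h3 x => ?_, fun m hkm hm x d d' φ e e' hφ hf he he' => ?_,
    fun hk2 x d φ e e' hφ he hd he' => ?_⟩
  · rw [hD m hkm hm, hD' m (by omega) h3 hm (by omega)]
    exact h.nested m hkm hm h3 x
  · rw [hD' m (by omega) (by omega) hm (by omega)] at he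
    rw [hD m (by omega) hm] at he'
    exact h.min_A m hkm hm x d d' φ e e' (hg hφ) hf he he'
  · rw [hD' (k + 1) (by omega) (by omega) hkr (by omega)] at he
    rw [hD (k + 1) (by omega) hkr] at he'
    exact h.min_S hk2 x d φ e e' (hg hφ) he hd he'

end Congr

/-- All the selections of a run of the algorithm except the last one. -/
structure IsPartialRun (S : SubRiemannian E M) (r : ℕ) (W : ℕ → ℕ → Distr E M) : Prop where
  slice : ∀ k, k + 1 ≤ r → S.IsSlice r k fun m => W m k
  next : ∀ k, 1 ≤ k → k + 1 ≤ r → S.IsNext r k (fun m => W m k) fun m => W m (k - 1)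

theorem IsEquiregular.isSlice_flag (hr : S.IsEquiregular r) : S.IsSlice r (r - 1) (flag S.H) := by
  have hmr : ∀ {m}, m ≤ r → r - 1 < m → m = r := fun h1 h2 => by omega
  refine ⟨fun m h2 _ hm hk => ?_, fun m h2 _ hm hk x => sup_eq_left.2 (flag_mono (by omega) x),
    fun m h2 _ hm hk x => ?_⟩
  · exact hr.isSmoothSubbundle (k := m - 1) (S.sectionSpanned_flag m) hm (by omega)
      (fun x => sup_eq_left.2 (flag_mono (by omega) x))
      (fun x => inf_eq_right.2 (flag_mono (by omega) x))
  · rw [hmr hm hk]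
    exact inf_eq_right.2 (flag_mono (by omega) x)

theorem IsEquiregular.exists_isPartialRun (hr : S.IsEquiregular r)
    (hJ : S.IsSemiJNondegenerate r) : ∃ W, S.IsPartialRun r W := by
  classical
  -- The value `D` where no successor exists is a default that is never reached. Below, `chain n` is
  -- the slice at level r - 1 - n, so that descending levels become an ordinary recursion.
  let nxt : ℕ → (ℕ → Distr E M) → ℕ → Distr E M := fun k D =>
    if h : ∃ D', S.IsNext r k D D' then h.choose else D
  let chain : ℕ → ℕ → Distr E M := fun n => Nat.rec (flag S.H) (fun n D => nxt (r - 1 - n) D) n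
  have hsucc : ∀ n, chain (n + 1) = nxt (r - 1 - n) (chain n) := fun n => rfl
  have h1 := hr.one_le
  have hn : ∀ n, S.IsSlice r (r - 1 - n) (chain n) → n + 1 ≤ r - 1 →
      S.IsNext r (r - 1 - n) (chain n) (chain (n + 1)) := by
    intro n hs hn
    have hex := hs.exists_next hr hJ (by omega) (by omega)
    rw [hsucc]
    simp only [nxt, dif_pos hex]
    exact hex.choose_spec
  have hslice : ∀ n, n ≤ r - 1 → S.IsSlice r (r - 1 - n) (chain n) := by
    intro n
    induction n with
    | zero => exact fun _ => hr.isSlice_flag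
    | succ n ih =>
      intro hle
      have := (hn n (ih (by omega)) hle).slice
      rwa [show r - 1 - n - 1 = r - 1 - (n + 1) by omega] at this
  refine ⟨fun m k => chain (r - 1 - k) m, fun k hk => ?_, fun k hk hkr => ?_⟩
  · have := hslice (r - 1 - k) (by omega)
    rwa [show r - 1 - (r - 1 - k) = k by omega] at this
  · have := hn (r - 1 - k) (hslice _ (by omega)) (by omega)
    rwa [show r - 1 - (r - 1 - k) = k by omega,
      show r - 1 - k + 1 = r - 1 - (k - 1) by omega] at this

theorem IsPartialRun.congr {W W' : ℕ → ℕ → Distr E M} (h : S.IsPartialRun r W)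
    (hW : ∀ m k, 2 ≤ m → 3 ≤ m + k → m ≤ r → k < m → W' m k = W m k) : S.IsPartialRun r W' :=
  ⟨fun k hk => (h.slice k hk).congr fun m h2 h3 hm hkm => hW m k h2 h3 hm hkm,
    fun k hk hkr => (h.next k hk hkr).congr hk hkr
      (fun m hkm hm => hW m k (by omega) (by omega) hm hkm)
      fun m h2 h3 hm hkm => hW m (k - 1) h2 h3 hm hkm⟩

theorem IsPartialRun.unique {W W' : ℕ → ℕ → Distr E M} (h : S.IsPartialRun r W)
    (h' : S.IsPartialRun r W') (hr : S.IsEquiregular r) (hJ : S.IsSemiJNondegenerate r) {m k : ℕ}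
    (h2 : 2 ≤ m) (h3 : 3 ≤ m + k) (hm : m ≤ r) (hk : k < m) : W' m k = W m k := by
  have key : ∀ n, n + 1 ≤ r → ∀ m, 2 ≤ m → 3 ≤ m + (r - 1 - n) → m ≤ r → r - 1 - n < m →
      W' m (r - 1 - n) = W m (r - 1 - n) := by
    intro n
    induction n with
    | zero =>
      intro hn m h2 h3 hm hk
      obtain rfl : m = r - 1 + 1 := by omega
      funext x
      have e1 := (h.slice (r - 1) (by omega))
      have e2 := (h'.slice (r - 1) (by omega))
      have s1 := e1.sup_eq (r - 1 + 1) (by omega) (by omega) hm (by omega) x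
      have s2 := e2.sup_eq (r - 1 + 1) (by omega) (by omega) hm (by omega) x
      have i1 := e1.inf_eq (r - 1 + 1) (by omega) (by omega) hm (by omega) x
      have i2 := e2.inf_eq (r - 1 + 1) (by omega) (by omega) hm (by omega) x
      simp only [Nat.add_sub_cancel, Nat.sub_zero] at *
      rw [sup_eq_left.2 (inf_eq_right.1 i1)] at s1
      rw [sup_eq_left.2 (inf_eq_right.1 i2)] at s2
      rw [s1, s2]
    | succ n ih =>
      intro hn m h2 h3 hm hk
      have e : r - 1 - (n + 1) = r - 1 - n - 1 := by omega
      rw [e] at h3 hk ⊢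
      -- By induction both runs have the same slice one level up, so the step of `W'` can be read as
      -- a step starting from the slice of `W`.
      have hn1 := (h'.next (r - 1 - n) (by omega) (by omega)).congr (by omega) (by omega)
        (D₁ := fun m => W m (r - 1 - n)) (D₁' := fun m => W' m (r - 1 - n - 1))
        (fun m hkm hm => (ih (by omega) m (by omega) (by omega) hm hkm).symm)
        fun m _ _ _ _ => rfl
      exact hn1.unique (h.next (r - 1 - n) (by omega) (by omega)) (h.slice _ (by omega)) hr hJ
        (by omega) (by omega) h2 h3 hm hk
  have := key (r - 1 - k) (by omega) m h2
  rw [show r - 1 - (r - 1 - k) = k by omega] at this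
  exact this h3 hm hk

/-! ### The trace term R -/

section TraceSum

variable {W : ℕ → ℕ → Distr E M} {x : M}

/-- The rows `e m` span `W m 0` and are dual to adapted coframe fields `φ m`, for `3 ≤ m ≤ r`. -/
def IsDualFamily (S : SubRiemannian E M) (r : ℕ) (W : ℕ → ℕ → Distr E M) (x : M) {d : ℕ → ℕ}
    (φ : (m : ℕ) → Fin (d m) → OneForm E M)
    (e : (m : ℕ) → Fin (d m) → TangentSpace 𝓘(ℝ, E) x) : Prop :=
  ∀ m, 3 ≤ m → m ≤ r → S.IsCoframeGerm r (m - 1) (fun j => W j (m - 1)) x (φ m) ∧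
    (∀ j, e m j ∈ W m 0 x) ∧ ∀ i j, φ m i x (e m j) = if i = j then 1 else 0

/-- `R` is the sum of the traces of `𝒮`, for `m ≥ 3`. -/
def IsTraceSum (S : SubRiemannian E M) (r : ℕ) (W : ℕ → ℕ → Distr E M) (x : M) (R : S.H x) : Prop :=
  ∃ (d : ℕ → ℕ) (φ : (m : ℕ) → Fin (d m) → OneForm E M)
    (e : (m : ℕ) → Fin (d m) → TangentSpace 𝓘(ℝ, E) x), S.IsDualFamily r W x φ e ∧
      R = ∑ m ∈ Finset.Icc 3 r, S.tr x (S.matS x (φ m) (e m))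

/-- Each summand is independent of coframe and dual row, because `W m 0` is transversal to H_{m-1}.
-/
theorem IsTraceSum.unique (hW : S.IsPartialRun r W) (hr : S.IsEquiregular r) {R R' : S.H x}
    (h : S.IsTraceSum r W x R) (h' : S.IsTraceSum r W x R') : R = R' := by
  obtain ⟨d, φ, e, hd, rfl⟩ := h
  obtain ⟨d', φ', e', hd', rfl⟩ := h'
  refine Finset.sum_congr rfl fun m hm => ?_
  rw [Finset.mem_Icc] at hm
  obtain ⟨h1, h2, h3⟩ := hd m hm.1 hm.2
  obtain ⟨h1', h2', h3'⟩ := hd' m hm.1 hm.2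
  obtain ⟨k, rfl⟩ : ∃ k, m = k + 1 := ⟨m - 1, by omega⟩
  have h0 := hW.slice 0 (by omega)
  have hsup := h0.sup_eq (k + 1) (by omega) (by omega) hm.2 (by omega) x
  have hinf := h0.inf_eq (k + 1) (by omega) (by omega) hm.2 (by omega) x
  exact IsCoframeGerm.tr_matS_eq (hW.slice k hm.2) h1' h1 hr (by omega) hm.2
    (le_sup_left.trans hsup.le) hinf h2' h2 h3' h3

/-- Near each point there are smooth rows in `D` dual to a given coframe field. -/
theorem IsCoframeGerm.exists_dual_sections {k : ℕ} {D : ℕ → Distr E M} {d : ℕ}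
    {φ : Fin d → OneForm E M} (h : S.IsCoframeGerm r k D x φ) {V : Distr E M}
    (hV : SectionSpanned V) (hsup : V x ⊔ flag S.H k x = flag S.H (k + 1) x) :
    ∃ e : Fin d → VField E M, (∀ j, (e j).IsSectionNear V x) ∧
      ∀ᶠ y in 𝓝 x, ∀ i j, φ i y (e j y) = if i = j then 1 else 0 := by
  obtain ⟨v, hv, hd⟩ := h.isCoframeAt.exists_dual_in hsup
  choose Y hY hYv using fun j => hV.exists_near (hv j)
  -- Extending a dual row from `x` spoils duality nearby; the inverse of the pairing matrix, which
  -- is the identity at `x`, restores it.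
  let A : M → Matrix (Fin d) (Fin d) ℝ := fun y => Matrix.of fun i j => φ i y (Y j y)
  have hAs : ∀ᶠ y in 𝓝 x, ∀ i j, SmoothFnAt E (fun y => A y i j) y := by
    filter_upwards [h, Filter.eventually_all.2 hY] with y h1 h2 i j
    exact (h1.1 i).apply (h2 j).1
  have hAx : A x = 1 := by
    ext i j
    simp only [A, Matrix.of_apply, hYv, hd, Matrix.one_apply]
  have hdet : ∀ᶠ y in 𝓝 x, (A y).det ≠ 0 := by
    refine (SmoothFnAt.det hAs.self_of_nhds).continuousAt.eventually_ne ?_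
    rw [hAx, Matrix.det_one]
    exact one_ne_zero
  refine ⟨fun j y => ∑ l, (A y)⁻¹ l j • Y l y, fun j => .sum fun l _ => (hY l).smul ?_, ?_⟩
  · filter_upwards [hAs, hdet] with y h1 h2 using SmoothFnAt.matrix_inv h1 h2 l j
  · filter_upwards [hdet] with y hy i j
    have := congrFun (congrFun (Matrix.mul_nonsing_inv _ (isUnit_iff_ne_zero.2 hy)) i) j
    rw [Matrix.mul_apply, Matrix.one_apply] at this
    rw [← this]
    simp [A, mul_comm]

theorem IsPartialRun.exists_dual_sections (hW : S.IsPartialRun r W) (hr : S.IsEquiregular r)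
    (x : M) : ∃ (d : ℕ → ℕ) (φ : (m : ℕ) → Fin (d m) → OneForm E M)
      (e : (m : ℕ) → Fin (d m) → VField E M), (∀ m, 3 ≤ m → m ≤ r →
        S.IsCoframeGerm r (m - 1) (fun j => W j (m - 1)) x (φ m)) ∧
      ∀ m, 3 ≤ m → m ≤ r → (∀ j, (e m j).IsSectionNear (W m 0) x) ∧
        ∀ᶠ y in 𝓝 x, ∀ i j, φ m i y (e m j y) = if i = j then 1 else 0 := by
  have key : ∀ m, ∃ (d : ℕ) (φ : Fin d → OneForm E M) (e : Fin d → VField E M),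
      3 ≤ m → m ≤ r → S.IsCoframeGerm r (m - 1) (fun j => W j (m - 1)) x φ ∧
        (∀ j, (e j).IsSectionNear (W m 0) x) ∧
        ∀ᶠ y in 𝓝 x, ∀ i j, φ i y (e j y) = if i = j then 1 else 0 := by
    intro m
    by_cases hm : 3 ≤ m ∧ m ≤ r
    · obtain ⟨h3, hmr⟩ := hm
      obtain ⟨k, rfl⟩ : ∃ k, m = k + 1 := ⟨m - 1, by omega⟩
      obtain ⟨d, φ, -, h, -⟩ := (hW.slice k hmr).exists_coframe hr (by omega) hmr x
      have h0 := hW.slice 0 (by omega)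
      obtain ⟨e, he, hd⟩ := h.exists_dual_sections
        (h0.smooth (k + 1) (by omega) (by omega) hmr (by omega)).sectionSpanned
        (h0.sup_eq (k + 1) (by omega) (by omega) hmr (by omega) x)
      exact ⟨d, φ, e, fun _ _ => ⟨h, he, hd⟩⟩
    -- Empty families as default values for the irrelevant indices.
    · exact ⟨0, fun i => i.elim0, fun i => i.elim0, fun h3 hmr => (hm ⟨h3, hmr⟩).elim⟩
  choose d φ e h using key
  exact ⟨d, φ, e, fun m h3 hm => (h m h3 hm).1, fun m h3 hm => (h m h3 hm).2⟩

theorem IsPartialRun.exists_isTraceSum (hW : S.IsPartialRun r W) (hr : S.IsEquiregular r) (x : M) :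
    ∃ R : S.H x, S.IsTraceSum r W x R := by
  obtain ⟨d, φ, e, h1, h2⟩ := hW.exists_dual_sections hr x
  exact ⟨_, d, φ, fun m j => e m j x, fun m h3 hm => ⟨h1 m h3 hm,
    fun j => ((h2 m h3 hm).1 j).mem, (h2 m h3 hm).2.self_of_nhds⟩, rfl⟩

/-- By uniqueness, near `x` the sum may be computed with one fixed choice of smooth coframes and
dual sections, where it is smooth. -/
theorem IsPartialRun.smooth_traceSum (hW : S.IsPartialRun r W) (hr : S.IsEquiregular r)
    {R : ∀ y, S.H y} (hR : ∀ y, S.IsTraceSum r W y (R y)) (x : M) {X : VField E M}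
    (hX : X.IsSectionNear S.H x) :
    ∀ᶠ y in 𝓝 x, SmoothFnAt E (fun y => extForm S.g y (R y) (X y)) y := by
  obtain ⟨d, φ, e, h1, h2⟩ := hW.exists_dual_sections hr x
  have hev : ∀ᶠ y in 𝓝 x, R y =
      ∑ m ∈ Finset.Icc 3 r, S.tr y (S.matS y (φ m) fun j => e m j y) := by
    have h3 : ∀ᶠ y in 𝓝 x, ∀ m ∈ Finset.Icc 3 r,
        S.IsCoframeGerm r (m - 1) (fun j => W j (m - 1)) y (φ m) ∧
          (∀ j, e m j y ∈ W m 0 y) ∧ ∀ i j, φ m i y (e m j y) = if i = j then 1 else 0 := by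
      refine (Filter.eventually_all_finset _).2 fun m hm => ?_
      rw [Finset.mem_Icc] at hm
      obtain ⟨h4, h5⟩ := h2 m hm.1 hm.2
      filter_upwards [(h1 m hm.1 hm.2).eventually, Filter.eventually_all.2 h4, h5] with y a b c
      exact ⟨a, fun j => (b j).2, c⟩
    filter_upwards [h3] with y hy
    exact (hR y).unique hW hr ⟨d, φ, fun m j => e m j y, fun m h3 hm =>
      hy m (Finset.mem_Icc.2 ⟨h3, hm⟩), rfl⟩
  have hs : ∀ᶠ y in 𝓝 x, ∀ m ∈ Finset.Icc 3 r, SmoothFnAt E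
      (fun y => extForm S.g y (S.tr y (S.matS y (φ m) fun j => e m j y)) (X y)) y := by
    refine (Filter.eventually_all_finset _).2 fun m hm => ?_
    rw [Finset.mem_Icc] at hm
    obtain ⟨h4, h5⟩ := h2 m hm.1 hm.2
    refine smooth_g_tr (fun i j => (h1 m hm.1 hm.2).pairedNear (by omega) i
      (Filter.Eventually.mono (h4 j) fun _ h => h.1) (h5.mono fun y hy => hy i j)) hX
  filter_upwards [hs, eventually_eventually_nhds.2 hev, eventually_eventually_nhds.2 hX]
    with y h3 h4 h5
  refine SmoothFnAt.congr (SmoothFnAt.sum h3) ?_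
  filter_upwards [h4, h5] with z h6 h7
  rw [extForm_apply (SetLike.coe_mem _) h7.2, h6]
  simp only [Subtype.coe_eta, map_sum, LinearMap.sum_apply]
  exact Finset.sum_congr rfl fun m _ => by rw [extForm_apply (SetLike.coe_mem _) h7.2]

end TraceSum

end SubRiemannian

/-! ### The last selection; existence and uniqueness of the run -/

namespace SubRiemannian

variable {E : Type*} [NormedAddCommGroup E] [NormedSpace ℝ E] [FiniteDimensional ℝ E]
variable {M : Type*} [TopologicalSpace M] [ChartedSpace E M] [IsManifold 𝓘(ℝ, E) ∞ M] [T2Space M]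
variable {S : SubRiemannian E M} {r : ℕ} {W W' : ℕ → ℕ → Distr E M}

theorem IsMinimalRigidRun.isPartialRun (h : S.IsMinimalRigidRun r W) : S.IsPartialRun r W := by
  refine ⟨fun k _ => ⟨fun m h2 _ hm hk => h.smooth m k h2 hm hk,
    fun m h2 _ hm hk => h.sup_eq m k h2 hm hk, fun m h2 _ hm hk => h.inf_eq m k h2 hm hk⟩,
    fun k hk hkr => ⟨⟨fun m h2 _ hm hk => h.smooth m _ h2 hm hk,
    fun m h2 _ hm hk => h.sup_eq m _ h2 hm hk, fun m h2 _ hm hk => h.inf_eq m _ h2 hm hk⟩,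
    fun m hkm hm _ => h.nested m k (by omega) hm hk hkm, ?_, ?_⟩⟩
  · intro m hkm hm x d d' φ e e' hφ
    exact h.min_A m k hk hkm hm x d d' φ e e' (isAdaptedCoframe_iff.2 hφ)
  · intro hk2 x d φ e e' hφ
    exact h.min_S k hk2 hkr x d φ e e' (isAdaptedCoframe_iff.2 hφ)

/-- A partial run is completed by the last selection. -/
theorem IsPartialRun.isMinimalRigidRun (hW : S.IsPartialRun r W) (hr : S.IsEquiregular r)
    (hJ : S.IsSemiJNondegenerate r) (hs : 2 ≤ r → IsSmoothSubbundle (W 2 0))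
    (hsel : 2 ≤ r → ∀ x, ∃ (R : S.H x) (d : ℕ) (φ : Fin d → OneForm E M)
      (e : Fin d → TangentSpace 𝓘(ℝ, E) x), S.IsTraceSum r W x R ∧
        S.IsCoframeGerm r 1 (fun j => W j 1) x φ ∧ S.IsSelected 1 True x φ (-R) e ∧
        W 2 0 x = Submodule.span ℝ (Set.range e) ⊔ flag S.H 0 x) :
    S.IsMinimalRigidRun r W := by
  have h20 : ∀ {m k : ℕ}, 2 ≤ m → k < m → (3 ≤ m + k ∨ (m = 2 ∧ k = 0)) := fun h1 h2 => by omega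
  have hsup : ∀ m k, 2 ≤ m → m ≤ r → k < m → ∀ x,
      W m k x ⊔ flag S.H (m - 1) x = flag S.H m x := by
    intro m k h2 hm hk x
    rcases h20 h2 hk with h3 | ⟨rfl, rfl⟩
    · exact (hW.slice k (by omega)).sup_eq m h2 h3 hm hk x
    · obtain ⟨R, d, φ, e, -, hφ, he, hWx⟩ := hsel hm x
      rw [hWx]
      exact hφ.isCoframeAt.span_sup he.mem he.dual (l := 0) (Nat.zero_le _)
  refine ⟨fun m k h2 hm hk => ?_, hsup, fun m k h2 hm hk x => ?_, fun m k h2 hm hk hkm x => ?_,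
    fun m k hk hkm hm x d d' φ e e' hφ => ?_, fun k hk hkr x d φ e e' hφ => ?_,
    fun hr2 x d φ e R hφ he hd hR => ?_⟩
  · rcases h20 h2 hk with h3 | ⟨rfl, rfl⟩
    · exact (hW.slice k (by omega)).smooth m h2 h3 hm hk
    · exact hs hm
  · rcases h20 h2 hk with h3 | ⟨rfl, rfl⟩
    · exact (hW.slice k (by omega)).inf_eq m h2 h3 hm hk x
    · obtain ⟨R, d, φ, e, -, hφ, he, hWx⟩ := hsel hm x
      rw [hWx]
      exact hφ.isCoframeAt.span_inf he.dual (l := 0) (Nat.zero_le _)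
  · rcases (show 3 ≤ m + (k - 1) ∨ (m = 2 ∧ k = 1) by omega) with h3 | ⟨rfl, rfl⟩
    · exact (hW.next k hk (by omega)).nested m hkm hm h3 x
    · exact (le_sup_left.trans (hsup 2 0 le_rfl hm (by omega) x).le).trans
        ((hW.slice 1 hm).eq_flag le_rfl hm x).ge
  · exact (hW.next k hk (by omega)).min_A m hkm hm x d d' φ e e' (isAdaptedCoframe_iff.1 hφ)
  · exact (hW.next k (by omega) hkr).min_S hk x d φ e e' (isAdaptedCoframe_iff.1 hφ)
  · obtain ⟨R', d', φ', e', hR', hφ', he', hWx⟩ := hsel hr2 x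
    -- The value of R built from the given coframes and rows is the one used in the selection,
    -- because it depends on the slices only.
    have hRR : R = R' := by
      refine IsTraceSum.unique hW hr ⟨d, φ, e, fun m h3 hm => ⟨?_, he m (by omega) hm,
        hd m (by omega) hm⟩, hR⟩ hR'
      have := hφ m (by omega) hm
      obtain ⟨k, rfl⟩ : ∃ k, m = k + 1 := ⟨m - 1, by omega⟩
      exact isAdaptedCoframe_iff.1 this
    subst hRR
    have hφ2 : S.IsCoframeGerm r 1 (fun j => W j 1) x (φ 2) :=
      isAdaptedCoframe_iff.1 (hφ 2 le_rfl hr2)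
    have hsel2 : S.IsSelected 1 True x (φ 2) (-R) (e 2) :=
      he'.of_mem_span (hW.slice 1 hr2) hφ' hr le_rfl hr2 hφ2
        (fun j => hWx ▸ he 2 le_rfl hr2 j) (hd 2 le_rfl hr2)
    refine ⟨hsel2.trace trivial, fun f hf hfd hft hne => ?_⟩
    refine hsel2.normSq_lt hφ2 hr hJ le_rfl hr2 (fun j => ?_) hfd (fun _ => hft) ?_
    · rw [← (hW.slice 1 hr2).eq_flag le_rfl hr2]
      exact hf j
    · by_contra hall
      push Not at hall
      exact hne (funext fun j => sub_eq_zero.1 ((Submodule.mem_bot ℝ).1 (hall j)))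

theorem IsPartialRun.smooth_neg_traceSum (hW : S.IsPartialRun r W) (hr : S.IsEquiregular r)
    {R : ∀ y, S.H y} (hR : ∀ y, S.IsTraceSum r W y (R y)) (x : M) (X : VField E M)
    (hX : X.IsSectionNear S.H x) :
    ∀ᶠ y in 𝓝 x, SmoothFnAt E (fun y => extForm S.g y (-R y : S.H y) (X y)) y := by
  filter_upwards [hW.smooth_traceSum hr hR x hX, eventually_eventually_nhds.2 hX] with y hy hXy
  refine hy.neg.congr ?_
  filter_upwards [hXy] with z hz
  rw [extForm_apply (SetLike.coe_mem _) hz.2, extForm_apply (SetLike.coe_mem _) hz.2]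
  simp only [Subtype.coe_eta, map_neg, LinearMap.neg_apply]

/-- A partial run fixes R, which varies smoothly; the constrained 𝒮-selection with trace -R then
supplies the one missing entry. For r < 2 there is nothing to select. -/
theorem IsEquiregular.exists_isMinimalRigidRun (hr : S.IsEquiregular r)
    (hJ : S.IsSemiJNondegenerate r) : ∃ W, S.IsMinimalRigidRun r W := by
  obtain ⟨W, hW⟩ := hr.exists_isPartialRun hJ
  rcases Nat.lt_or_ge r 2 with hr2 | hr2
  · exact ⟨W, hW.isMinimalRigidRun hr hJ (fun h => by omega) fun h => by omega⟩
  choose R hR using hW.exists_isTraceSum hr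
  have hρ : True → ∀ (x : M) (X : VField E M), X.IsSectionNear S.H x →
      ∀ᶠ y in 𝓝 x, SmoothFnAt E (fun y => extForm S.g y (-R y : S.H y) (X y)) y :=
    fun _ => hW.smooth_neg_traceSum hr hR
  have h1 := hW.slice 1 hr2
  have hex : ∀ x, ∃ (d : ℕ) (φ : Fin d → OneForm E M) (e : Fin d → TangentSpace 𝓘(ℝ, E) x),
      S.IsCoframeGerm r 1 (fun j => W j 1) x φ ∧ S.IsSelected 1 True x φ (-R x) e := by
    intro x
    obtain ⟨d, φ, e, h, -, hs⟩ := h1.exists_selected hr hJ le_rfl hr2 (x := x) (c := True)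
      (fun _ => rfl) (ρ := fun y => -R y) fun h => hρ h x
    exact ⟨d, φ, _, h, hs.self_of_nhds⟩
  choose d φ e hφ he using hex
  let V : Distr E M := fun x => Submodule.span ℝ (Set.range (e x)) ⊔ flag S.H (1 - 1) x
  have hV : IsSmoothSubbundle V :=
    hr.isSmoothSubbundle (m := 2) (k := 0)
      (h1.sectionSpanned_selected hr hJ le_rfl hr2 (c := True) (fun _ => rfl) (ρ := fun y => -R y)
        hρ hφ he) hr2 (by omega)
      (fun x => (hφ x).isCoframeAt.span_sup (he x).mem (he x).dual (l := 0) (Nat.zero_le _))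
      (fun x => (hφ x).isCoframeAt.span_inf (he x).dual (l := 0) (Nat.zero_le _))
  -- Only the entry (2, 0) changes; slices and trace sums ignore it, so the partial run survives.
  let W' : ℕ → ℕ → Distr E M := fun m k => if m = 2 ∧ k = 0 then V else W m k
  have hWW : ∀ m k, 3 ≤ m + k → W' m k = W m k := fun m k h =>
    if_neg fun h' => by omega
  have hW' : S.IsPartialRun r W' := hW.congr fun m k _ h3 _ _ => hWW m k h3
  have h20 : W' 2 0 = V := if_pos ⟨rfl, rfl⟩
  refine ⟨W', hW'.isMinimalRigidRun hr hJ (fun _ => h20 ▸ hV) fun _ x =>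
    ⟨R x, d x, φ x, e x, ?_, ?_, he x, by rw [h20]⟩⟩
  · obtain ⟨d, φ, e, hd, hRx⟩ := hR x
    refine ⟨d, φ, e, fun m h3 hm => ?_, hRx⟩
    obtain ⟨a, b, c⟩ := hd m h3 hm
    exact ⟨a.congr fun j h1 h2 => hWW j (m - 1) (by omega), fun j => by
      rw [hWW m 0 (by omega)]; exact b j, c⟩
  · exact (hφ x).congr fun j h1 h2 => hWW j 1 (by omega)

/-- The minimality in `final` yields the first-order condition for a dual row in `W 2 0`, and that
condition determines the row completely because H_0 = 0. -/
theorem IsMinimalRigidRun.two_zero_eq (h : S.IsMinimalRigidRun r W) (hr : S.IsEquiregular r)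
    (hJ : S.IsSemiJNondegenerate r) (hr2 : 2 ≤ r) {x : M} {R : S.H x}
    (hR : S.IsTraceSum r W x R) {d : ℕ} {φ : Fin d → OneForm E M}
    {e : Fin d → TangentSpace 𝓘(ℝ, E) x} (hφ : S.IsCoframeGerm r 1 (fun j => W j 1) x φ)
    (he : S.IsSelected 1 True x φ (-R) e) :
    W 2 0 x = Submodule.span ℝ (Set.range e) ⊔ flag S.H 0 x := by
  have hsup := h.sup_eq 2 0 le_rfl hr2 (by omega) x
  have hinf := h.inf_eq 2 0 le_rfl hr2 (by omega) x
  have h1 := h.isPartialRun.slice 1 hr2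
  obtain ⟨f, hf, hfd⟩ := hφ.isCoframeAt.exists_dual_in hsup
  obtain ⟨d', φ', e', hd', hR'⟩ := hR
  -- `final` takes the data of all degrees at once, so the coframe and row of degree 2 are spliced
  -- into the family that computes R. Bundling the dimension with them avoids casts.
  obtain ⟨p, hp2, hp⟩ : ∃ p : ℕ → (d : ℕ) × (Fin d → OneForm E M) ×
      (Fin d → TangentSpace 𝓘(ℝ, E) x), p 2 = ⟨d, φ, f⟩ ∧
      ∀ m, 3 ≤ m → p m = ⟨d' m, φ' m, e' m⟩ :=
    ⟨fun m => if m = 2 then ⟨d, φ, f⟩ else ⟨d' m, φ' m, e' m⟩, if_pos rfl,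
      fun m hm => if_neg (by omega)⟩
  have hspec : ∀ m, 2 ≤ m → m ≤ r → S.IsAdaptedCoframe r W m x (p m).2.1 ∧
      (∀ j, (p m).2.2 j ∈ W m 0 x) ∧
      ∀ i j, (p m).2.1 i x ((p m).2.2 j) = if i = j then 1 else 0 := by
    intro m h2 hm
    rcases h2.eq_or_lt with rfl | h3
    · rw [hp2]
      exact ⟨isAdaptedCoframe_iff.2 hφ, hf, hfd⟩
    · rw [hp m h3]
      obtain ⟨h4, h5, h6⟩ := hd' m h3 hm
      refine ⟨?_, h5, h6⟩
      obtain ⟨k, rfl⟩ : ∃ k, m = k + 1 := ⟨m - 1, by omega⟩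
      exact isAdaptedCoframe_iff.2 h4
  have hfin := h.final hr2 x (fun m => (p m).1) (fun m => (p m).2.1) (fun m => (p m).2.2) R
    (fun m h2 hm => (hspec m h2 hm).1) (fun m h2 hm => (hspec m h2 hm).2.1)
    (fun m h2 hm => (hspec m h2 hm).2.2) (hR'.trans (Finset.sum_congr rfl fun m hm => by
      rw [hp m (Finset.mem_Icc.1 hm).1]))
  rw [hp2] at hfin
  have hsel : S.IsSelected 1 True x φ (-R) f :=
    hφ.isSelected_of_min le_rfl (fun j => hsup.le (Submodule.mem_sup_left (hf j))) hfd
      (fun _ => hfin.1) fun e' he' hde' ht hne => hfin.2 e'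
        (fun j => by rw [h1.eq_flag le_rfl hr2]; exact he' j) hde' (ht trivial) fun e => by
          obtain ⟨j, hj⟩ := hne
          exact hj (by rw [e]; simp)
  exact eq_span_of_selected hφ hr hJ le_rfl hr2 hsup hinf he hsel hf

theorem IsMinimalRigidRun.exists_selected (h : S.IsMinimalRigidRun r W) (hr : S.IsEquiregular r)
    (hJ : S.IsSemiJNondegenerate r) (hr2 : 2 ≤ r) (x : M) :
    ∃ (R : S.H x) (d : ℕ) (φ : Fin d → OneForm E M) (e : Fin d → TangentSpace 𝓘(ℝ, E) x),
      S.IsTraceSum r W x R ∧ S.IsCoframeGerm r 1 (fun j => W j 1) x φ ∧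
        S.IsSelected 1 True x φ (-R) e := by
  have hW := h.isPartialRun
  choose R hR using hW.exists_isTraceSum hr
  obtain ⟨d, φ, e, h, -, hs⟩ := (hW.slice 1 hr2).exists_selected hr hJ le_rfl hr2 (x := x)
    (c := True) (fun _ => rfl) (ρ := fun y => -R y) fun _ X hX =>
      hW.smooth_neg_traceSum hr hR x X hX
  exact ⟨R x, d, φ, _, hR x, h, hs.self_of_nhds⟩

theorem IsTraceSum.congr {x : M} {R : S.H x} (h : S.IsTraceSum r W x R)
    (hW : ∀ m k, 2 ≤ m → 3 ≤ m + k → m ≤ r → k < m → W' m k = W m k) : S.IsTraceSum r W' x R := by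
  obtain ⟨d, φ, e, hd, hR⟩ := h
  refine ⟨d, φ, e, fun m h3 hm => ?_, hR⟩
  obtain ⟨a, b, c⟩ := hd m h3 hm
  exact ⟨a.congr fun j h1 h2 => hW j (m - 1) (by omega) (by omega) h2 (by omega), fun j => by
    rw [hW m 0 (by omega) (by omega) hm (by omega)]; exact b j, c⟩

/-- The algorithm determines its result. -/
theorem IsMinimalRigidRun.unique (h : S.IsMinimalRigidRun r W) (h' : S.IsMinimalRigidRun r W')
    (hr : S.IsEquiregular r) (hJ : S.IsSemiJNondegenerate r) {m k : ℕ} (h2 : 2 ≤ m) (hm : m ≤ r)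
    (hk : k < m) : W' m k = W m k := by
  have key : ∀ m k, 2 ≤ m → 3 ≤ m + k → m ≤ r → k < m → W' m k = W m k :=
    fun m k h2 h3 hm hk => h.isPartialRun.unique h'.isPartialRun hr hJ h2 h3 hm hk
  rcases (show 3 ≤ m + k ∨ (m = 2 ∧ k = 0) by omega) with h3 | ⟨rfl, rfl⟩
  · exact key m k h2 h3 hm hk
  · funext x
    obtain ⟨R, d, φ, e, hR, hφ, he⟩ := h.exists_selected hr hJ hm x
    rw [h.two_zero_eq hr hJ hm hR hφ he, h'.two_zero_eq hr hJ hm (hR.congr key)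
      (hφ.congr fun j h1 h2 => key j 1 (by omega) (by omega) h2 (by omega)) he]

theorem IsMinimalRigidRun.isGradedComplement (h : S.IsMinimalRigidRun r W) :
    S.IsGradedComplement r fun m => W m 0 := by
  intro m h2 hm
  refine ⟨h.smooth m 0 h2 hm (by omega), fun x => ⟨?_, ?_⟩⟩
  · rw [sup_comm]; exact h.sup_eq m 0 h2 hm (by omega) x
  · rw [inf_comm]; exact h.inf_eq m 0 h2 hm (by omega) x

end SubRiemannian

/-! ### Rigidity of the complement -/

namespace SubRiemannian

variable {E : Type*} [NormedAddCommGroup E] [NormedSpace ℝ E] [FiniteDimensional ℝ E]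
variable {M : Type*} [TopologicalSpace M] [ChartedSpace E M] [IsManifold 𝓘(ℝ, E) ∞ M] [T2Space M]
variable {S : SubRiemannian E M} {r : ℕ} {W : ℕ → ℕ → Distr E M}

theorem IsMinimalRigidRun.nested_le (h : S.IsMinimalRigidRun r W) {m k : ℕ} (h2 : 2 ≤ m)
    (hm : m ≤ r) (hk : k < m) (x : M) : W m 0 x ≤ W m k x := by
  induction k with
  | zero => exact le_rfl
  | succ k ih => exact (ih (by omega)).trans (h.nested m (k + 1) h2 hm (by omega) hk x)

/-- The coframes `φ m` are adapted to `W`, near `x`. -/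
def IsCoframeFamily (S : SubRiemannian E M) (r : ℕ) (W : ℕ → ℕ → Distr E M) (x : M) {d : ℕ → ℕ}
    (φ : (m : ℕ) → Fin (d m) → OneForm E M) : Prop :=
  ∀ m, 2 ≤ m → m ≤ r → S.IsCoframeGerm r (m - 1) (fun j => W j (m - 1)) x (φ m)

section Family

variable {x : M} {d : ℕ → ℕ} {φ : (m : ℕ) → Fin (d m) → OneForm E M}

theorem IsCoframeFamily.eventually (hφ : S.IsCoframeFamily r W x φ) :
    ∀ᶠ y in 𝓝 x, S.IsCoframeFamily r W y φ := by
  have : ∀ᶠ y in 𝓝 x, ∀ m ∈ Finset.Icc 2 r,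
      S.IsCoframeGerm r (m - 1) (fun j => W j (m - 1)) y (φ m) := by
    rw [Filter.eventually_all_finset]
    intro m hm
    rw [Finset.mem_Icc] at hm
    exact (hφ m hm.1 hm.2).eventually
  filter_upwards [this] with y hy m h2 hm using hy m (Finset.mem_Icc.2 ⟨h2, hm⟩)

theorem IsCoframeFamily.isCoframeAt (hφ : S.IsCoframeFamily r W x φ) {m : ℕ} (h2 : 2 ≤ m)
    (hm : m ≤ r) : S.IsCoframeAt m x fun i => φ m i x := by
  have := (hφ m h2 hm).isCoframeAt
  rwa [show m - 1 + 1 = m by omega] at this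

/-- For l < m because `W l 0` lies in H_{m-1}; for l > m because adapted coframes annihilate `W l (m
- 1)`, which contains `W l 0`. -/
theorem IsCoframeFamily.apply_eq_zero (hφ : S.IsCoframeFamily r W x φ)
    (h : S.IsMinimalRigidRun r W) {m l : ℕ} (h2 : 2 ≤ m) (hm : m ≤ r) (hl2 : 2 ≤ l) (hl : l ≤ r)
    (hne : l ≠ m) (i : Fin (d m)) {v : TangentSpace 𝓘(ℝ, E) x} (hv : v ∈ W l 0 x) :
    φ m i x v = 0 := by
  rcases lt_or_gt_of_ne hne with hlt | hlt
  · refine (hφ m h2 hm).apply_eq_zero i (flag_mono (show l ≤ m - 1 by omega) x ?_)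
    rw [← h.sup_eq l 0 hl2 hl (by omega) x]
    exact Submodule.mem_sup_left hv
  · exact (hφ m h2 hm).apply_eq_zero_of_mem (by omega) hl i
      (h.nested_le hl2 hl (by omega) x hv)

/-- The matrix relating an orthonormal frame of the complement to an adapted family of coframes
has orthonormal rows. -/
theorem IsCoframeFamily.row (hφ : S.IsCoframeFamily r W x φ) (h : S.IsMinimalRigidRun r W) {n : ℕ}
    {u : Fin n → TangentSpace 𝓘(ℝ, E) x} (hu : S.IsOrthonormalFrameAt r (fun m => W m 0) x u)
    (i l : Fin n) : ∑ J : (Σ m : Finset.Icc 2 r, Fin (d m)),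
      φ J.1 J.2 x (u i) * φ J.1 J.2 x (u l) = if i = l then 1 else 0 := by
  obtain ⟨-, c, hcV, hcu, hco⟩ := hu
  have key : ∀ (m : Finset.Icc 2 r) (j : Fin (d m)) (i : Fin n),
      φ m j x (u i) = φ m j x (c i m : TangentSpace 𝓘(ℝ, E) x) := by
    intro m j i
    have hm := Finset.mem_Icc.1 m.2
    rw [hcu i, map_sum]
    refine Finset.sum_eq_single_of_mem _ m.2 fun l hl hne => ?_
    have hl' := Finset.mem_Icc.1 hl
    exact hφ.apply_eq_zero h hm.1 hm.2 hl'.1 hl'.2 hne j (hcV i l hl)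
  rw [Fintype.sum_sigma, ← hco i l, ← Finset.sum_coe_sort (Finset.Icc 2 r)]
  refine Finset.sum_congr rfl fun m _ => ?_
  have hm := Finset.mem_Icc.1 m.2
  rw [(hφ.isCoframeAt hm.1 hm.2).hatForm_apply]
  exact Finset.sum_congr rfl fun j _ => by rw [key, key]

/-- The difference of the two sides vanishes on H and on the span of `u`, which contains every `W m
0`; climbing the flag, it vanishes on all of TM. -/
theorem IsCoframeFamily.dual_eq (hφ : S.IsCoframeFamily r W x φ) (h : S.IsMinimalRigidRun r W)
    (hr : S.IsEquiregular r) {n : ℕ}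
    {u : Fin n → TangentSpace 𝓘(ℝ, E) x} (hu : S.IsOrthonormalFrameAt r (fun m => W m 0) x u)
    {ψ : Fin n → TangentSpace 𝓘(ℝ, E) x →L[ℝ] ℝ} (hd : ∀ i j, ψ i (u j) = if i = j then 1 else 0)
    (hH : ∀ i, ∀ v ∈ S.H x, ψ i v = 0) (i : Fin n) :
    ψ i = ∑ J : (Σ m : Finset.Icc 2 r, Fin (d m)), φ J.1 J.2 x (u i) • φ J.1 J.2 x := by
  have hle : ∀ m, 1 ≤ m → m ≤ r → flag S.H m x ≤ LinearMap.ker (ψ i -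
      ∑ J : (Σ m : Finset.Icc 2 r, Fin (d m)), φ J.1 J.2 x (u i) • φ J.1 J.2 x).toLinearMap := by
    intro m hm
    induction m, hm using Nat.le_induction with
    | base =>
      intro _ v hv
      have : ∀ J : (Σ m : Finset.Icc 2 r, Fin (d m)), φ J.1 J.2 x v = 0 := fun J => by
        have hJ := Finset.mem_Icc.1 J.1.2
        exact (hφ J.1 hJ.1 hJ.2).apply_eq_zero_of_mem_H (by omega) _ hv
      simp [this, hH i v hv]
    | succ m hm ih =>
      intro hmr
      rw [← h.sup_eq (m + 1) 0 (by omega) hmr (by omega) x]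
      refine sup_le ?_ (ih (by omega))
      have : W (m + 1) 0 x ≤ Submodule.span ℝ (Set.range u) := by
        rw [hu.1]
        exact le_biSup (fun m => W m 0 x) (Finset.mem_Icc.2 ⟨by omega, hmr⟩)
      refine this.trans (Submodule.span_le.2 ?_)
      rintro _ ⟨l, rfl⟩
      have := hφ.row h hu i l
      simp [hd, this]
  have htop := hle r hr.one_le le_rfl
  rw [hr.eq_top] at htop
  ext v
  have := htop (Submodule.mem_top (x := v))
  exact sub_eq_zero.1 this

end Family

/-- The constraint of the last selection in another form: each tr 𝒮 is twice the trace of 𝒜, and the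
degree 2 trace equals -R. -/
theorem IsMinimalRigidRun.sum_alpha_eq_zero (h : S.IsMinimalRigidRun r W) (hr2 : 2 ≤ r) {x : M}
    {d : ℕ → ℕ} {φ : (m : ℕ) → Fin (d m) → OneForm E M} (hφ : S.IsCoframeFamily r W x φ)
    {e : (m : ℕ) → Fin (d m) → TangentSpace 𝓘(ℝ, E) x}
    (he : ∀ m, 2 ≤ m → m ≤ r → ∀ j, e m j ∈ W m 0 x)
    (hd : ∀ m, 2 ≤ m → m ≤ r → ∀ i j, φ m i x (e m j) = if i = j then 1 else 0) :
    ∑ m ∈ Finset.Icc 2 r, ∑ i, S.alpha (φ m i) x (e m i) = 0 := by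
  have hfin := (h.final hr2 x d φ e _ (fun m h2 hm => ?_) he hd rfl).1
  · have htr : ∑ m ∈ Finset.Icc 2 r, S.tr x (S.matS x (φ m) (e m)) = 0 := by
      rw [← Finset.insert_Icc_add_one_left_eq_Icc hr2, Finset.sum_insert (by simp), hfin]
      exact neg_add_cancel _
    have h2 : (2 : ℝ) • ∑ m ∈ Finset.Icc 2 r, ∑ i, S.alpha (φ m i) x (e m i) = 0 := by
      rw [← htr, Finset.smul_sum]
      refine Finset.sum_congr rfl fun m _ => ?_
      rw [tr, Finset.smul_sum]
      exact Finset.sum_congr rfl fun i _ => by rw [matS, matA_apply, two_smul]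
    exact (smul_eq_zero.1 h2).resolve_left two_ne_zero
  · have := hφ m h2 hm
    obtain ⟨k, rfl⟩ : ∃ k, m = k + 1 := ⟨m - 1, by omega⟩
    exact isAdaptedCoframe_iff.2 this

/-- The dual coframe ψ is an orthogonal transform of the union of the adapted coframes over all
degrees. Under it the trace of 𝒜 is unchanged, the derivative terms contributing the trace of a skew
matrix; and for the adapted data the trace is zero. -/
theorem IsMinimalRigidRun.isVRigid (h : S.IsMinimalRigidRun r W) (hr : S.IsEquiregular r) :
    S.IsVRigid r fun m => W m 0 := by
  intro O n U ψ hO hU hψ hUψ x hx X hX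
  rcases Nat.lt_or_ge r 2 with hr2 | hr2
  · have hspan := (hUψ x hx).1.1
    rw [Finset.Icc_eq_empty (by omega)] at hspan
    have hbot : Submodule.span ℝ (Set.range fun i => U i x) = ⊥ := by simpa using hspan
    refine Finset.sum_eq_zero fun i _ => ?_
    rw [show U i x = 0 from Submodule.span_eq_bot.1 hbot _ ⟨i, rfl⟩]
    simp
  have hex : ∀ m, ∃ p : (d : ℕ) × (Fin d → OneForm E M),
      2 ≤ m → m ≤ r → S.IsCoframeGerm r (m - 1) (fun j => W j (m - 1)) x p.2 := by
    intro m
    by_cases hm : 2 ≤ m ∧ m ≤ r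
    · obtain ⟨d, φ, -, hφ, -⟩ := (h.isPartialRun.slice (m - 1) (by omega)).exists_coframe hr
        (by omega) (by omega) x
      exact ⟨⟨d, φ⟩, fun _ _ => hφ⟩
    · exact ⟨⟨0, Fin.elim0⟩, fun h1 h2 => (hm ⟨h1, h2⟩).elim⟩
  choose p hp using hex
  let φ : (m : ℕ) → Fin (p m).1 → OneForm E M := fun m => (p m).2
  have hφ : S.IsCoframeFamily r W x φ := hp
  have hed : ∀ m, ∃ e : Fin (p m).1 → TangentSpace 𝓘(ℝ, E) x, 2 ≤ m → m ≤ r →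
      (∀ j, e j ∈ W m 0 x) ∧ ∀ i j, φ m i x (e j) = if i = j then 1 else 0 := by
    intro m
    by_cases hm : 2 ≤ m ∧ m ≤ r
    · obtain ⟨e, h1, h2⟩ := (hφ.isCoframeAt hm.1 hm.2).exists_dual_in
        (h.sup_eq m 0 hm.1 hm.2 (by omega) x)
      exact ⟨e, fun _ _ => ⟨h1, h2⟩⟩
    · exact ⟨0, fun h1 h2 => (hm ⟨h1, h2⟩).elim⟩
  choose e he using hed
  have hsum := h.sum_alpha_eq_zero hr2 hφ (fun m h2 hm => (he m h2 hm).1)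
    fun m h2 hm => (he m h2 hm).2
  let ι := Σ m : Finset.Icc 2 r, Fin (p m).1
  have hι : ∀ J : ι, 2 ≤ J.1.1 ∧ J.1.1 ≤ r := fun J => Finset.mem_Icc.1 J.1.2
  -- The coefficient of `e J` along `U i` is ψ_i(e_J), which equals φ_J(U_i) by `dual_eq`: frames
  -- and coframes change by one and the same matrix.
  have heJ : ∀ J : ι, e J.1 J.2 = ∑ i, φ J.1 J.2 x (U i x) • U i x := by
    intro J
    have hmem : e J.1 J.2 ∈ Submodule.span ℝ (Set.range fun i => U i x) := by
      rw [(hUψ x hx).1.1]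
      exact le_biSup (fun m => W m 0 x) J.1.2 ((he J.1 (hι J).1 (hι J).2).1 J.2)
    obtain ⟨k, hk⟩ := (Submodule.mem_span_range_iff_exists_fun ℝ).1 hmem
    rw [← hk]
    refine Finset.sum_congr rfl fun i _ => ?_
    have h1 : ψ i x (e J.1 J.2) = k i := by simp [← hk, (hUψ x hx).2.1]
    have h2 : ψ i x (e J.1 J.2) = φ J.1 J.2 x (U i x) := by
      rw [hφ.dual_eq h hr (hUψ x hx).1 (hUψ x hx).2.1 (hUψ x hx).2.2 i]
      simp only [sum_apply, smul_apply, smul_eq_mul]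
      rw [Finset.sum_eq_single_of_mem J (Finset.mem_univ _), (he J.1 (hι J).1 (hι J).2).2]
      · simp
      · rintro ⟨m, j⟩ - hne
        have hm := Finset.mem_Icc.1 m.2
        by_cases hmJ : m = J.1
        · subst hmJ
          rw [(he J.1 (hι J).1 (hι J).2).2, if_neg, mul_zero]
          rintro rfl
          exact hne rfl
        · rw [hφ.apply_eq_zero h hm.1 hm.2 (hι J).1 (hι J).2 (fun e => hmJ (Subtype.ext e.symm)) j
            ((he J.1 (hι J).1 (hι J).2).1 J.2), mul_zero]
    rw [← h1, h2]
  have hg : IsGauge x (fun J : ι => φ J.1 J.2) ψ fun i J y => φ J.1 J.2 y (U i y) := by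
    refine ⟨fun i J => ((hφ J.1 (hι J).1 (hι J).2).smoothAt _).apply ((hU i).smoothAt hO hx), ?_, ?_,
      fun J K => ?_⟩
    · filter_upwards [hO.mem_nhds hx, hφ.eventually] with y hy hφy i
      exact hφy.dual_eq h hr (hUψ y hy).1 (hUψ y hy).2.1 (hUψ y hy).2.2 i
    · filter_upwards [hO.mem_nhds hx, hφ.eventually] with y hy hφy i l
      exact hφy.row h (hUψ y hy).1 i l
    · have h1 : φ K.1 K.2 x (e J.1 J.2) = if J = K then 1 else 0 := by
        by_cases hJK : J = K
        · subst hJK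
          rw [(he J.1 (hι J).1 (hι J).2).2]; simp
        · rw [if_neg hJK]
          by_cases hm : J.1 = K.1
          · obtain ⟨m, j⟩ := J
            obtain ⟨m', j'⟩ := K
            obtain rfl : m = m' := hm
            have hm := Finset.mem_Icc.1 m.2
            rw [(he m hm.1 hm.2).2, if_neg]
            rintro rfl
            exact hJK rfl
          · exact hφ.apply_eq_zero h (hι K).1 (hι K).2 (hι J).1 (hι J).2
              (fun e => hm (Subtype.ext e)) K.2 ((he J.1 (hι J).1 (hι J).2).1 J.2)
      rw [← h1, heJ J]
      simp
  obtain ⟨σ, hσ, hσ0⟩ := hg.exists_sigma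
    (fun J => (hφ J.1 (hι J).1 (hι J).2).smoothAt _) fun J X hX =>
      (hφ J.1 (hι J).1 (hι J).2).apply_eq_zero_of_mem_H (by have := (hι J).1; omega) _ hX
  -- The diagonal of the skew-symmetry relation: the rows of the gauge matrix have constant length.
  have hσ1 : ∀ i, ∑ J : ι, φ J.1 J.2 x (U i x) • σ i J = 0 := by
    intro i
    have := hσ0 i i
    simp only [← two_smul ℝ, ← Finset.smul_sum] at this
    exact (smul_eq_zero.1 this).resolve_left two_ne_zero
  have hzero : ∑ i, S.alpha (ψ i) x (U i x) = 0 := by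
    calc ∑ i, S.alpha (ψ i) x (U i x)
        = ∑ i, ∑ J : ι, φ J.1 J.2 x (U i x) • S.alpha (φ J.1 J.2) x (U i x) :=
          Finset.sum_congr rfl fun i _ => by rw [hσ, hσ1, sub_zero]
      _ = ∑ J : ι, S.alpha (φ J.1 J.2) x (e J.1 J.2) := by
          rw [Finset.sum_comm]
          refine Finset.sum_congr rfl fun J _ => ?_
          rw [heJ J, map_sum]
          simp only [map_smul]
      _ = 0 := by
          rw [← hsum, Fintype.sum_sigma, ← Finset.sum_coe_sort (Finset.Icc 2 r)]
  have := congrArg (fun v => S.g x v ⟨X, hX⟩) hzero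
  simpa [g_alpha] using this

end SubRiemannian

/-! ### Transport by diffeomorphisms -/

section Push

variable {E : Type*} [NormedAddCommGroup E] [NormedSpace ℝ E] [FiniteDimensional ℝ E]
variable {M : Type*} [TopologicalSpace M] [ChartedSpace E M] [IsManifold 𝓘(ℝ, E) ∞ M]
variable (F : Diffeomorph 𝓘(ℝ, E) 𝓘(ℝ, E) M M ∞)

/-- The differential of a diffeomorphism. -/
def tangentEquiv (x : M) : TangentSpace 𝓘(ℝ, E) x ≃L[ℝ] TangentSpace 𝓘(ℝ, E) (F x) :=
  F.mfderivToContinuousLinearEquiv (by simp) x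

theorem isInvertible_mfderiv (x : M) : (mfderiv 𝓘(ℝ, E) 𝓘(ℝ, E) F x).IsInvertible :=
  ⟨tangentEquiv F x, rfl⟩

/-- The equality is placed in the model space `E`, because the tangent spaces at `F.symm (F x)` and
at `x` agree only along a propositional equality of points. -/
theorem mfderiv_symm_apply (x : M) (v : TangentSpace 𝓘(ℝ, E) x) :
    (mfderiv 𝓘(ℝ, E) 𝓘(ℝ, E) F.symm (F x) (tangentEquiv F x v) : E) = v := by
  have h := mfderiv_comp x (F.symm.contMDiff.mdifferentiableAt (x := F x) (by simp))
    (F.contMDiff.mdifferentiableAt (x := x) (by simp))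
  have e : (F.symm ∘ F : M → M) = id := funext F.symm_apply_apply
  have h2 : (mfderiv 𝓘(ℝ, E) 𝓘(ℝ, E) (F.symm ∘ F : M → M) x : E → E) = id := by
    rw [e, mfderiv_id]; rfl
  rw [h] at h2
  exact congrFun h2 v

/-- The push-forward of a vector field by a diffeomorphism. -/
def VField.push (X : VField E M) : VField E M :=
  VectorField.mpullback 𝓘(ℝ, E) 𝓘(ℝ, E) F.symm X

/-- The pull-back of a vector field by a diffeomorphism. -/
def VField.pull (X : VField E M) : VField E M :=
  VectorField.mpullback 𝓘(ℝ, E) 𝓘(ℝ, E) F X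

/-- The push-forward of a one-form by a diffeomorphism. -/
def OneForm.push (φ : OneForm E M) : OneForm E M := fun z =>
  (φ (F.symm z)).comp (mfderiv 𝓘(ℝ, E) 𝓘(ℝ, E) F.symm z)

theorem exists_apply_eq (z : M) : ∃ y, F y = z := ⟨F.symm z, F.apply_symm_apply z⟩

variable {F} {X Y : VField E M} {φ : OneForm E M} {x : M}

theorem VField.push_apply (X : VField E M) (x : M) : X.push F (F x) = tangentEquiv F x (X x) := by
  have h1 : tangentEquiv F.symm (F x) (X.push F (F x)) = X (F.symm (F x)) :=
    (isInvertible_mfderiv F.symm (F x)).self_apply_inverse _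
  have h2 : (tangentEquiv F.symm (F x) (tangentEquiv F x (X x)) : E) = X (F.symm (F x)) := by
    refine (mfderiv_symm_apply F x (X x)).trans ?_
    exact (congrArg (fun y => (X y : E)) (F.symm_apply_apply x)).symm
  exact (tangentEquiv F.symm (F x)).injective (h1.trans h2.symm)

theorem VField.pull_apply (X : VField E M) (x : M) : tangentEquiv F x (X.pull F x) = X (F x) :=
  (isInvertible_mfderiv F x).self_apply_inverse _

theorem OneForm.push_apply (φ : OneForm E M) (x : M) (v : TangentSpace 𝓘(ℝ, E) x) :
    φ.push F (F x) (tangentEquiv F x v) = φ x v := by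
  have h : ∀ (y : M) (hy : y = x) (w : E), w = v → (φ y : E → ℝ) w = φ x v := by
    rintro y rfl w rfl; rfl
  exact h _ (F.symm_apply_apply x) _ (mfderiv_symm_apply F x v)

theorem VField.SmoothAt.pull (hX : X.SmoothAt (F x)) : (X.pull F).SmoothAt x :=
  ContMDiffAt.mpullback_vectorField_preimage hX (F.contMDiff x) (isInvertible_mfderiv F x) (by simp)

theorem VField.SmoothAt.push (hX : X.SmoothAt x) : (X.push F).SmoothAt (F x) :=
  ContMDiffAt.mpullback_vectorField_preimage
    (show X.SmoothAt (F.symm (F x)) by rwa [F.symm_apply_apply]) (F.symm.contMDiff _)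
    (isInvertible_mfderiv F.symm _) (by simp)

theorem SmoothFnAt.comp_symm {f : M → ℝ} (hf : SmoothFnAt E f x) :
    SmoothFnAt E (fun z => f (F.symm z)) (F x) :=
  ContMDiffAt.comp (F x) (g := f) (f := F.symm)
    (show SmoothFnAt E f (F.symm (F x)) by rwa [F.symm_apply_apply]) (F.symm.contMDiff _)

theorem dirDeriv_comp_symm {f : M → ℝ} (hf : SmoothFnAt E f x) (v : TangentSpace 𝓘(ℝ, E) x) :
    dirDeriv (fun z => f (F.symm z)) (F x) (tangentEquiv F x v) = dirDeriv f x v := by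
  have h := mfderiv_comp x (g := fun z => f (F.symm z)) (f := F)
    (hf.comp_symm (F := F)).mdifferentiableAt (F.contMDiff.mdifferentiableAt (x := x) (by simp))
  have e : (fun z => f (F.symm z)) ∘ F = f := funext fun y => by simp
  rw [e] at h
  unfold dirDeriv
  rw [h]
  rfl

theorem mlieBracket_push (hX : X.SmoothAt x) (hY : Y.SmoothAt x) :
    VectorField.mlieBracket 𝓘(ℝ, E) (X.push F) (Y.push F) (F x) =
      tangentEquiv F x (VectorField.mlieBracket 𝓘(ℝ, E) X Y x) := by
  have := VectorField.mpullback_mlieBracket (I := 𝓘(ℝ, E)) (I' := 𝓘(ℝ, E)) (f := F.symm)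
    (x₀ := F x) (n := ∞)
    (show X.SmoothAt (F.symm (F x)) by rwa [F.symm_apply_apply]).mdifferentiableAt
    (show Y.SmoothAt (F.symm (F x)) by rwa [F.symm_apply_apply]).mdifferentiableAt
    (F.symm.contMDiff _) (by rw [minSmoothness_of_isRCLikeNormedField]; exact ENat.LEInfty.out)
  exact this.symm.trans (VField.push_apply _ x)

theorem OneForm.push_push (φ : OneForm E M) (X : VField E M) (z : M) :
    φ.push F z (X.push F z) = φ (F.symm z) (X (F.symm z)) := by
  obtain ⟨y, rfl⟩ := exists_apply_eq F z
  rw [VField.push_apply, OneForm.push_apply, F.symm_apply_apply]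

theorem VField.push_pull (X : VField E M) (z : M) : (X.pull F).push F z = X z := by
  obtain ⟨y, rfl⟩ := exists_apply_eq F z
  rw [VField.push_apply, VField.pull_apply]

/-- Smoothness may be tested on vector fields, and every vector field is the push-forward of its
pull-back. -/
theorem OneForm.SmoothAt.push (hφ : φ.SmoothAt x) : (φ.push F).SmoothAt (F x) :=
  OneForm.smoothAt_of_apply fun X hX =>
    (SmoothFnAt.comp_symm (F := F) (hφ.apply hX.pull)).congr (.of_forall fun z => by
      rw [← OneForm.push_push, VField.push_pull])

/-- Each ingredient of the invariant formula for dφ, namely directional derivatives, pairings and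
Lie brackets, commutes with push-forward. -/
theorem extDer_push (hφ : φ.SmoothAt x) (u v : TangentSpace 𝓘(ℝ, E) x) :
    extDer (φ.push F) (F x) (tangentEquiv F x u) (tangentEquiv F x v) = extDer φ x u v := by
  have hu := extend_smoothAt u
  have hv := extend_smoothAt v
  have h := extDer_apply (hφ.push (F := F)) (hu.push (F := F)) (hv.push (F := F))
  have h' := extDer_apply hφ hu hv
  simp only [VField.push_apply, OneForm.push_push, extend_self, mlieBracket_push hu hv,
    OneForm.push_apply] at h h'
  rw [h, h', dirDeriv_comp_symm (f := fun z => φ z (extend v z)) (hφ.apply hv),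
    dirDeriv_comp_symm (f := fun z => φ z (extend u z)) (hφ.apply hu)]

theorem IsSmoothSubbundle.pull {D : Distr E M} (hD : IsSmoothSubbundle D)
    (F : Diffeomorph 𝓘(ℝ, E) 𝓘(ℝ, E) M M ∞) :
    IsSmoothSubbundle fun x => (D (F x)).map (tangentEquiv F x).symm.toLinearMap := by
  refine isSmoothSubbundle_of_frames fun x => ?_
  obtain ⟨k, X, hX, hs⟩ := hD.exists_frame (F x)
  refine ⟨Fin k, inferInstance, fun i => (X i).pull F, fun i => ?_, ?_⟩
  · exact (F.continuous.continuousAt.eventually (hX i)).mono fun y hy => VField.SmoothAt.pull hy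
  · filter_upwards [F.continuous.continuousAt.eventually hs] with y hy
    have e : ∀ i, (X i).pull F y = (tangentEquiv F y).symm (X i (F y)) := fun i => by
      rw [← VField.pull_apply (F := F) (X i) y, ContinuousLinearEquiv.symm_apply_apply]
    simp only [e]
    refine ⟨hy.1.map' (tangentEquiv F y).symm.toLinearMap
      (LinearMap.ker_eq_bot.2 (tangentEquiv F y).symm.injective), ?_⟩
    rw [← hy.2, Submodule.map_span, ← Set.range_comp]
    rfl

theorem mem_pull_iff {D : Distr E M} {v : TangentSpace 𝓘(ℝ, E) x} :
    v ∈ (D (F x)).map (tangentEquiv F x).symm.toLinearMap ↔ tangentEquiv F x v ∈ D (F x) := by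
  constructor
  · rintro ⟨w, hw, rfl⟩
    simpa using hw
  · intro h
    exact ⟨_, h, by simp⟩

end Push

/-! ### Naturality -/

namespace SubRiemannian

variable {E : Type*} [NormedAddCommGroup E] [NormedSpace ℝ E] [FiniteDimensional ℝ E]
variable {M : Type*} [TopologicalSpace M] [ChartedSpace E M] [IsManifold 𝓘(ℝ, E) ∞ M] [T2Space M]
variable {S : SubRiemannian E M} {r : ℕ} {F : Diffeomorph 𝓘(ℝ, E) 𝓘(ℝ, E) M M ∞}

namespace IsWeakIsometry

variable (h : S.IsWeakIsometry F) {x : M} {m k d d' : ℕ}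
include h

theorem mem_H {v : TangentSpace 𝓘(ℝ, E) x} (hv : v ∈ S.H x) : tangentEquiv F x v ∈ S.H (F x) := by
  rw [← h.1 x]
  exact ⟨v, hv, rfl⟩

theorem push_mem {X : VField E M} {D : Distr E M}
    (hD : ∀ x, ∀ v ∈ D x, tangentEquiv F x v ∈ D (F x)) (hX : ∀ y, X y ∈ D y) (z : M) :
    X.push F z ∈ D z := by
  obtain ⟨y, rfl⟩ := exists_apply_eq F z
  rw [VField.push_apply]
  exact hD y _ (hX y)

/-- Push-forward preserves sections and brackets, so the recursion for the flag is respected. The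
reverse inclusion comes afterwards from equality of ranks. -/
theorem mem_flag {m : ℕ} {x : M} {v : TangentSpace 𝓘(ℝ, E) x} (hv : v ∈ flag S.H m x) :
    tangentEquiv F x v ∈ flag S.H m (F x) := by
  match m with
  | 0 =>
    have : v = 0 := hv
    rw [this, map_zero]
    exact Submodule.zero_mem _
  | 1 => exact h.mem_H hv
  | (i + 2) =>
    have hle : flag S.H (i + 2) x ≤
        (flag S.H (i + 2) (F x)).comap (tangentEquiv F x).toLinearMap := by
      refine sup_le (fun w hw => Submodule.mem_sup_left (mem_flag hw)) (Submodule.span_le.2 ?_)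
      rintro _ ⟨A, B, hA, hB, hAm, hBm, rfl⟩
      refine Submodule.mem_sup_right (Submodule.subset_span ⟨A.push F, B.push F, fun z => ?_,
        fun z => ?_, h.push_mem (fun _ _ => mem_flag) hAm, h.push_mem (fun _ _ => h.mem_H) hBm,
        (mlieBracket_push (hA x) (hB x)).symm⟩)
      · obtain ⟨y, rfl⟩ := exists_apply_eq F z
        exact VField.SmoothAt.push (hA y)
      · obtain ⟨y, rfl⟩ := exists_apply_eq F z
        exact VField.SmoothAt.push (hB y)
    exact hle hv

theorem map_flag (hr : S.IsEquiregular r) (hm : m ≤ r) :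
    (flag S.H m x).map (tangentEquiv F x).toLinearMap = flag S.H m (F x) := by
  obtain ⟨n, hn⟩ := hr.exists_rank hm
  refine Submodule.eq_of_le_of_finrank_eq ?_ ?_
  · rintro _ ⟨v, hv, rfl⟩
    exact h.mem_flag hv
  · rw [hn, ← hn x]
    exact LinearEquiv.finrank_map_eq (tangentEquiv F x).toLinearEquiv _

theorem exists_mem_flag (hr : S.IsEquiregular r) (hm : m ≤ r) {w : TangentSpace 𝓘(ℝ, E) (F x)}
    (hw : w ∈ flag S.H m (F x)) : ∃ v ∈ flag S.H m x, tangentEquiv F x v = w := by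
  rw [← h.map_flag hr hm] at hw
  exact hw

theorem mem_flag_iff (hr : S.IsEquiregular r) (hm : m ≤ r) {v : TangentSpace 𝓘(ℝ, E) x} :
    tangentEquiv F x v ∈ flag S.H m (F x) ↔ v ∈ flag S.H m x := by
  refine ⟨fun hv => ?_, h.mem_flag⟩
  obtain ⟨w, hw, e⟩ := h.exists_mem_flag hr hm hv
  exact (tangentEquiv F x).injective e ▸ hw

theorem map_symm_flag (hr : S.IsEquiregular r) (hm : m ≤ r) :
    (flag S.H m (F x)).map (tangentEquiv F x).symm.toLinearMap = flag S.H m x := by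
  ext v
  rw [mem_pull_iff, h.mem_flag_iff hr hm]

omit h in
/-- The isomorphism of horizontal spaces induced by a weak isometry. -/
def mapH (h : S.IsWeakIsometry F) (x : M) : S.H x →ₗ[ℝ] S.H (F x) :=
  (tangentEquiv F x).toLinearMap.restrict fun _ => h.mem_H

theorem coe_mapH (v : S.H x) : (h.mapH x v : TangentSpace 𝓘(ℝ, E) (F x)) = tangentEquiv F x v := rfl

theorem mapH_surjective : Function.Surjective (h.mapH x) := by
  rintro ⟨w, hw⟩
  have hw' := hw
  rw [← h.1 x] at hw'
  obtain ⟨v, hv, rfl⟩ := hw'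
  exact ⟨⟨v, hv⟩, rfl⟩

theorem mapH_injective : Function.Injective (h.mapH x) := fun _ _ e =>
  Subtype.ext ((tangentEquiv F x).injective (congrArg Subtype.val e))

theorem g_mapH (v w : S.H x) : S.g (F x) (h.mapH x v) (h.mapH x w) = S.g x v w :=
  h.2 x v w _ _ rfl rfl

omit h in
/-- The map of the spaces `H_m` induced by a weak isometry. -/
def mapFlag (h : S.IsWeakIsometry F) (m : ℕ) (x : M) : flag S.H m x →ₗ[ℝ] flag S.H m (F x) :=
  (tangentEquiv F x).toLinearMap.restrict fun _ => h.mem_flag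

omit h in
/-- The map of the spaces `Ĥ_m` induced by a weak isometry. -/
def mapHat (h : S.IsWeakIsometry F) (m : ℕ) (x : M) : S.Hat m x →ₗ[ℝ] S.Hat m (F x) :=
  Submodule.mapQ _ _ (h.mapFlag m x) fun _ hv => h.mem_flag hv

theorem mapHat_cls (v : flag S.H m x) :
    h.mapHat m x (S.cls m x v) = S.cls m (F x) (h.mapFlag m x v) := rfl

theorem mapHat_injective (hr : S.IsEquiregular r) (hm : m ≤ r) :
    Function.Injective (h.mapHat m x) := by
  rw [injective_iff_map_eq_zero]
  intro a ha
  obtain ⟨v, hv, rfl⟩ := exists_cls a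
  rw [mapHat_cls, cls_eq_zero_iff] at ha
  exact (cls_eq_zero_iff _).2 ((h.mem_flag_iff hr (by omega)).1 ha)

theorem mapHat_surjective (hr : S.IsEquiregular r) (hm : m ≤ r) :
    Function.Surjective (h.mapHat m x) := by
  intro a
  obtain ⟨w, hw, rfl⟩ := exists_cls a
  obtain ⟨v, hv, rfl⟩ := h.exists_mem_flag hr hm hw
  exact ⟨S.cls m x ⟨v, hv⟩, rfl⟩

theorem isSectionNear_push {X : VField E M} {D : Distr E M}
    (hD : ∀ x, ∀ v ∈ D x, tangentEquiv F x v ∈ D (F x)) (hX : X.Smooth) (hXD : ∀ y, X y ∈ D y)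
    (z : M) : (X.push F).IsSectionNear D z := by
  refine VField.IsSectionNear.of_global (fun z => ?_) (h.push_mem hD hXD)
  obtain ⟨y, rfl⟩ := exists_apply_eq F z
  exact VField.SmoothAt.push (hX y)

theorem bracketForm (hr : S.IsEquiregular r) (hk : 1 ≤ k) (hkr : k + 1 ≤ r) (a : S.Hat k x)
    (b : S.H x) : S.bracketForm k (F x) (h.mapHat k x a) (h.mapH x b) =
      h.mapHat (k + 1) x (S.bracketForm k x a b) := by
  obtain ⟨v, hv, rfl⟩ := exists_cls a
  obtain ⟨A, hA, hAm, rfl⟩ := S.sectionSpanned_flag k x v hv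
  obtain ⟨B, hB, (hBm : ∀ y, B y ∈ S.H y), eB⟩ := S.sectionSpanned_flag 1 x b b.2
  obtain rfl : b = ⟨B x, hBm x⟩ := Subtype.ext eB.symm
  have hA' := h.isSectionNear_push (D := flag S.H k) (fun _ _ => h.mem_flag) hA hAm (F x)
  have hB' := h.isSectionNear_push (D := S.H) (fun _ _ => h.mem_H) hB hBm (F x)
  have hm := bracket_mem_flag (H := S.H) hk (.of_global hA hAm) (x := x) (.of_global hB hBm)
  have h1 := hr.bracketForm_section hk hkr hA' hB'
    (h.mapFlag (k + 1) x ⟨_, Submodule.neg_mem _ hm⟩)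
    (by rw [mlieBracket_push (hA x) (hB x), ← map_neg]; rfl)
  have h2 := hr.bracketForm_section hk hkr (x := x) (.of_global hA hAm) (.of_global hB hBm)
    ⟨_, Submodule.neg_mem _ hm⟩ rfl
  refine Eq.trans ?_ (h1.trans (congrArg (h.mapHat (k + 1) x) h2.symm))
  have eA : h.mapFlag k x ⟨A x, hAm x⟩ = ⟨_, hA'.mem⟩ := Subtype.ext (VField.push_apply A x).symm
  have eB : h.mapH x ⟨B x, hBm x⟩ = ⟨_, VField.IsSectionNear.mem hB'⟩ :=
    Subtype.ext (VField.push_apply B x).symm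
  rw [mapHat_cls, eA, eB]

theorem isParseval_mapH {ι : Type*} [Fintype ι] {X : ι → S.H x} (hX : IsParseval (S.g x) X) :
    IsParseval (S.g (F x)) fun i => h.mapH x (X i) := by
  refine ⟨S.g_symm _, fun w => ?_⟩
  obtain ⟨v, rfl⟩ := h.mapH_surjective w
  simp only [g_mapH, ← map_smul, ← map_sum, hX.sum_eq]

/-- The recipe that produces Parseval frames of Ĥ_m from one of H uses only the bracket forms, with
which the induced maps commute. -/
theorem exists_isParseval (hr : S.IsEquiregular r) (hm : 1 ≤ m) (hmr : m ≤ r) :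
    ∃ (ι : Type) (_ : Fintype ι) (f : ι → S.Hat m x), IsParseval (S.hatForm x m) f ∧
      IsParseval (S.hatForm (F x) m) fun i => h.mapHat m x (f i) := by
  obtain ⟨d, X, hX⟩ := S.exists_orthonormalBasis_H x
  have hP := hX.isParseval (S.g_symm x)
  have hP' := h.isParseval_mapH hP
  induction m, hm using Nat.le_induction with
  | base => exact ⟨_, _, _, isParseval_hatForm_one hP, isParseval_hatForm_one hP'⟩
  | succ m hm ih =>
    rcases hm.eq_or_lt with rfl | hm2
    · refine ⟨_, _, _, hr.isParseval_hatForm_two hmr hP, ?_⟩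
      simp only [map_smul, ← h.bracketForm hr le_rfl hmr]
      exact hr.isParseval_hatForm_two hmr hP'
    · obtain ⟨ι, _, f, hf, hf'⟩ := ih (by omega)
      refine ⟨_, _, _, hr.isParseval_hatForm_succ hm2 hmr hP hf, ?_⟩
      simp only [← h.bracketForm hr hm hmr]
      exact hr.isParseval_hatForm_succ hm2 hmr hP' hf'

/-- The pulled-back metric and the given one share a Parseval frame, hence coincide. -/
theorem hatForm_mapHat (hr : S.IsEquiregular r) (hm : 1 ≤ m) (hmr : m ≤ r) (a b : S.Hat m x) :
    S.hatForm (F x) m (h.mapHat m x a) (h.mapHat m x b) = S.hatForm x m a b := by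
  obtain ⟨ι, _, f, hf, hf'⟩ := h.exists_isParseval (x := x) hr hm hmr
  have : IsParseval ((S.hatForm (F x) m).compl₁₂ (h.mapHat m x) (h.mapHat m x)) f :=
    ⟨fun _ _ => hf'.symm _ _, fun w => h.mapHat_injective hr hmr (by
      rw [map_sum]
      simp only [map_smul]
      exact hf'.sum_eq (h.mapHat m x w))⟩
  exact LinearMap.congr_fun₂ (this.eq hf) a b

theorem isFrameAt (hr : S.IsEquiregular r) (hm : 1 ≤ m) (hmr : m ≤ r)
    {e : Fin d → TangentSpace 𝓘(ℝ, E) x} (he : S.IsFrameAt m x e) :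
    S.IsFrameAt m (F x) fun i => tangentEquiv F x (e i) := by
  obtain ⟨he, ho, hs⟩ := he
  refine ⟨fun i => h.mem_flag (he i), fun i j => ?_, ?_⟩
  · rw [← ho i j]
    exact h.hatForm_mapHat (x := x) hr hm hmr (S.cls m x ⟨e i, he i⟩) (S.cls m x ⟨e j, he j⟩)
  · have := congrArg (Submodule.map (h.mapHat m x)) hs
    rw [Submodule.map_span, Submodule.map_top, LinearMap.range_eq_top.2 (h.mapHat_surjective hr hmr),
      ← Set.range_comp] at this
    exact this

theorem isCoframeAt (hr : S.IsEquiregular r) (hm : 1 ≤ m) (hmr : m ≤ r)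
    {φ : Fin d → OneForm E M} (hφ : S.IsCoframeAt m x fun i => φ i x) :
    S.IsCoframeAt m (F x) fun i => (φ i).push F (F x) := by
  obtain ⟨h0, e, he, hd⟩ := hφ
  refine ⟨fun i w hw => ?_, _, h.isFrameAt hr hm hmr he, fun i j => ?_⟩
  · obtain ⟨v, hv, rfl⟩ := h.exists_mem_flag hr (by omega) hw
    rw [OneForm.push_apply, h0 i v hv]
  · rw [OneForm.push_apply, hd]

theorem matA (φ : Fin d → OneForm E M) (hφ : ∀ i, (φ i).SmoothAt x)
    (e : Fin d' → TangentSpace 𝓘(ℝ, E) x) (i : Fin d) (j : Fin d') :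
    S.matA (F x) (fun i => (φ i).push F) (fun i => tangentEquiv F x (e i)) i j =
      h.mapH x (S.matA x φ e i j) := by
  refine g_ext fun X => ?_
  obtain ⟨X, rfl⟩ := h.mapH_surjective X
  rw [g_mapH, matA_apply, matA_apply, g_alpha, g_alpha, coe_mapH, extDer_push (hφ i)]

theorem matS (φ : Fin d → OneForm E M) (hφ : ∀ i, (φ i).SmoothAt x)
    (e : Fin d → TangentSpace 𝓘(ℝ, E) x) (i j : Fin d) :
    S.matS (F x) (fun i => (φ i).push F) (fun i => tangentEquiv F x (e i)) i j =
      h.mapH x (S.matS x φ e i j) := by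
  rw [SubRiemannian.matS, h.matA φ hφ, h.matA φ hφ, ← map_add]
  rfl

theorem normSq_matA (φ : Fin d → OneForm E M) (hφ : ∀ i, (φ i).SmoothAt x)
    (e : Fin d' → TangentSpace 𝓘(ℝ, E) x) :
    S.normSq (F x) (S.matA (F x) (fun i => (φ i).push F) fun i => tangentEquiv F x (e i)) =
      S.normSq x (S.matA x φ e) := by
  simp only [normSq, h.matA φ hφ, g_mapH]

theorem normSq_matS (φ : Fin d → OneForm E M) (hφ : ∀ i, (φ i).SmoothAt x)
    (e : Fin d → TangentSpace 𝓘(ℝ, E) x) :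
    S.normSq (F x) (S.matS (F x) (fun i => (φ i).push F) fun i => tangentEquiv F x (e i)) =
      S.normSq x (S.matS x φ e) := by
  simp only [normSq, h.matS φ hφ, g_mapH]

theorem tr_matS (φ : Fin d → OneForm E M) (hφ : ∀ i, (φ i).SmoothAt x)
    (e : Fin d → TangentSpace 𝓘(ℝ, E) x) :
    S.tr (F x) (S.matS (F x) (fun i => (φ i).push F) fun i => tangentEquiv F x (e i)) =
      h.mapH x (S.tr x (S.matS x φ e)) := by
  simp only [tr, h.matS φ hφ, map_sum]

omit h in
/-- The pull-back of a family of distributions by a diffeomorphism. -/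
def pullRun (F : Diffeomorph 𝓘(ℝ, E) 𝓘(ℝ, E) M M ∞) (W : ℕ → ℕ → Distr E M) (m k : ℕ) : Distr E M :=
  fun x => (W m k (F x)).map (tangentEquiv F x).symm.toLinearMap

theorem isAdaptedCoframe (hr : S.IsEquiregular r) (hm : 1 ≤ m) (hmr : m ≤ r)
    {W : ℕ → ℕ → Distr E M} {φ : Fin d → OneForm E M}
    (hφ : S.IsAdaptedCoframe r (pullRun F W) m x φ) :
    (∀ i, (φ i).SmoothAt x) ∧ S.IsAdaptedCoframe r W m (F x) fun i => (φ i).push F := by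
  obtain ⟨O, hO, hx, hs, hc⟩ := hφ
  refine ⟨fun i => (hs i).smoothAt hO hx, F.symm ⁻¹' O, hO.preimage F.symm.continuous, by simpa,
    fun i => OneForm.smoothOn_of_smoothAt fun z hz => ?_, fun z hz => ?_⟩
  · obtain ⟨y, rfl⟩ := exists_apply_eq F z
    rw [Set.mem_preimage, F.symm_apply_apply] at hz
    exact ((hs i).smoothAt hO hz).push
  · obtain ⟨y, rfl⟩ := exists_apply_eq F z
    rw [Set.mem_preimage, F.symm_apply_apply] at hz
    refine ⟨h.isCoframeAt hr hm hmr (hc y hz).1, fun i j hj hjr w hw => ?_⟩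
    obtain ⟨v, rfl⟩ := (tangentEquiv F y).surjective w
    rw [OneForm.push_apply]
    exact (hc y hz).2 i j hj hjr v (mem_pull_iff.2 hw)

/-- Competitors, coframes and frames at `x` are transported to `F x`, where the norms and traces are
the same; the minimality of `W` there is that of the pulled-back family here. -/
theorem isMinimalRigidRun (hr : S.IsEquiregular r) {W : ℕ → ℕ → Distr E M}
    (hW : S.IsMinimalRigidRun r W) : S.IsMinimalRigidRun r (pullRun F W) where
  smooth m k h2 hm hk := (hW.smooth m k h2 hm hk).pull F
  sup_eq m k h2 hm hk x := by
    rw [← h.map_symm_flag hr hm, ← h.map_symm_flag (m := m - 1) hr (by omega),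
      ← hW.sup_eq m k h2 hm hk, Submodule.map_sup]
    rfl
  inf_eq m k h2 hm hk x := by
    rw [← h.map_symm_flag (m := k) hr (by omega), ← h.map_symm_flag (m := m - 1) hr (by omega),
      ← hW.inf_eq m k h2 hm hk, Submodule.map_inf _ (tangentEquiv F x).symm.injective]
    rfl
  nested m k h2 hm hk hkm x := Submodule.map_mono (hW.nested m k h2 hm hk hkm (F x))
  min_A m k hk hkm hm x d d' φ e e' hφ he heW heW' hsub hne := by
    obtain ⟨hs, hφ'⟩ := h.isAdaptedCoframe hr (by omega) (by omega) hφ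
    have := hW.min_A m k hk hkm hm (F x) d d' _ (fun i => tangentEquiv F x (e i))
      (fun i => tangentEquiv F x (e' i)) hφ' (h.isFrameAt hr (by omega) hm he)
      (fun j => mem_pull_iff.1 (heW j)) (fun j => mem_pull_iff.1 (heW' j))
      (fun j => by rw [← map_sub]; exact h.mem_flag (hsub j)) (by
        obtain ⟨j, hj⟩ := hne
        exact ⟨j, by rwa [← map_sub, h.mem_flag_iff hr (by omega)]⟩)
    rwa [h.normSq_matA φ hs, h.normSq_matA φ hs] at this
  min_S k hk hkr x d φ e e' hφ heW hd heW' hd' hne := by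
    obtain ⟨hs, hφ'⟩ := h.isAdaptedCoframe hr (by omega) (by omega) hφ
    have := hW.min_S k hk hkr (F x) d _ (fun i => tangentEquiv F x (e i))
      (fun i => tangentEquiv F x (e' i)) hφ'
      (fun j => mem_pull_iff.1 (heW j)) (fun i j => by rw [OneForm.push_apply, hd])
      (fun j => mem_pull_iff.1 (heW' j)) (fun i j => by rw [OneForm.push_apply, hd']) (by
        obtain ⟨j, hj⟩ := hne
        exact ⟨j, by rwa [← map_sub, h.mem_flag_iff hr (by omega)]⟩)
    rwa [h.normSq_matS φ hs, h.normSq_matS φ hs] at this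
  final hr2 x d φ e R hφ he hd hR := by
    have hs := fun m h2 hm => (h.isAdaptedCoframe hr (by omega) hm (hφ m h2 hm)).1
    have hφ' := fun m h2 hm => (h.isAdaptedCoframe hr (by omega) hm (hφ m h2 hm)).2
    obtain ⟨h1, h2⟩ := hW.final hr2 (F x) d (fun m i => (φ m i).push F)
      (fun m i => tangentEquiv F x (e m i)) (h.mapH x R) hφ'
      (fun m h2 hm j => mem_pull_iff.1 (he m h2 hm j))
      (fun m h2 hm i j => by rw [OneForm.push_apply, hd m h2 hm]) (by
        rw [hR, map_sum]
        refine Finset.sum_congr rfl fun m hm => ?_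
        rw [Finset.mem_Icc] at hm
        rw [h.tr_matS (φ m) (hs m (by omega) hm.2)])
    have h2s := hs 2 le_rfl hr2
    rw [h.tr_matS (φ 2) h2s, ← map_neg] at h1
    refine ⟨h.mapH_injective h1, fun f hf hfd hft hne => ?_⟩
    have := h2 (fun i => tangentEquiv F x (f i)) (fun j => mem_pull_iff.1 (hf j))
      (fun i j => by rw [OneForm.push_apply, hfd]) (by rw [h.tr_matS (φ 2) h2s, hft, map_neg])
      fun e => hne (funext fun i => (tangentEquiv F x).injective (congrFun e i))
    rwa [h.normSq_matS (φ 2) h2s, h.normSq_matS (φ 2) h2s] at this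

end IsWeakIsometry

/-- The pull-back of the run is a run, so it coincides with the run by uniqueness. -/
theorem IsMinimalRigidRun.isNatural {W : ℕ → ℕ → Distr E M} (hW : S.IsMinimalRigidRun r W)
    (hr : S.IsEquiregular r) (hJ : S.IsSemiJNondegenerate r) : S.IsNatural r fun m => W m 0 := by
  intro F hF m h2 hm x
  have h := congrFun (hW.unique (hF.isMinimalRigidRun hr hW) hr hJ h2 hm (k := 0) (by omega)) x
  refine le_antisymm ?_ fun w hw => ?_
  · rintro _ ⟨v, hv, rfl⟩
    change v ∈ W m 0 x at hv
    rw [← h] at hv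
    exact mem_pull_iff.1 hv
  · obtain ⟨v, rfl⟩ := (tangentEquiv F x).surjective w
    refine ⟨v, ?_, rfl⟩
    change v ∈ W m 0 x
    rw [← h]
    exact mem_pull_iff.2 hw

end SubRiemannian

end SubRiem

end

theorem theoremA {E : Type*} [NormedAddCommGroup E] [NormedSpace ℝ E] [FiniteDimensional ℝ E]
    {M : Type*} [TopologicalSpace M] [T2Space M] [SecondCountableTopology M]
    [ChartedSpace E M] [IsManifold 𝓘(ℝ, E) ∞ M]
    (S : SubRiem.SubRiemannian E M) (r : ℕ)
    (hr : S.IsEquiregular r) (hJ : S.IsSemiJNondegenerate r) :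
    ∃ (W : ℕ → ℕ → SubRiem.Distr E M) (V : ℕ → SubRiem.Distr E M),
      S.IsMinimalRigidRun r W ∧
      (∀ W' : ℕ → ℕ → SubRiem.Distr E M, S.IsMinimalRigidRun r W' →
        ∀ m k, 2 ≤ m → m ≤ r → k < m → W' m k = W m k) ∧
      (∀ m, V m = W m 0) ∧
      S.IsGradedComplement r V ∧ S.IsNatural r V ∧ S.IsVRigid r V := by
  obtain ⟨W, hW⟩ := hr.exists_isMinimalRigidRun hJ
  exact ⟨W, fun m => W m 0, hW,
    fun W' hW' m k h2 hm hk => hW.unique hW' hr hJ h2 hm hk, fun _ => rfl,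
    hW.isGradedComplement, hW.isNatural hr hJ, hW.isVRigid hr⟩
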